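/- **Conventions.** All complexes are finite cell complexes with a direction chosen on every edge, considered up to cell-preserving homeomorphism. Cell decompositions of a closed oriented surface are described by their vertices, edges, faces and the cyclic (counter-clockwise) order of the edges around each vertex; a 2-sphere complex is oriented as seen from outside. A complex is *regular* if the closures of its cells are embedded closed balls. A directed graph is *bipolar* from $n$ to $s$ if it has no directed cycle, the single source $n$ and the single sink $s$. A *closed planar Sturm complex* with North pole $n$ and South pole $s$ is a finite, regular, planar (closed, contractible) complex whose 1-skeleton is bipolar from $n$ to $s$, with $n,s$ on its boundary (a single vertex $n=s$ is allowed). A *3-cell template* is a finite regular cell complex $\mathcal C$ with directed edges such that (1) $\mathcal C=\operatorname{clos} c_{\mathcal O}=S^2\,\dot\cup\, c_{\mathcal O}$ is the closure of a single 3-cell; (2) the 1-skeleton is bipolar from a vertex $\mathbf N$ to a vertex $\mathbf S$, and there are two directed paths $\mathbf{WE}$, $\mathbf{EW}$ (the meridians) from $\mathbf N$ to $\mathbf S$, disjoint except for their end points, which decompose $S^2$ into two remaining components $\mathbf W$ and $\mathbf E$ (the hemispheres); (3) at end points on the meridians other than $\mathbf N,\mathbf S$, edges in $\mathbf W$ are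 directed towards the meridians and edges in $\mathbf E$ away from the meridians; (4) for each of the two meridians, the face in $\mathbf W$ at its first edge and the face in $\mathbf E$ at its last edge share at least one edge of that meridian. The *dual* of a directed 2-sphere complex has one vertex for each face, one edge $e^*$ for each edge $e$, and one face for each vertex; $e^*$ crosses $e$ once and is directed from the face to the left of $e$ to the face to the right of $e$. Conversely $e$, the *predual* of $e^*$, is directed from (the barycenter of) the face to the right of $e^*$ to that of the face to the left of $e^*$. **Lemma.** A two-dimensional complex $\mathcal C^{2,*}$ with directed edges is the dual of the boundary 2-sphere complex $\mathcal C^2=\partial c_{\mathcal O}$ of a 3-cell template $\mathcal C=\operatorname{clos} c_{\mathcal O}$ if and only if the following conditions all hold, for suitable choices of the objects named in (i). (i) $\mathcal C^{2,*}$ is a regular 2-sphere complex which decomposes into the disjoint union of (a) two (open) faces $\mathbf N^*$ and $\mathbf S^*$, the polar faces; (b) two subcomplexes $\mathbf W^*$ and $\mathbf E^*$, the Western and Eastern cores, which are closed planar Sturm complexes with North poles $w_-^0$, $w_+^0$ and South poles $w_-^1$, $w_+^1$, respectively; (c) two sets $\mathbf{EW}^*$ and $\mathbf{WE}^*$ of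 edges and faces, the meridian duals. (ii) All edges of the polar circle $\partial\mathbf N^*$ are directed clockwise around $\mathbf N^*$, and all edges of the polar circle $\partial\mathbf S^*$ are directed counter-clockwise around $\mathbf S^*$, as seen from outside the sphere. Moreover $\mathbf W^*\cap\partial\mathbf N^*\subset\partial\mathbf W^*$ is a directed path from $w_-^0$ to $w_-^1$, and $\mathbf E^*\cap\partial\mathbf S^*\subset\partial\mathbf E^*$ is a directed path from $w_+^0$ to $w_+^1$; these paths may be single vertices, and they are disjoint. (iii) The preduals of the edges in $\mathbf{EW}^*$ and in $\mathbf{WE}^*$ form two directed paths $\mathbf{EW}$ and $\mathbf{WE}$, respectively, from the barycenter $\mathbf N$ of $\mathbf N^*$ to the barycenter $\mathbf S$ of $\mathbf S^*$, disjoint except for their end points. (iv) There exist an edge in $\mathbf{WE}^*$ directed from $w_+^1$ to $w_-^0$, and an edge in $\mathbf{EW}^*$ directed from $w_-^1$ to $w_+^0$. -/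

import Mathlib

/-!
Finite cell decompositions of closed oriented surfaces, with a direction chosen on every edge, are
encoded as combinatorial maps (rotation systems).  A dart is an edge together with one of its two
senses of traversal; the vertices, edges and faces are the orbits of three permutations of the
darts.  This determines the decomposition up to cell-preserving orientation-preserving
homeomorphism.  All left/right and (counter-)clockwise conventions refer to the orientation of the
surface; for a sphere, it is the standard planar orientation seen from outside.
-/

/-- A cell decomposition of a closed oriented surface with directed edges, on the dart set `D`.
* `rot d` is the next dart counter-clockwise around the starting vertex of `d`;
* `opp d` is the same edge traversed in the opposite sense;
* `dir d` says that the dart `d` is traversed along the chosen direction of its edge (exactly one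
  of `d`, `opp d` is; in particular `opp` has no fixed point). -/
structure DirectedComplex (D : Type*) where
  rot : Equiv.Perm D
  opp : Equiv.Perm D
  opp_opp : ∀ d, opp (opp d) = d
  dir : D → Prop
  dir_opp : ∀ d, dir (opp d) ↔ ¬ dir d

/-- `IsDirectedWalk src tgt a b l`: the successive steps of `l`, a step `d` leading from `src d` to
`tgt d`, lead from `a` to `b`. -/
def IsDirectedWalk {D X : Type*} (src tgt : D → X) : X → X → List D → Prop
  | a, b, [] => a = b
  | a, b, d :: l => src d = a ∧ IsDirectedWalk src tgt (tgt d) b l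

/-- A directed walk without repeated vertices. -/
def IsDirectedPath {D X : Type*} (src tgt : D → X) (a b : X) (l : List D) : Prop :=
  IsDirectedWalk src tgt a b l ∧ (a :: l.map tgt).Nodup

/-- Two paths from `a` to `b` are disjoint, except for their common end points: they share no step
and no vertex other than `a` and `b`. -/
def PathsDisjoint {D X : Type*} (tgt : D → X) (a b : X) (p q : List D) : Prop :=
  (∀ d ∈ p, d ∉ q) ∧ ∀ x ∈ a :: p.map tgt, x ∈ a :: q.map tgt → x = a ∨ x = b

namespace DirectedComplex

variable {D : Type*} (M : DirectedComplex D)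

/-- `facePerm d` is the dart that follows `d` along the boundary of the face to the left of `d`,
traversed counter-clockwise. -/
def facePerm : Equiv.Perm D := M.opp.trans M.rot.symm

/-- Vertices. -/
abbrev V : Type _ := Quotient (Equiv.Perm.SameCycle.setoid M.rot)

/-- Edges. -/
abbrev E : Type _ := Quotient (Equiv.Perm.SameCycle.setoid M.opp)

/-- Faces. -/
abbrev F : Type _ := Quotient (Equiv.Perm.SameCycle.setoid M.facePerm)

/-- The starting vertex of a dart. -/
def src (d : D) : M.V := Quotient.mk _ d

/-- The end vertex of a dart. -/
def tgt (d : D) : M.V := M.src (M.opp d)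

/-- The edge of a dart. -/
def edge (d : D) : M.E := Quotient.mk _ d

/-- The face to the left of a dart. -/
def left (d : D) : M.F := Quotient.mk _ d

/-- The face to the right of a dart. -/
def right (d : D) : M.F := M.left (M.opp d)

/-- The oriented dual.  Its vertices are the faces of `M`.  The dual of a dart `d` crosses `d` from
left to right: it starts in the face to the left of `d` and ends in the face to the right of `d`.
The dual of a directed dart is directed.  Counter-clockwise around the barycenter of a face, the
crossed darts are those of its counter-clockwise boundary, whence the rotation `facePerm`. -/
def dual : DirectedComplex D where
  rot := M.facePerm
  opp := M.opp
  opp_opp := M.opp_opp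
  dir := M.dir
  dir_opp := M.dir_opp

/-- Edges on the boundary of a face. -/
def faceEdges (f : M.F) : Set M.E := {e | ∃ d, M.left d = f ∧ M.edge d = e}

/-- Vertices on the boundary of a face. -/
def faceVertices (f : M.F) : Set M.V := {v | ∃ d, M.left d = f ∧ M.src d = v}

/-- The complex is regular: edges have two distinct end points, and the boundary of every face is an
embedded circle, i.e. passes through no edge and through no vertex twice. -/
def IsRegular : Prop :=
  (∀ d, M.src d ≠ M.tgt d) ∧ (∀ d, M.left d ≠ M.right d) ∧
    ∀ d d', M.left d = M.left d' → M.src d = M.src d' → d = d'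

/-- `u` and `v` are joined by an (undirected) path with edges in `B`. -/
def Joined (B : Set M.E) : M.V → M.V → Prop :=
  Relation.EqvGen fun u v => ∃ d, M.edge d ∈ B ∧ M.src d = u ∧ M.tgt d = v

/-- The surface is a 2-sphere: connected, with Euler characteristic 2. -/
def IsSphere : Prop :=
  (∀ u v, M.Joined Set.univ u v) ∧
    (Nat.card M.V : ℤ) - (Nat.card M.E : ℤ) + (Nat.card M.F : ℤ) = 2

/-- A set of (open) cells of `M`. -/
structure Cells where
  verts : Set M.V
  edges : Set M.E
  faces : Set M.F

variable {M}

/-- The set of cells is closed, i.e. a subcomplex. -/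
def Cells.IsClosed (K : M.Cells) : Prop :=
  (∀ d, M.edge d ∈ K.edges → M.src d ∈ K.verts) ∧ ∀ d, M.left d ∈ K.faces → M.edge d ∈ K.edges

/-- Vertices on the topological boundary of a subcomplex: not surrounded by faces of it. -/
def Cells.bdryVerts (K : M.Cells) : Set M.V :=
  {v | v ∈ K.verts ∧ ∃ d, M.src d = v ∧ M.left d ∉ K.faces}

/-- Edges on the topological boundary of a subcomplex: not between two faces of it. -/
def Cells.bdryEdges (K : M.Cells) : Set M.E :=
  {e | e ∈ K.edges ∧ ∃ d, M.edge d = e ∧ M.left d ∉ K.faces}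

/-- The directed 1-skeleton of `K` has no directed cycle, the single source `n` and the single
sink `s`. -/
def Cells.IsBipolar (K : M.Cells) (n s : M.V) : Prop :=
  (∀ v, ¬ Relation.TransGen
    (fun u u' => ∃ d, M.dir d ∧ M.edge d ∈ K.edges ∧ M.src d = u ∧ M.tgt d = u') v v) ∧
  (∀ v, (v ∈ K.verts ∧ ∀ d, M.dir d → M.edge d ∈ K.edges → M.tgt d ≠ v) ↔ v = n) ∧
  (∀ v, (v ∈ K.verts ∧ ∀ d, M.dir d → M.edge d ∈ K.edges → M.src d ≠ v) ↔ v = s)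

/-- For a subcomplex `K` of a sphere which misses some face, i.e. a planar complex: contractible
means connected with vanishing first Betti number, i.e. connected with Euler characteristic 1. -/
def Cells.IsContractible (K : M.Cells) : Prop :=
  K.verts.Nonempty ∧ (∀ u ∈ K.verts, ∀ v ∈ K.verts, M.Joined K.edges u v) ∧
    (K.verts.ncard : ℤ) - (K.edges.ncard : ℤ) + (K.faces.ncard : ℤ) = 1

/-- A set of cells of a regular sphere complex is a closed planar Sturm complex with North pole `n`
and South pole `s`: it is a subcomplex, planar (some face of the sphere is missing), contractible,
and its 1-skeleton is bipolar from `n` to `s`, with both poles on the boundary. -/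
def Cells.IsPlanarSturm (K : M.Cells) (n s : M.V) : Prop :=
  K.IsClosed ∧ (∃ f, f ∉ K.faces) ∧ K.IsContractible ∧ K.IsBipolar n s ∧
    n ∈ K.bdryVerts ∧ s ∈ K.bdryVerts

variable (M)

/-- All cells. -/
def allCells : M.Cells := ⟨Set.univ, Set.univ, Set.univ⟩

/-- The single (open) face `f`. -/
def faceCell (f : M.F) : M.Cells := ⟨∅, ∅, {f}⟩

/-- The complex is the disjoint union of the listed sets of cells. -/
def DecomposesInto {k : ℕ} (P : Fin k → M.Cells) : Prop :=
  (∀ v, ∃! i, v ∈ (P i).verts) ∧ (∀ e, ∃! i, e ∈ (P i).edges) ∧ ∀ f, ∃! i, f ∈ (P i).faces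

/-! ### 3-cell templates -/

/-- The edges of two lists of darts. -/
def pathEdges (p q : List D) : Set M.E := {e | ∃ d, (d ∈ p ∨ d ∈ q) ∧ M.edge d = e}

/-- The vertices of two paths which start at `a`. -/
def pathVerts (a : M.V) (p q : List D) : Set M.V :=
  {v | v ∈ a :: p.map M.tgt ∨ v ∈ a :: q.map M.tgt}

/-- Two faces can be joined without crossing an edge in `B`. -/
def FacesJoinedOff (B : Set M.E) : M.F → M.F → Prop :=
  Relation.EqvGen fun f g => ∃ d, M.edge d ∉ B ∧ M.left d = f ∧ M.right d = g

/-- `W` and `Ea` are the sets of faces of the two components that remain of the surface when the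
cycle with edges `B` is removed. -/
def AreHemispheres (B : Set M.E) (W Ea : Set M.F) : Prop :=
  W.Nonempty ∧ Ea.Nonempty ∧ IsCompl W Ea ∧
    ∀ f g, M.FacesJoinedOff B f g ↔ (f ∈ W ↔ g ∈ W)

/-- The face in `W` at the first edge of the path `p` and the face in `Ea` at the last edge of `p`
share an edge of `p`. -/
def Overlap (W Ea : Set M.F) (p : List D) : Prop :=
  ∃ f ∈ W, ∃ g ∈ Ea, (∃ a ∈ p.head?, M.edge a ∈ M.faceEdges f) ∧
    (∃ b ∈ p.getLast?, M.edge b ∈ M.faceEdges g) ∧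
    ∃ d ∈ p, M.edge d ∈ M.faceEdges f ∧ M.edge d ∈ M.faceEdges g

/-- The complex is the boundary 2-sphere complex of a 3-cell template with oriented 1-skeleton.  (A
finite regular complex which is the closure of a single 3-cell consists of that cell and of a
regular cell decomposition of its boundary sphere.)

Here `N`, `S` are the poles, `WE`, `EW` the meridians, `W`, `Ea` the sets of faces in the Western
and Eastern hemispheres.  An edge off the meridians lies in the hemisphere of its adjacent faces. -/
def IsTemplateBoundary : Prop :=
  M.IsSphere ∧ M.IsRegular ∧
  ∃ (N S : M.V) (WE EW : List D) (W Ea : Set M.F),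
    -- bipolar orientation, meridian paths and hemispheres
    M.allCells.IsBipolar N S ∧
    ((∀ d ∈ WE, M.dir d) ∧ IsDirectedPath M.src M.tgt N S WE) ∧
    ((∀ d ∈ EW, M.dir d) ∧ IsDirectedPath M.src M.tgt N S EW) ∧
    PathsDisjoint M.tgt N S WE EW ∧
    M.AreHemispheres (M.pathEdges WE EW) W Ea ∧
    -- edge directions at the meridians
    (∀ d, M.dir d → M.edge d ∉ M.pathEdges WE EW → M.left d ∈ W →
      M.src d ∈ M.pathVerts N WE EW → M.src d = N ∨ M.src d = S) ∧
    (∀ d, M.dir d → M.edge d ∉ M.pathEdges WE EW → M.left d ∈ Ea →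
      M.tgt d ∈ M.pathVerts N WE EW → M.tgt d = N ∨ M.tgt d = S) ∧
    -- overlaps
    M.Overlap W Ea WE ∧ M.Overlap W Ea EW

/-! ### The characterizing conditions on the dual -/

/-- The intersection of the set of cells `K` with the boundary circle of the face `f` is a directed
path from `a` to `b`, contained in the boundary of `K`. -/
def IsPolarSegment (K : M.Cells) (f : M.F) (a b : M.V) : Prop :=
  (∃ l : List D, (∀ d ∈ l, M.dir d) ∧ IsDirectedPath M.src M.tgt a b l ∧
    K.verts ∩ M.faceVertices f = {v | v ∈ a :: l.map M.tgt} ∧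
    K.edges ∩ M.faceEdges f = {e | e ∈ l.map M.edge}) ∧
  K.verts ∩ M.faceVertices f ⊆ K.bdryVerts ∧ K.edges ∩ M.faceEdges f ⊆ K.bdryEdges

/-- The conditions (i)--(iv) on a dual complex.  Here `N`, `S` are the polar faces, `W`, `Ea` the
Western and Eastern cores, with North poles `wW0`, `wE0` and South poles `wW1`, `wE1`, and `EW`,
`WE` the meridian duals.  The pre-dual of a directed edge runs from (the barycenter of) the face to
its right to (the barycenter of) the face to its left. -/
def DualConditions : Prop :=
  -- (i) decomposition
  M.IsSphere ∧ M.IsRegular ∧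
  ∃ (N S : M.F) (W Ea EW WE : M.Cells) (wW0 wW1 wE0 wE1 : M.V),
    M.DecomposesInto ![M.faceCell N, M.faceCell S, W, Ea, EW, WE] ∧
    W.IsPlanarSturm wW0 wW1 ∧ Ea.IsPlanarSturm wE0 wE1 ∧
    EW.verts = ∅ ∧ WE.verts = ∅ ∧
    -- (ii) polar circles: clockwise around `N`, counter-clockwise around `S`; polar segments
    (∀ d, M.dir d → M.edge d ∈ M.faceEdges N → M.right d = N) ∧
    (∀ d, M.dir d → M.edge d ∈ M.faceEdges S → M.left d = S) ∧
    M.IsPolarSegment W N wW0 wW1 ∧ M.IsPolarSegment Ea S wE0 wE1 ∧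
    Disjoint (W.verts ∩ M.faceVertices N) (Ea.verts ∩ M.faceVertices S) ∧
    -- (iii) pre-duals of the meridian edges
    (∃ p q : List D,
      ((∀ d ∈ p, M.dir d) ∧ IsDirectedPath M.right M.left N S p ∧
        EW.edges = {e | e ∈ p.map M.edge}) ∧
      ((∀ d ∈ q, M.dir d) ∧ IsDirectedPath M.right M.left N S q ∧
        WE.edges = {e | e ∈ q.map M.edge}) ∧
      PathsDisjoint M.left N S p q) ∧
    -- (iv) polar bridges
    (∃ d, M.dir d ∧ M.edge d ∈ WE.edges ∧ M.src d = wE1 ∧ M.tgt d = wW0) ∧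
    (∃ d, M.dir d ∧ M.edge d ∈ EW.edges ∧ M.src d = wW1 ∧ M.tgt d = wE0)

end DirectedComplex

/-! Everything rests on one homological fact about the sphere. Coboundaries of vertex functions and
boundaries of face functions are orthogonal, and Euler characteristic 2 makes them span all
antisymmetric functions of darts (`IsSphere.exists_hodge`). Hence a closed walk in the dual graph is
the jump of a vertex potential, and a closed walk in the graph is the jump of a face potential
(`IsSphere.exists_vertex_potential`, `IsSphere.exists_face_potential`). This replaces the Jordan
curve theorem. If the walk is directed, its potential is monotone along all directed edges,
respectively along their duals.

From the template to the dual: the face potential of the meridian cycle shows that, up to exchanging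
names, the Western hemisphere lies to the right of `WE` and to the left of `EW`. The cores are the
duals of the open hemispheres. A directed cycle in a core would yield a vertex potential that is
monotone along all edges and constant along `WE`, hence equal at both poles, hence constant: a
contradiction. A face of `W` without incoming dual edge in the core has a local source on its
boundary, which the edge directions at the meridians force to be `N`; so it is the face at the first
edge of `WE`, and the other three core poles are found alike. Both cores have Euler characteristic
at most 1, while their sum is at least 2, so both are contractible. The overlap edges are the polar
bridges.

From the dual to the template: the bridges make the dual 1-skeleton strongly connected, so the face
potential of a directed cycle is constant, and there is no such cycle. A source or sink off the
meridians would be circled by a directed dual cycle inside a core. For the edge directions at a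
meridian, the closed dual curve through the bridge and back across a meridian edge `b` has a
potential (`Meridian.exists_potential`) that excludes a second outgoing edge after the bridge and a
second incoming edge before it. At the remaining vertices the core pole next to the polar face
propagates along the meridian up to the bridge and fills the whole sector on its side (`sector`),
leaving no room for a wrongly directed edge. -/

namespace DirectedComplex

variable {D : Type*} (M : DirectedComplex D)

/-! ### Incidences of darts, edges and faces. -/

theorem src_eq_iff {d d' : D} : M.src d = M.src d' ↔ M.rot.SameCycle d d' := Quotient.eq

theorem left_eq_iff {d d' : D} : M.left d = M.left d' ↔ M.facePerm.SameCycle d d' := Quotient.eq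

@[simp] theorem src_rot (d : D) : M.src (M.rot d) = M.src d :=
  M.src_eq_iff.2 (Equiv.Perm.sameCycle_apply_left.2 (Equiv.Perm.SameCycle.refl _ _))

@[simp] theorem left_facePerm (d : D) : M.left (M.facePerm d) = M.left d :=
  M.left_eq_iff.2 (Equiv.Perm.sameCycle_apply_left.2 (Equiv.Perm.SameCycle.refl _ _))

theorem facePerm_apply (d : D) : M.facePerm d = M.rot.symm (M.opp d) := rfl

theorem rot_facePerm (d : D) : M.rot (M.facePerm d) = M.opp d := by simp [facePerm_apply]

theorem facePerm_opp_rot (d : D) : M.facePerm (M.opp (M.rot d)) = d := by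
  simp [facePerm_apply, M.opp_opp]

@[simp] theorem src_opp (d : D) : M.src (M.opp d) = M.tgt d := rfl

@[simp] theorem tgt_opp (d : D) : M.tgt (M.opp d) = M.src d := by simp [tgt, M.opp_opp, -src_opp]

@[simp] theorem left_opp (d : D) : M.left (M.opp d) = M.right d := rfl

@[simp] theorem right_opp (d : D) : M.right (M.opp d) = M.left d := by
  simp [right, M.opp_opp, -left_opp]

@[simp] theorem src_facePerm (d : D) : M.src (M.facePerm d) = M.tgt d := by
  rw [← M.src_rot, rot_facePerm, src_opp]

@[simp] theorem right_rot (d : D) : M.right (M.rot d) = M.left d := by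
  rw [← left_opp, ← M.left_facePerm, facePerm_opp_rot]

theorem edge_eq_iff {d d' : D} : M.edge d = M.edge d' ↔ d' = d ∨ d' = M.opp d := by
  have h : M.edge d = M.edge d' ↔ M.opp.SameCycle d d' := Quotient.eq
  rw [h]
  constructor
  · rintro ⟨i, rfl⟩
    rcases Int.even_or_odd' i with ⟨k, rfl | rfl⟩
    · left
      have : M.opp ^ (2 : ℤ) = 1 := by
        ext x; rw [zpow_two, Equiv.Perm.mul_apply, M.opp_opp]; rfl
      rw [zpow_mul, this]; simp
    · right
      have : M.opp ^ (2 : ℤ) = 1 := by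
        ext x; rw [zpow_two, Equiv.Perm.mul_apply, M.opp_opp]; rfl
      rw [zpow_add, zpow_mul, this]; simp
  · rintro (rfl | rfl)
    · exact Equiv.Perm.SameCycle.refl _ _
    · exact Equiv.Perm.sameCycle_apply_right.2 (Equiv.Perm.SameCycle.refl _ _)

@[simp] theorem edge_opp (d : D) : M.edge (M.opp d) = M.edge d := by
  rw [eq_comm, edge_eq_iff]; simp

theorem eq_of_edge_eq {d d' : D} (hd : M.dir d) (hd' : M.dir d') (h : M.edge d = M.edge d') :
    d = d' := by
  rcases M.edge_eq_iff.1 h with rfl | rfl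
  · rfl
  · exact absurd hd ((M.dir_opp d).1 hd')

theorem exists_src (v : M.V) : ∃ d, M.src d = v := Quotient.exists_rep v

theorem exists_left (f : M.F) : ∃ d, M.left d = f := Quotient.exists_rep f

theorem exists_edge (e : M.E) : ∃ d, M.dir d ∧ M.edge d = e := by
  obtain ⟨d, rfl⟩ : ∃ d, M.edge d = e := Quotient.exists_rep e
  by_cases h : M.dir d
  · exact ⟨d, h, rfl⟩
  · exact ⟨M.opp d, (M.dir_opp d).2 h, by simp⟩

theorem dir_or_dir_opp (d : D) : M.dir d ∨ M.dir (M.opp d) := by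
  rw [M.dir_opp]; exact em _

/-! ### Chains and cochains -/

section Chains

variable [Fintype D]

theorem sum_opp (z : D → ℝ) : ∑ d, z (M.opp d) = ∑ d, z d := Equiv.sum_comp M.opp z

/-- Coboundaries of vertex functions are orthogonal to boundaries of face functions. -/
theorem sum_coboundary_mul_boundary (g : M.V → ℝ) (h : M.F → ℝ) :
    ∑ d, (g (M.tgt d) - g (M.src d)) * (h (M.left d) - h (M.right d)) = 0 := by
  -- Reindexing by `facePerm` keeps the left face and replaces the end of a dart by the start of the
  -- next; the other two identities reindex by `opp`.
  have e1 : ∑ d, g (M.tgt d) * h (M.left d) = ∑ d, g (M.src d) * h (M.left d) := by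
    rw [← Equiv.sum_comp M.facePerm (fun d => g (M.src d) * h (M.left d))]
    simp
  have e2 : ∑ d, g (M.tgt d) * h (M.right d) = ∑ d, g (M.src d) * h (M.left d) := by
    rw [← M.sum_opp (fun d => g (M.src d) * h (M.left d))]; simp
  have e3 : ∑ d, g (M.src d) * h (M.right d) = ∑ d, g (M.tgt d) * h (M.left d) := by
    rw [← M.sum_opp (fun d => g (M.tgt d) * h (M.left d))]; simp
  simp only [sub_mul, mul_sub, Finset.sum_sub_distrib]
  linarith

end Chains

theorem Joined.eq_of_invariant {B : Set M.E} {X : Type*} (g : M.V → X)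
    (hg : ∀ d, M.edge d ∈ B → g (M.src d) = g (M.tgt d)) {u v : M.V} (h : M.Joined B u v) :
    g u = g v := by
  induction h with
  | rel u v h => obtain ⟨d, hd, rfl, rfl⟩ := h; exact hg d hd
  | refl => rfl
  | symm _ _ _ ih => exact ih.symm
  | trans _ _ _ _ _ ih1 ih2 => exact ih1.trans ih2

/-- In a connected surface any two faces can be joined by crossing edges. -/
theorem eq_of_left_eq_right [Finite D] (hM : ∀ u v, M.Joined Set.univ u v) {X : Type*} (h : M.F → X)
    (hh : ∀ d, h (M.left d) = h (M.right d)) (f f' : M.F) : h f = h f' := by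
  have hrot : ∀ d, h (M.left (M.rot d)) = h (M.left d) := fun d => by rw [hh, right_rot]
  have hs : ∀ d d', M.src d = M.src d' → h (M.left d) = h (M.left d') := by
    intro d d' e
    obtain ⟨n, rfl⟩ := (M.src_eq_iff.1 e).exists_nat_pow_eq
    induction n with
    | zero => rfl
    | succ n ih =>
      rw [pow_succ', Equiv.Perm.mul_apply, hrot]
      exact ih ((M.src_eq_iff.2 ⟨n, rfl⟩))
  obtain ⟨d, rfl⟩ := M.exists_left f
  obtain ⟨d', rfl⟩ := M.exists_left f'
  let g : M.V → X := fun v => h (M.left (M.exists_src v).choose)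
  have hg : ∀ d, g (M.src d) = h (M.left d) := fun d => hs _ _ (M.exists_src (M.src d)).choose_spec
  have := Joined.eq_of_invariant M g (fun d _ => by
    rw [hg, ← M.src_opp, hg, hh, left_opp]) (hM (M.src d) (M.src d'))
  rwa [hg, hg] at this

/-- The darts in `edges`, traversed along their direction, correspond to `edges`. -/
theorem card_dir_darts (B : Set M.E) : Nat.card {d // M.dir d ∧ M.edge d ∈ B} = B.ncard := by
  refine Nat.card_congr (Equiv.ofBijective (fun d => ⟨M.edge d.1, d.2.2⟩) ⟨?_, ?_⟩)
  · rintro ⟨d, hd⟩ ⟨d', hd'⟩ h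
    simp only [Subtype.mk.injEq] at h
    exact Subtype.ext (M.eq_of_edge_eq hd.1 hd'.1 h)
  · rintro ⟨e, he⟩
    obtain ⟨d, hd, rfl⟩ := M.exists_edge e
    exact ⟨⟨d, hd, he⟩, rfl⟩

/-! ### Euler characteristic and potentials. -/

section Euler

open Classical in
/-- Extension of a function by zero. -/
noncomputable def extendZero {X : Type*} (P : X → Prop) : ({x // P x} → ℝ) →ₗ[ℝ] (X → ℝ) where
  toFun f x := if h : P x then f ⟨x, h⟩ else 0
  map_add' f g := by ext x; by_cases h : P x <;> simp [h]
  map_smul' c f := by ext x; by_cases h : P x <;> simp [h]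

theorem extendZero_of {X : Type*} {P : X → Prop} (f : {x // P x} → ℝ) (x : {x // P x}) :
    extendZero P f x = f x := by simp [extendZero, x.2]

theorem extendZero_of_not {X : Type*} {P : X → Prop} (f : {x // P x} → ℝ) {x : X} (h : ¬ P x) :
    extendZero P f x = 0 := by simp [extendZero, h]

variable {M}

/-- The sum of the coboundary of a function on the vertices other than `v₀` and the boundary of a
function on the faces. -/
noncomputable def Cells.hodge (K : M.Cells) (v₀ : M.V) :
    (({v // v ∈ K.verts ∧ v ≠ v₀} → ℝ) × ({f // f ∈ K.faces} → ℝ)) →ₗ[ℝ]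
      ({d // M.dir d ∧ M.edge d ∈ K.edges} → ℝ) where
  toFun x d :=
    (extendZero _ x.1 (M.tgt d.1) - extendZero _ x.1 (M.src d.1)) +
      (extendZero _ x.2 (M.left d.1) - extendZero _ x.2 (M.right d.1))
  map_add' x y := by ext d; simp; ring
  map_smul' c x := by ext d; simp; ring

/-- If coboundary and boundary cancel on `K`, orthogonality makes both vanish. A face function
without jumps is constant, and zero at the missing face `f₀`; a vertex function without jumps along
the connected `K` is zero because it is at `v₀`. -/
theorem Cells.hodge_injective [Finite D] (hM : ∀ u v, M.Joined Set.univ u v) (K : M.Cells)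
    (hK : K.IsClosed) (hc : ∀ u ∈ K.verts, ∀ v ∈ K.verts, M.Joined K.edges u v)
    {v₀ : M.V} (hv₀ : v₀ ∈ K.verts) {f₀ : M.F} (hf₀ : f₀ ∉ K.faces) :
    Function.Injective (K.hodge v₀) := by
  have := Fintype.ofFinite D
  rw [injective_iff_map_eq_zero]
  rintro ⟨x, y⟩ hxy
  set g := extendZero _ x with hg
  set h := extendZero _ y with hh
  have hdir : ∀ d, M.dir d → M.edge d ∈ K.edges →
      (g (M.tgt d) - g (M.src d)) + (h (M.left d) - h (M.right d)) = 0 := fun d h1 h2 =>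
    congrFun hxy ⟨d, h1, h2⟩
  have hall : ∀ d, M.edge d ∈ K.edges →
      (g (M.tgt d) - g (M.src d)) + (h (M.left d) - h (M.right d)) = 0 := by
    intro d hd
    rcases M.dir_or_dir_opp d with h' | h'
    · exact hdir d h' hd
    · have := hdir _ h' (by simpa using hd)
      simp only [tgt_opp, src_opp, left_opp, right_opp] at this
      linarith
  -- An edge off the closed `K` borders no face of `K`, so `h` is the zero extension on both sides.
  have hoff : ∀ d, M.edge d ∉ K.edges → h (M.left d) - h (M.right d) = 0 := by
    intro d hd
    rw [hh, extendZero_of_not _ fun hl => hd (hK.2 d hl),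
      extendZero_of_not _ fun hl => hd (by simpa using hK.2 (M.opp d) hl), sub_zero]
  have hsq : ∀ d, h (M.left d) - h (M.right d) = 0 := by
    have h0 : ∑ d, (h (M.left d) - h (M.right d)) ^ 2 = 0 := by
      rw [← neg_eq_zero, ← Finset.sum_neg_distrib, ← M.sum_coboundary_mul_boundary g h]
      refine Finset.sum_congr rfl fun d _ => ?_
      by_cases hd : M.edge d ∈ K.edges
      · rw [eq_neg_of_add_eq_zero_left (hall d hd)]; ring
      · rw [hoff d hd]; ring
    rw [Finset.sum_eq_zero_iff_of_nonneg fun _ _ => sq_nonneg _] at h0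
    exact fun d => pow_eq_zero_iff two_ne_zero |>.1 (h0 d (Finset.mem_univ d))
  have hh0 : ∀ f, h f = 0 := fun f => by
    rw [M.eq_of_left_eq_right hM h (fun d => sub_eq_zero.1 (hsq d)) f f₀, hh,
      extendZero_of_not _ hf₀]
  have hg0 : ∀ v ∈ K.verts, g v = 0 := fun v hv => by
    rw [Joined.eq_of_invariant M g (fun d hd => ?_) (hc v hv v₀ hv₀), hg,
      extendZero_of_not _ (by simp)]
    have := hall d hd
    rw [hsq d] at this
    linarith
  ext z
  · refine (extendZero_of x z).symm.trans ?_; exact hg0 _ z.2.1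
  · refine (extendZero_of y z).symm.trans ?_; exact hh0 _

theorem Cells.card_verts_ne [Finite D] {K : M.Cells} {v₀ : M.V} (hv₀ : v₀ ∈ K.verts) :
    Nat.card {v // v ∈ K.verts ∧ v ≠ v₀} + 1 = K.verts.ncard := by
  have : Nat.card {v // v ∈ K.verts ∧ v ≠ v₀} = (K.verts \ {v₀}).ncard := rfl
  rw [this]
  exact Set.ncard_sdiff_singleton_add_one hv₀ (Set.toFinite _)

/-- A connected subcomplex with a missing face has Euler characteristic at most one. -/
theorem Cells.euler_le [Finite D] (hM : ∀ u v, M.Joined Set.univ u v) (K : M.Cells)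
    (hK : K.IsClosed) (hc : ∀ u ∈ K.verts, ∀ v ∈ K.verts, M.Joined K.edges u v)
    (hv : K.verts.Nonempty) {f₀ : M.F} (hf₀ : f₀ ∉ K.faces) :
    K.verts.ncard + K.faces.ncard ≤ K.edges.ncard + 1 := by
  obtain ⟨v₀, hv₀⟩ := hv
  have := Fintype.ofFinite {v // v ∈ K.verts ∧ v ≠ v₀}
  have := Fintype.ofFinite {f // f ∈ K.faces}
  have := Fintype.ofFinite {d // M.dir d ∧ M.edge d ∈ K.edges}
  have h := LinearMap.finrank_le_finrank_of_injective (K.hodge_injective hM hK hc hv₀ hf₀)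
  rw [Module.finrank_prod, Module.finrank_fintype_fun_eq_card, Module.finrank_fintype_fun_eq_card,
    Module.finrank_fintype_fun_eq_card, ← Nat.card_eq_fintype_card, ← Nat.card_eq_fintype_card,
    ← Nat.card_eq_fintype_card, card_dir_darts] at h
  rw [← card_verts_ne hv₀]
  have : Nat.card {f // f ∈ K.faces} = K.faces.ncard := rfl
  omega

/-- On a sphere, every antisymmetric function of the darts is the sum of a coboundary and of a
boundary. -/
theorem IsSphere.exists_hodge [Finite D] (hM : M.IsSphere) (z : D → ℝ)
    (hz : ∀ d, z (M.opp d) = -z d) :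
    ∃ (g : M.V → ℝ) (h : M.F → ℝ), ∀ d,
      z d = (g (M.tgt d) - g (M.src d)) + (h (M.left d) - h (M.right d)) := by
  rcases isEmpty_or_nonempty D with hD | ⟨⟨d₀⟩⟩
  · exact ⟨fun _ => 0, fun _ => 0, fun d => isEmptyElim d⟩
  let f₀ := M.left d₀
  let v₀ := M.src d₀
  -- Dropping one vertex and one face from the sphere leaves (V − 1) + (F − 1) = E unknowns, so the
  -- injective map `K.hodge v₀` is also surjective.
  let K : M.Cells := ⟨Set.univ, Set.univ, {f₀}ᶜ⟩
  have hinj := K.hodge_injective hM.1 ⟨fun _ _ => trivial, fun _ _ => trivial⟩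
    (fun u _ v _ => hM.1 u v) (v₀ := v₀) trivial (f₀ := f₀) (by simp [K])
  have := Fintype.ofFinite {v // v ∈ K.verts ∧ v ≠ v₀}
  have := Fintype.ofFinite {f // f ∈ K.faces}
  have := Fintype.ofFinite {d // M.dir d ∧ M.edge d ∈ K.edges}
  have hfin : Module.finrank ℝ (({v // v ∈ K.verts ∧ v ≠ v₀} → ℝ) × ({f // f ∈ K.faces} → ℝ)) =
      Module.finrank ℝ ({d // M.dir d ∧ M.edge d ∈ K.edges} → ℝ) := by
    rw [Module.finrank_prod, Module.finrank_fintype_fun_eq_card, Module.finrank_fintype_fun_eq_card,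
      Module.finrank_fintype_fun_eq_card, ← Nat.card_eq_fintype_card, ← Nat.card_eq_fintype_card,
      ← Nat.card_eq_fintype_card, card_dir_darts]
    have h1 := Cells.card_verts_ne (K := K) (v₀ := v₀) trivial
    have h2 : Nat.card {f // f ∈ K.faces} + 1 = Nat.card M.F := by
      have : Nat.card {f // f ∈ K.faces} = ({f₀}ᶜ : Set M.F).ncard := rfl
      rw [this, ← Set.ncard_add_ncard_compl {f₀}, Set.ncard_singleton, add_comm]
    have h3 : K.verts.ncard = Nat.card M.V := Set.ncard_univ _
    have h4 : K.edges.ncard = Nat.card M.E := Set.ncard_univ _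
    have := hM.2
    omega
  obtain ⟨⟨x, y⟩, hxy⟩ := (LinearMap.injective_iff_surjective_of_finrank_eq_finrank hfin).1 hinj
    (fun d => z d.1)
  have hd : ∀ d (hd : M.dir d), z d = K.hodge v₀ (x, y) ⟨d, hd, trivial⟩ := fun d hd =>
    (congrFun hxy ⟨d, hd, trivial⟩).symm
  refine ⟨extendZero _ x, extendZero _ y, fun d => ?_⟩
  rcases M.dir_or_dir_opp d with h' | h'
  · exact hd d h'
  · have := hd _ h'
    simp only [Cells.hodge, LinearMap.coe_mk, AddHom.coe_mk, hz, tgt_opp, src_opp, left_opp,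
      right_opp] at this
    linarith

theorem sum_antisymm [Fintype D] {z : D → ℝ} (hz : ∀ d, z (M.opp d) = -z d) {X : Type*}
    (s : D → X) (h : X → ℝ) : ∑ d, h (s (M.opp d)) * z d = - ∑ d, h (s d) * z d := by
  rw [← M.sum_opp, ← Finset.sum_neg_distrib]
  exact Finset.sum_congr rfl fun d _ => by rw [hz, M.opp_opp]; ring

/-- The multiplicity with which a list of darts passes through a dart, counted with sign. -/
noncomputable def chain (M : DirectedComplex D) (l : List D) (d : D) : ℝ := by
  classical exact l.count d - l.count (M.opp d)

theorem chain_opp (l : List D) (d : D) : M.chain l (M.opp d) = -M.chain l d := by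
  simp [chain, M.opp_opp]

theorem chain_eq_zero {l : List D} {d : D} (h : d ∉ l) (h' : M.opp d ∉ l) : M.chain l d = 0 := by
  classical
  simp [chain, List.count_eq_zero_of_not_mem h, List.count_eq_zero_of_not_mem h']

theorem chain_nonneg {l : List D} {d : D} (h' : M.opp d ∉ l) : 0 ≤ M.chain l d := by
  classical
  simp [chain, List.count_eq_zero_of_not_mem h']

theorem chain_pos {l : List D} {d : D} (h : d ∈ l) (h' : M.opp d ∉ l) : 0 < M.chain l d := by
  classical
  simpa [chain, List.count_eq_zero_of_not_mem h'] using List.count_pos_iff.2 h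

theorem opp_not_mem {l : List D} (hl : ∀ d ∈ l, M.dir d) {d : D} (hd : M.dir d) : M.opp d ∉ l :=
  fun h => (M.dir_opp d).1 (hl _ h) hd

/-- The sum telescopes along the walk. Since the end of a step is read off from `opp`, this applies
both to vertices (`src`) and to faces (`left`). -/
theorem sum_mul_chain [Fintype D] {X : Type*} (s : D → X) (h : X → ℝ) (l : List D) {a b : X}
    (hl : IsDirectedWalk s (fun d => s (M.opp d)) a b l) :
    ∑ d, h (s d) * M.chain l d = h a - h b := by
  classical
  induction l generalizing a with
  | nil => simp only [IsDirectedWalk] at hl; simp [chain, hl]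
  | cons e l ih =>
    obtain ⟨rfl, hl⟩ := hl
    have h1 : ∀ d, M.chain (e :: l) d = M.chain l d + ((if e = d then 1 else 0) -
        (if M.opp e = d then 1 else 0)) := by
      intro d
      have : (e = M.opp d) ↔ (M.opp e = d) :=
        ⟨fun h => by rw [h, M.opp_opp], fun h => by rw [← h, M.opp_opp]⟩
      simp only [chain, List.count_cons, beq_iff_eq, this]
      push_cast
      ring
    simp only [h1, mul_add, mul_sub, Finset.sum_add_distrib, ih hl, Finset.sum_sub_distrib]
    simp

/-- A closed walk in the dual graph of a sphere is a coboundary. -/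
theorem IsSphere.exists_vertex_potential [Finite D] (hM : M.IsSphere) {l : List D} {f : M.F}
    (hl : IsDirectedWalk M.left M.right f f l) :
    ∃ g : M.V → ℝ, ∀ d, g (M.tgt d) - g (M.src d) = M.chain l d := by
  have := Fintype.ofFinite D
  obtain ⟨g, h, hz⟩ := hM.exists_hodge (M.chain l) (chain_opp l)
  refine ⟨g, fun d => ?_⟩
  have h0 : ∑ d, h (M.left d) * M.chain l d = 0 := by
    rw [sum_mul_chain M.left h l hl, sub_self]
  have h1 := sum_antisymm (M := M) (chain_opp l) M.left h
  rw [h0, neg_zero] at h1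
  -- The boundary part of the chain is orthogonal to the chain, because the dual walk is closed, and
  -- to the coboundary part; so its norm is zero.
  have h2 : ∑ d, (h (M.left d) - h (M.right d)) ^ 2 = 0 := by
    have h3 := M.sum_coboundary_mul_boundary g h
    have h4 : ∑ d, (h (M.left d) - h (M.right d)) * M.chain l d = 0 := by
      simp only [sub_mul, Finset.sum_sub_distrib, h0]
      simpa using h1
    rw [← h4, ← sub_eq_zero, ← Finset.sum_sub_distrib, ← neg_eq_zero, ← Finset.sum_neg_distrib,
      ← h3]
    exact Finset.sum_congr rfl fun d _ => by rw [hz]; ring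
  rw [Finset.sum_eq_zero_iff_of_nonneg fun _ _ => sq_nonneg _] at h2
  rw [hz, pow_eq_zero_iff two_ne_zero |>.1 (h2 d (Finset.mem_univ d)), add_zero]

/-- A closed walk on a sphere is a boundary. -/
theorem IsSphere.exists_face_potential [Finite D] (hM : M.IsSphere) {l : List D} {v : M.V}
    (hl : IsDirectedWalk M.src M.tgt v v l) :
    ∃ h : M.F → ℝ, ∀ d, h (M.right d) - h (M.left d) = M.chain l d := by
  have := Fintype.ofFinite D
  obtain ⟨g, h, hz⟩ := hM.exists_hodge (M.chain l) (chain_opp l)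
  refine ⟨fun f => - h f, fun d => ?_⟩
  have h0 : ∑ d, g (M.src d) * M.chain l d = 0 := by
    rw [sum_mul_chain M.src g l hl, sub_self]
  have h1 := sum_antisymm (M := M) (chain_opp l) M.src g
  rw [h0, neg_zero] at h1
  -- Here it is the coboundary part that is orthogonal to both, as the walk is closed on vertices.
  have h2 : ∑ d, (g (M.tgt d) - g (M.src d)) ^ 2 = 0 := by
    have h3 := M.sum_coboundary_mul_boundary g h
    have h4 : ∑ d, (g (M.tgt d) - g (M.src d)) * M.chain l d = 0 := by
      simp only [sub_mul, Finset.sum_sub_distrib, h0]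
      simpa using h1
    rw [← h4, ← sub_eq_zero, ← Finset.sum_sub_distrib, ← neg_eq_zero, ← Finset.sum_neg_distrib,
      ← h3]
    exact Finset.sum_congr rfl fun d _ => by rw [hz]; ring
  rw [Finset.sum_eq_zero_iff_of_nonneg fun _ _ => sq_nonneg _] at h2
  rw [hz, pow_eq_zero_iff two_ne_zero |>.1 (h2 d (Finset.mem_univ d)), zero_add]
  ring

end Euler

end DirectedComplex

/-! ### Directed walks -/

section Walks

variable {D X : Type*} {src tgt : D → X}

theorem IsDirectedWalk.append {a b c : X} {l l' : List D} (h : IsDirectedWalk src tgt a b l)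
    (h' : IsDirectedWalk src tgt b c l') : IsDirectedWalk src tgt a c (l ++ l') := by
  induction l generalizing a with
  | nil => cases h; exact h'
  | cons d l ih => exact ⟨h.1, ih h.2⟩

theorem isDirectedWalk_append_iff {a c : X} {l l' : List D} :
    IsDirectedWalk src tgt a c (l ++ l') ↔
      ∃ b, IsDirectedWalk src tgt a b l ∧ IsDirectedWalk src tgt b c l' := by
  refine ⟨fun h => ?_, fun ⟨b, h, h'⟩ => h.append h'⟩
  induction l generalizing a with
  | nil => exact ⟨a, rfl, h⟩
  | cons d l ih =>
    obtain ⟨b, h1, h2⟩ := ih h.2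
    exact ⟨b, ⟨h.1, h1⟩, h2⟩

theorem IsDirectedWalk.reverse {op : D → D} (h1 : ∀ d, src (op d) = tgt d)
    (h2 : ∀ d, tgt (op d) = src d) {a b : X} {l : List D} (h : IsDirectedWalk src tgt a b l) :
    IsDirectedWalk src tgt b a (l.map op).reverse := by
  induction l generalizing a with
  | nil => exact h.symm
  | cons d l ih =>
    rw [List.map_cons, List.reverse_cons]
    exact (ih h.2).append ⟨h1 d, (h2 d).trans h.1⟩

theorem IsDirectedWalk.mem_verts_iff {a b : X} {l : List D} (h : IsDirectedWalk src tgt a b l)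
    (x : X) : x ∈ a :: l.map tgt ↔ x ∈ l.map src ∨ x = b := by
  induction l generalizing a with
  | nil => cases h; simp
  | cons d l ih =>
    obtain ⟨rfl, h⟩ := h
    rw [List.mem_cons, List.map_cons, ih h, List.map_cons, List.mem_cons, or_assoc]

theorem IsDirectedWalk.src_mem {a b : X} {l : List D} (h : IsDirectedWalk src tgt a b l) {d : D}
    (hd : d ∈ l) : src d ∈ a :: l.map tgt :=
  (h.mem_verts_iff _).2 (Or.inl (List.mem_map_of_mem hd))

theorem IsDirectedPath.eq_of_tgt_eq {a b : X} {l : List D} (h : IsDirectedPath src tgt a b l)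
    {d d' : D} (hd : d ∈ l) (hd' : d' ∈ l) (e : tgt d = tgt d') : d = d' :=
  List.inj_on_of_nodup_map (List.nodup_cons.1 h.2).2 hd hd' e

theorem IsDirectedPath.tgt_ne_start {a b : X} {l : List D} (h : IsDirectedPath src tgt a b l)
    {d : D} (hd : d ∈ l) : tgt d ≠ a :=
  fun e => (List.nodup_cons.1 h.2).1 (e ▸ List.mem_map_of_mem hd)

theorem IsDirectedPath.tail {a b : X} {d : D} {l : List D}
    (h : IsDirectedPath src tgt a b (d :: l)) : IsDirectedPath src tgt (tgt d) b l :=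
  ⟨h.1.2, (List.nodup_cons.1 h.2).2⟩

theorem IsDirectedPath.src_ne_end {a b : X} {l : List D} (h : IsDirectedPath src tgt a b l)
    {d : D} (hd : d ∈ l) : src d ≠ b := by
  induction l generalizing a with
  | nil => cases hd
  | cons e l ih =>
    rcases List.mem_cons.1 hd with rfl | hd
    · rw [h.1.1]
      rintro rfl
      have := (h.tail.1.mem_verts_iff a).2 (Or.inr rfl)
      exact (List.nodup_cons.1 h.2).1 this
    · exact ih h.tail hd

theorem IsDirectedPath.eq_of_src_eq {a b : X} {l : List D} (h : IsDirectedPath src tgt a b l)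
    {d d' : D} (hd : d ∈ l) (hd' : d' ∈ l) (e : src d = src d') : d = d' := by
  induction l generalizing a with
  | nil => cases hd
  | cons c l ih =>
    have key : ∀ y ∈ l, src y ≠ src c := fun y hy hh => by
      have := h.tail.1.src_mem hy
      rw [hh, h.1.1] at this
      exact (List.nodup_cons.1 h.2).1 this
    rcases List.mem_cons.1 hd with h1 | h1 <;> rcases List.mem_cons.1 hd' with h2 | h2
    · rw [h1, h2]
    · exact absurd (e.symm.trans (congrArg src h1)) (key _ h2)
    · exact absurd (e.trans (congrArg src h2)) (key _ h1)
    · exact ih h.tail h1 h2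

theorem IsDirectedWalk.monotone {a b : X} {l : List D}
    (h : IsDirectedWalk src tgt a b l) (g : X → ℝ) (hg : ∀ d ∈ l, g (src d) ≤ g (tgt d)) :
    g a ≤ g b := by
  induction l generalizing a with
  | nil => exact (congrArg g h).le
  | cons d l ih =>
    obtain ⟨rfl, h⟩ := h
    exact (hg d (by simp)).trans (ih h fun e he => hg e (by simp [he]))

theorem exists_walk_of_transGen {P : D → Prop} {a b : X}
    (h : Relation.TransGen (fun u v => ∃ d, P d ∧ src d = u ∧ tgt d = v) a b) :
    ∃ l : List D, l ≠ [] ∧ (∀ d ∈ l, P d) ∧ IsDirectedWalk src tgt a b l := by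
  induction h with
  | single h =>
    obtain ⟨d, hd, rfl, rfl⟩ := h
    exact ⟨[d], by simp, by simpa using hd, rfl, rfl⟩
  | tail _ h ih =>
    obtain ⟨d, hd, rfl, rfl⟩ := h
    obtain ⟨l, h1, h2, h3⟩ := ih
    refine ⟨l ++ [d], by simp, ?_, h3.append ⟨rfl, rfl⟩⟩
    intro e he
    rcases List.mem_append.1 he with he | he
    · exact h2 e he
    · rw [List.mem_singleton.1 he]; exact hd

/-- An acyclic relation on a finite type increases some height function. -/
theorem exists_height [Finite X] {r : X → X → Prop} (h : ∀ x, ¬ Relation.TransGen r x x) :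
    ∃ ht : X → ℕ, ∀ x y, r x y → ht x < ht y := by
  -- The height of `x` counts its strict predecessors.
  refine ⟨fun x => {y | Relation.TransGen r y x}.ncard, fun x y hxy => ?_⟩
  refine Set.ncard_lt_ncard ⟨fun z hz => hz.tail hxy, fun hs => h x ?_⟩ (Set.toFinite _)
  exact hs (Relation.TransGen.single hxy)

end Walks

namespace DirectedComplex

/-! ### Reachability in bipolar complexes. -/

section Bipolar

variable {D : Type*} [Finite D] {M : DirectedComplex D} {K : M.Cells} {n s : M.V}

theorem Cells.IsBipolar.exists_height (h : K.IsBipolar n s) :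
    ∃ ht : M.V → ℕ, ∀ d, M.dir d → M.edge d ∈ K.edges → ht (M.src d) < ht (M.tgt d) := by
  obtain ⟨ht, hht⟩ := _root_.exists_height h.1
  exact ⟨ht, fun d h1 h2 => hht _ _ ⟨d, h1, h2, rfl, rfl⟩⟩

/-- In a bipolar complex every vertex can be reached from the source. -/
theorem Cells.IsBipolar.exists_walk_from (h : K.IsBipolar n s) (hK : K.IsClosed) {v : M.V}
    (hv : v ∈ K.verts) : ∃ l : List D, (∀ d ∈ l, M.dir d ∧ M.edge d ∈ K.edges) ∧
      IsDirectedWalk M.src M.tgt n v l := by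
  obtain ⟨ht, hht⟩ := h.exists_height
  induction hk : ht v using Nat.strong_induction_on generalizing v with
  | _ k ih =>
    by_cases hn : v = n
    · exact ⟨[], by simp, hn.symm⟩
    · have := mt (h.2.1 v).1 hn
      push Not at this
      obtain ⟨d, h1, h2, rfl⟩ := this hv
      obtain ⟨l, hl, hw⟩ := ih _ (hk ▸ hht d h1 h2) (hK.1 d h2) rfl
      refine ⟨l ++ [d], fun e he => ?_, hw.append ⟨rfl, rfl⟩⟩
      rcases List.mem_append.1 he with he | he
      · exact hl e he
      · rw [List.mem_singleton.1 he]; exact ⟨h1, h2⟩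

/-- In a bipolar complex the sink can be reached from every vertex. -/
theorem Cells.IsBipolar.exists_walk_to (h : K.IsBipolar n s) (hK : K.IsClosed) {v : M.V}
    (hv : v ∈ K.verts) : ∃ l : List D, (∀ d ∈ l, M.dir d ∧ M.edge d ∈ K.edges) ∧
      IsDirectedWalk M.src M.tgt v s l := by
  obtain ⟨ht, hht⟩ := h.exists_height
  obtain ⟨m, hm⟩ : ∃ m, ∀ v, ht v ≤ m := by
    obtain ⟨m, hm⟩ := (Set.finite_range ht).bddAbove
    exact ⟨m, fun v => hm ⟨v, rfl⟩⟩
  -- Heights increase along edges, so the gap to the maximum `m` decreases.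
  induction hk : m - ht v using Nat.strong_induction_on generalizing v with
  | _ k ih =>
    by_cases hn : v = s
    · exact ⟨[], by simp, hn⟩
    · have := mt (h.2.2 v).1 hn
      push Not at this
      obtain ⟨d, h1, h2, rfl⟩ := this hv
      obtain ⟨l, hl, hw⟩ := ih (m - ht (M.tgt d))
        (by have := hht d h1 h2; have := hm (M.tgt d); omega)
        (hK.1 (M.opp d) (by simpa using h2)) rfl
      exact ⟨d :: l, by simpa using ⟨⟨h1, h2⟩, hl⟩, rfl, hw⟩

end Bipolar

/-! ### The dual complex -/

variable {D : Type*} (C : DirectedComplex D)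

/-- Because of this conjugation, the bijection `dualFace` is induced by `opp` and not by the
identity of darts. -/
theorem dual_facePerm : C.dual.facePerm = C.opp * C.rot * C.opp⁻¹ := by
  ext d
  have : C.opp⁻¹ d = C.opp d := by rw [Equiv.Perm.inv_eq_iff_eq, C.opp_opp]
  rw [Equiv.Perm.mul_apply, Equiv.Perm.mul_apply, this]
  change C.facePerm.symm (C.opp d) = _
  rw [Equiv.symm_apply_eq, facePerm_apply, C.opp_opp, Equiv.symm_apply_apply]

/-- The faces of the dual are the vertices of the complex. -/
def dualFace : C.V ≃ C.dual.F :=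
  Quotient.congr C.opp fun a b => by
    change C.rot.SameCycle a b ↔ C.dual.facePerm.SameCycle _ _
    rw [dual_facePerm, Equiv.Perm.sameCycle_conj]
    simp

theorem dual_right (d : D) : C.dual.right d = C.dualFace (C.src d) := rfl

theorem dual_left (d : D) : C.dual.left d = C.dualFace (C.tgt d) := by
  rw [← C.src_opp, ← dual_right]; exact (C.dual.right_opp d).symm

theorem dual_src (d : D) : C.dual.src d = C.left d := rfl

theorem dual_edge (d : D) : C.dual.edge d = C.edge d := rfl

/-- Every complex is a dual. -/
theorem exists_eq_dual (M : DirectedComplex D) : ∃ C : DirectedComplex D, M = C.dual := by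
  -- The rotation of the predual is chosen so that its `facePerm` is `M.rot`.
  refine ⟨⟨M.rot.symm.trans M.opp, M.opp, M.opp_opp, M.dir, M.dir_opp⟩, ?_⟩
  have : M.rot = M.opp.trans (M.rot.symm.trans M.opp).symm := by
    ext d
    simp only [Equiv.trans_apply, Equiv.symm_trans_apply, Equiv.symm_symm]
    rw [Equiv.symm_apply_apply]
  cases M
  simp only [dual, facePerm, mk.injEq, and_self, and_true]
  exact this

/-- Duality exchanges the clauses on end points and on adjacent faces. The third clause is self-dual
after a shift by `facePerm`, which turns a common end point into a common start. -/
theorem isRegular_dual : C.dual.IsRegular ↔ C.IsRegular := by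
  have h : ∀ d d' : D, C.dual.left d = C.dual.left d' ↔ C.tgt d = C.tgt d' := fun d d' => by
    rw [dual_left, dual_left, C.dualFace.injective.eq_iff]
  constructor
  · rintro ⟨h1, h2, h3⟩
    refine ⟨fun d e => h2 d ?_, h1, fun d d' hl hs => ?_⟩
    · rw [dual_left, dual_right, e]
    · obtain ⟨x, rfl⟩ := C.facePerm.surjective d
      obtain ⟨y, rfl⟩ := C.facePerm.surjective d'
      simp only [src_facePerm, left_facePerm] at hl hs
      rw [h3 x y ((h x y).2 hs) hl]
  · rintro ⟨h1, h2, h3⟩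
    refine ⟨h2, fun d e => h1 d ?_, fun d d' hl hs => ?_⟩
    · rw [dual_left, dual_right, C.dualFace.injective.eq_iff] at e
      exact e.symm
    · refine C.facePerm.injective (h3 _ _ ?_ ?_)
      · rw [left_facePerm, left_facePerm]; exact hs
      · simpa using (h d d').1 hl

/-- The connected component of a face in the dual graph does not change across an edge, so
`eq_of_left_eq_right` applies to it. -/
theorem joined_univ_dual [Finite D] (h : ∀ u v, C.Joined Set.univ u v) (f f' : C.dual.V) :
    C.dual.Joined Set.univ f f' := by
  let r := Relation.EqvGen.setoid fun u v =>
    ∃ d, C.dual.edge d ∈ Set.univ ∧ C.dual.src d = u ∧ C.dual.tgt d = v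
  have := C.eq_of_left_eq_right h (X := Quotient r) (fun f => Quotient.mk r f)
    (fun d => Quotient.sound (Relation.EqvGen.rel _ _ ⟨d, trivial, rfl, rfl⟩)) f f'
  exact Quotient.exact this

theorem joined_univ_of_dual [Finite D] (h : ∀ u v, C.dual.Joined Set.univ u v) (v v' : C.V) :
    C.Joined Set.univ v v' := by
  let r := Relation.EqvGen.setoid fun u v =>
    ∃ d, C.edge d ∈ Set.univ ∧ C.src d = u ∧ C.tgt d = v
  have := C.dual.eq_of_left_eq_right h (X := Quotient r)
    (fun f => Quotient.mk r (C.dualFace.symm f)) (fun d => by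
      rw [dual_left, dual_right, Equiv.symm_apply_apply, Equiv.symm_apply_apply]
      exact (Quotient.sound (Relation.EqvGen.rel _ _ ⟨d, trivial, rfl, rfl⟩)).symm)
    (C.dualFace v) (C.dualFace v')
  rw [Equiv.symm_apply_apply, Equiv.symm_apply_apply] at this
  exact Quotient.exact this

theorem isSphere_dual [Finite D] : C.dual.IsSphere ↔ C.IsSphere := by
  have hF : Nat.card C.dual.F = Nat.card C.V := (Nat.card_congr C.dualFace).symm
  have hV : Nat.card C.dual.V = Nat.card C.F := rfl
  have hE : Nat.card C.dual.E = Nat.card C.E := rfl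
  refine and_congr ⟨C.joined_univ_of_dual, C.joined_univ_dual⟩ ?_
  rw [hF, hV, hE]
  omega

end DirectedComplex

/-! ### Sides of the meridians. -/

namespace DirectedComplex

variable {D : Type*} {C : DirectedComplex D}

/-- The boundary of a 3-cell template, with the Western hemisphere to the right of `WE` and to the
left of `EW`. -/
structure OrientedTemplate (C : DirectedComplex D) (N S : C.V) (WE EW : List D)
    (W Ea : Set C.F) : Prop where
  sphere : C.IsSphere
  regular : C.IsRegular
  bipolar : C.allCells.IsBipolar N S
  dir_WE : ∀ d ∈ WE, C.dir d
  path_WE : IsDirectedPath C.src C.tgt N S WE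
  dir_EW : ∀ d ∈ EW, C.dir d
  path_EW : IsDirectedPath C.src C.tgt N S EW
  disj : PathsDisjoint C.tgt N S WE EW
  hemi : C.AreHemispheres (C.pathEdges WE EW) W Ea
  west : ∀ d, C.dir d → C.edge d ∉ C.pathEdges WE EW → C.left d ∈ W →
    C.src d ∈ C.pathVerts N WE EW → C.src d = N ∨ C.src d = S
  east : ∀ d, C.dir d → C.edge d ∉ C.pathEdges WE EW → C.left d ∈ Ea →
    C.tgt d ∈ C.pathVerts N WE EW → C.tgt d = N ∨ C.tgt d = S
  overlap_WE : C.Overlap W Ea WE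
  overlap_EW : C.Overlap W Ea EW
  left_WE : ∀ d ∈ WE, C.left d ∈ Ea
  right_WE : ∀ d ∈ WE, C.right d ∈ W
  left_EW : ∀ d ∈ EW, C.left d ∈ W
  right_EW : ∀ d ∈ EW, C.right d ∈ Ea

theorem pathEdges_comm (p q : List D) : C.pathEdges p q = C.pathEdges q p := by
  ext e; simp only [pathEdges, Set.mem_ofPred_eq, or_comm]

theorem pathVerts_comm (a : C.V) (p q : List D) : C.pathVerts a p q = C.pathVerts a q p := by
  ext e; simp only [pathVerts, Set.mem_ofPred_eq, or_comm]

theorem mem_pathEdges_iff {p q : List D} {d : D} : C.edge d ∈ C.pathEdges p q ↔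
    d ∈ p ∨ d ∈ q ∨ C.opp d ∈ p ∨ C.opp d ∈ q := by
  simp only [pathEdges, Set.mem_ofPred_eq]
  constructor
  · rintro ⟨e, he, h⟩
    rcases C.edge_eq_iff.1 h with rfl | rfl
    · tauto
    · rw [C.opp_opp]; tauto
  · rintro (h | h | h | h)
    · exact ⟨d, Or.inl h, rfl⟩
    · exact ⟨d, Or.inr h, rfl⟩
    · exact ⟨_, Or.inl h, C.edge_opp d⟩
    · exact ⟨_, Or.inr h, C.edge_opp d⟩

theorem mem_pathEdges_iff_of_dir {p q : List D} (hp : ∀ d ∈ p, C.dir d) (hq : ∀ d ∈ q, C.dir d)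
    {d : D} (hd : C.dir d) : C.edge d ∈ C.pathEdges p q ↔ d ∈ p ∨ d ∈ q := by
  rw [mem_pathEdges_iff]
  have h1 := C.opp_not_mem hp hd
  have h2 := C.opp_not_mem hq hd
  tauto

theorem PathsDisjoint.symm {X : Type*} {tgt : D → X} {a b : X} {p q : List D}
    (h : PathsDisjoint tgt a b p q) : PathsDisjoint tgt a b q p :=
  ⟨fun d hd hd' => h.1 d hd' hd, fun x hx hx' => h.2 x hx' hx⟩

theorem Overlap.ne_nil {W Ea : Set C.F} {p : List D} (h : C.Overlap W Ea p) : p ≠ [] := by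
  rintro rfl
  obtain ⟨_, _, _, _, ⟨a, ha, _⟩, _⟩ := h
  simp at ha

/-- The difference of two disjoint directed paths bounds: a face function which jumps across the
paths only, upwards from left to right of `p` and downwards from left to right of `q`. -/
theorem IsSphere.exists_jump [Finite D] (hC : C.IsSphere) {N S : C.V} {p q : List D}
    (hp : ∀ d ∈ p, C.dir d) (hq : ∀ d ∈ q, C.dir d)
    (wp : IsDirectedWalk C.src C.tgt N S p) (wq : IsDirectedWalk C.src C.tgt N S q)
    (hd : ∀ d ∈ p, d ∉ q) :
    ∃ h : C.F → ℝ, (∀ d ∈ p, h (C.left d) < h (C.right d)) ∧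
      (∀ d ∈ q, h (C.right d) < h (C.left d)) ∧
      ∀ f g, C.FacesJoinedOff (C.pathEdges p q) f g → h f = h g := by
  -- The closed walk goes out along `p` and back along `q`.
  have hw : IsDirectedWalk C.src C.tgt N N (p ++ (q.map C.opp).reverse) :=
    wp.append (wq.reverse (fun d => rfl) C.tgt_opp)
  obtain ⟨h, hh⟩ := hC.exists_face_potential hw
  have hopp : ∀ d, d ∈ (q.map C.opp).reverse ↔ C.opp d ∈ q := by
    intro d
    simp only [List.mem_reverse, List.mem_map]
    exact ⟨fun ⟨e, he, h⟩ => by rwa [← h, C.opp_opp], fun h => ⟨_, h, C.opp_opp d⟩⟩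
  refine ⟨h, fun d h1 => ?_, fun d h1 => ?_, fun f g hfg => ?_⟩
  · rw [← sub_pos, hh]
    refine chain_pos (by simp [h1]) ?_
    rw [List.mem_append, hopp, C.opp_opp, not_or]
    exact ⟨C.opp_not_mem hp (hp d h1), hd d h1⟩
  · rw [← sub_neg, hh, ← neg_pos, ← chain_opp]
    refine chain_pos ?_ ?_
    · rw [List.mem_append, hopp, C.opp_opp]; exact Or.inr h1
    · rw [List.mem_append, hopp, C.opp_opp, not_or]
      exact ⟨fun h2 => hd d h2 h1, C.opp_not_mem hq (hq d h1)⟩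
  · induction hfg with
    | rel f g hr =>
      obtain ⟨d, hd, rfl, rfl⟩ := hr
      rw [mem_pathEdges_iff] at hd
      have := hh d
      rw [chain_eq_zero, sub_eq_zero] at this
      · exact this.symm
      · rw [List.mem_append, hopp]; tauto
      · rw [List.mem_append, hopp, C.opp_opp]; tauto
    | refl => rfl
    | symm _ _ _ ih => exact ih.symm
    | trans _ _ _ _ _ ih1 ih2 => exact ih1.trans ih2

theorem AreHemispheres.mem_right {B : Set C.E} {W Ea : Set C.F} (h : C.AreHemispheres B W Ea)
    {f : C.F} : f ∈ Ea ↔ f ∉ W := by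
  rw [← h.2.2.1.compl_eq, Set.mem_compl_iff]

theorem AreHemispheres.symm {B : Set C.E} {W Ea : Set C.F} (h : C.AreHemispheres B W Ea) :
    C.AreHemispheres B Ea W :=
  ⟨h.2.1, h.1, h.2.2.1.symm, fun f g => by
    rw [h.2.2.2, h.mem_right, h.mem_right, not_iff_not]⟩

/-- A function which is constant on both hemispheres increases in one direction only. -/
theorem AreHemispheres.sides {B : Set C.E} {W Ea : Set C.F} (hh : C.AreHemispheres B W Ea)
    (ph : C.F → ℝ) (hc : ∀ f g, C.FacesJoinedOff B f g → ph f = ph g) {f g f' g' : C.F}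
    (h1 : ph f < ph g) (h2 : ph f' < ph g') (hg : g ∈ W) : f' ∈ Ea ∧ g' ∈ W := by
  have hW : ∀ f g, f ∈ W → g ∈ W → ph f = ph g := fun f g hf hg =>
    hc f g ((hh.2.2.2 f g).2 (iff_of_true hf hg))
  have hE : ∀ f g, f ∈ Ea → g ∈ Ea → ph f = ph g := fun f g hf hg =>
    hc f g ((hh.2.2.2 f g).2 (iff_of_false (hh.mem_right.1 hf) (hh.mem_right.1 hg)))
  have hWE : ∀ f, f ∈ W ∨ f ∈ Ea := fun f => by rw [hh.mem_right]; exact em _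
  have hf : f ∈ Ea := (hWE f).resolve_left fun hf => h1.ne (hW _ _ hf hg)
  rcases hWE f' with hf' | hf' <;> rcases hWE g' with hg' | hg'
  · exact absurd (hW _ _ hf' hg') h2.ne
  · rw [hW f' g hf' hg, hE g' f hg' hf] at h2
    exact absurd h2 h1.not_gt
  · exact ⟨hf', hg'⟩
  · exact absurd (hE _ _ hf' hg') h2.ne

/-- The jump function of the meridian cycle takes one value on each hemisphere, so all edges of one
meridian have the same hemisphere on their right, and the edges of the other have it on their left.
The remaining conditions are symmetric in the two meridians, so their names may be exchanged. -/
theorem IsTemplateBoundary.exists_oriented [Finite D] (h : C.IsTemplateBoundary) :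
    ∃ N S WE EW W Ea, OrientedTemplate C N S WE EW W Ea := by
  obtain ⟨hs, hr, N, S, p, q, W, Ea, hb, ⟨hp, pp⟩, ⟨hq, pq⟩, hd, hh, hw, he, ho, ho'⟩ := h
  obtain ⟨ph, hp', hq', hc⟩ := hs.exists_jump hp hq pp.1 pq.1 hd.1
  have key : ∀ f g f' g', ph f < ph g → ph f' < ph g' → g ∈ W → f' ∈ Ea ∧ g' ∈ W :=
    fun _ _ _ _ => hh.sides ph hc
  have key' : ∀ f g f' g', ph f < ph g → ph f' < ph g' → g ∈ Ea → f' ∈ W ∧ g' ∈ Ea :=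
    fun _ _ _ _ => hh.symm.sides ph hc
  obtain ⟨a, ha⟩ := List.exists_mem_of_ne_nil _ (Overlap.ne_nil ho)
  rcases (em (C.right a ∈ W)).imp_right hh.mem_right.2 with h1 | h1
  · refine ⟨N, S, p, q, W, Ea, hs, hr, hb, hp, pp, hq, pq, hd, hh, hw, he, ho, ho', ?_, ?_, ?_, ?_⟩
    · exact fun d hd => (key _ _ _ _ (hp' a ha) (hp' d hd) h1).1
    · exact fun d hd => (key _ _ _ _ (hp' a ha) (hp' d hd) h1).2
    · exact fun d hd => (key _ _ _ _ (hp' a ha) (hq' d hd) h1).2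
    · exact fun d hd => (key _ _ _ _ (hp' a ha) (hq' d hd) h1).1
  · rw [pathEdges_comm] at hh hw he
    rw [pathVerts_comm] at hw he
    refine ⟨N, S, q, p, W, Ea, hs, hr, hb, hq, pq, hp, pp, PathsDisjoint.symm hd, hh, hw, he, ho',
      ho, ?_, ?_, ?_, ?_⟩
    · exact fun d hd => (key' _ _ _ _ (hp' a ha) (hq' d hd) h1).2
    · exact fun d hd => (key' _ _ _ _ (hp' a ha) (hq' d hd) h1).1
    · exact fun d hd => (key' _ _ _ _ (hp' a ha) (hp' d hd) h1).1
    · exact fun d hd => (key' _ _ _ _ (hp' a ha) (hp' d hd) h1).2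

/-! ### Cores -/

/-- The cells of the dual in the part `X` of the complement of a graph with edges `B` and
vertices `P`. -/
def core (C : DirectedComplex D) (B : Set C.E) (P : Set C.V) (X : Set C.F) : C.dual.Cells where
  verts := X
  edges := {e | e ∉ B ∧ ∃ d, C.edge d = e ∧ C.left d ∈ X}
  faces := {f | C.dualFace.symm f ∉ P ∧ ∃ d, C.src d = C.dualFace.symm f ∧ C.left d ∈ X}

section Core

variable {B : Set C.E} {P : Set C.V} {X : Set C.F}

theorem edge_mem_core (hX : ∀ d, C.edge d ∉ B → (C.left d ∈ X ↔ C.right d ∈ X)) {d : D} :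
    C.dual.edge d ∈ (C.core B P X).edges ↔ C.edge d ∉ B ∧ C.left d ∈ X := by
  refine ⟨fun ⟨h1, d', h2, h3⟩ => ⟨h1, ?_⟩, fun ⟨h1, h2⟩ => ⟨h1, d, rfl, h2⟩⟩
  change C.edge d ∉ B at h1
  change C.edge d' = C.edge d at h2
  rcases C.edge_eq_iff.1 h2 with rfl | rfl
  · exact h3
  · rw [left_opp, ← hX d' (by simpa using h1)]; exact h3

theorem core_joined (hX : ∀ d, C.edge d ∉ B → (C.left d ∈ X ↔ C.right d ∈ X))
    {f g : C.F} (hf : f ∈ X) (h : C.FacesJoinedOff B f g) :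
    C.dual.Joined (C.core B P X).edges f g := by
  have : (f ∈ X ↔ g ∈ X) ∧ (f ∈ X → C.dual.Joined (C.core B P X).edges f g) := by
    clear hf
    induction h with
    | rel f g h =>
      obtain ⟨d, hd, rfl, rfl⟩ := h
      exact ⟨hX d hd, fun hl => Relation.EqvGen.rel _ _
        ⟨d, (edge_mem_core hX).2 ⟨hd, hl⟩, rfl, rfl⟩⟩
    | refl f => exact ⟨Iff.rfl, fun _ => Relation.EqvGen.refl _⟩
    | symm f g _ ih => exact ⟨ih.1.symm, fun h => (ih.2 (ih.1.2 h)).symm⟩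
    | trans f g k _ _ ih1 ih2 =>
      exact ⟨ih1.1.trans ih2.1, fun h => (ih1.2 h).trans _ _ _ (ih2.2 (ih1.1.1 h))⟩
  exact this.2 hf

variable [Finite D]

/-- No edge of `B` ends at a vertex off `P`, so rotating around such a vertex never enters or leaves
`X`. -/
theorem left_mem_iff_of_src_eq (hX : ∀ d, C.edge d ∉ B → (C.left d ∈ X ↔ C.right d ∈ X))
    (hP : ∀ d, C.edge d ∈ B → C.src d ∈ P) {d d' : D} (hd : C.src d ∉ P)
    (h : C.src d = C.src d') : C.left d ∈ X ↔ C.left d' ∈ X := by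
  obtain ⟨n, rfl⟩ := (C.src_eq_iff.1 h).exists_nat_pow_eq
  induction n with
  | zero => rfl
  | succ n ih =>
    have hs : C.src d = C.src ((C.rot ^ n) d) := C.src_eq_iff.2 ⟨n, rfl⟩
    rw [ih hs, pow_succ', Equiv.Perm.mul_apply, hX (C.rot _), right_rot]
    intro hB
    have := hP _ hB
    rw [src_rot, ← hs] at this
    exact hd this

theorem dualFace_mem_core (hX : ∀ d, C.edge d ∉ B → (C.left d ∈ X ↔ C.right d ∈ X))
    (hP : ∀ d, C.edge d ∈ B → C.src d ∈ P) {d : D} :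
    C.dualFace (C.src d) ∈ (C.core B P X).faces ↔ C.src d ∉ P ∧ C.left d ∈ X := by
  simp only [core, Set.mem_ofPred_eq, Equiv.symm_apply_apply]
  refine and_congr_right fun h => ⟨fun ⟨d', h1, h2⟩ => ?_, fun h' => ⟨d, rfl, h'⟩⟩
  exact (left_mem_iff_of_src_eq hX hP h h1.symm).2 h2

theorem core_isClosed (hX : ∀ d, C.edge d ∉ B → (C.left d ∈ X ↔ C.right d ∈ X))
    (hP : ∀ d, C.edge d ∈ B → C.src d ∈ P) : (C.core B P X).IsClosed := by
  refine ⟨fun d hd => ((edge_mem_core hX).1 hd).2, fun d hd => (edge_mem_core hX).2 ?_⟩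
  rw [dual_left, ← src_opp, dualFace_mem_core hX hP] at hd
  have hB : C.edge d ∉ B := fun h => hd.1 (hP _ (by simpa using h))
  exact ⟨hB, (hX d hB).2 hd.2⟩

end Core

end DirectedComplex

/-! ### Arcs of a rotation. -/

/-- An arc of a cycle of the permutation `τ`, entered after `a` and left after `b`, as a path whose
step `x` leads from `L x` to `R x = L (τ x)`. -/
theorem exists_arc {D F : Type*} [Finite D] (τ : Equiv.Perm D) (L R : D → F)
    (hτ : ∀ x, L (τ x) = R x) (X : Set F) {a b : D} (hab : τ.SameCycle a b)
    (hX : ∀ x, τ.SameCycle a x → x ≠ a → x ≠ b → (L x ∈ X ↔ R x ∈ X))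
    (ha : L a ∉ X) (ha' : R a ∈ X) (hb : L b ∈ X) (hb' : R b ∉ X)
    (hinj : ∀ x y, τ.SameCycle a x → τ.SameCycle a y → L x = L y → x = y) :
    ∃ l : List D, IsDirectedPath L R (R a) (L b) l ∧
      ∀ x, x ∈ l ↔ τ.SameCycle a x ∧ x ≠ b ∧ L x ∈ X := by
  classical
  -- Only `b` has its `L` side in `X`, so `b ≠ a` and `b` is reached after at least one step.
  have hex : ∃ k, (τ ^ (k + 1)) a = b := by
    obtain ⟨k, hk⟩ := hab.exists_nat_pow_eq
    cases k with
    | zero => exact absurd hb (by rw [← hk]; exact ha)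
    | succ k => exact ⟨k, hk⟩
  set k := Nat.find hex
  have hkb : (τ ^ (k + 1)) a = b := Nat.find_spec hex
  have hmin : ∀ i < k, (τ ^ (i + 1)) a ≠ b := fun i hi => Nat.find_min hex hi
  have hsc : ∀ i : ℕ, τ.SameCycle a ((τ ^ i) a) := fun i => ⟨i, by simp⟩
  have hR : ∀ i : ℕ, R ((τ ^ i) a) = L ((τ ^ (i + 1)) a) := fun i => by
    rw [pow_succ', Equiv.Perm.mul_apply, hτ]
  let w : ℕ → D := fun i => (τ ^ (i + 1)) a
  have hwalk : ∀ m, IsDirectedWalk L R (R a) (R ((τ ^ m) a)) ((List.range m).map w) := by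
    intro m
    induction m with
    | zero => rfl
    | succ m ih =>
      rw [List.range_succ, List.map_append]
      exact ih.append ⟨(hR m).symm, rfl⟩
  have hmem : ∀ x, x ∈ (List.range k).map w ↔ ∃ i < k, w i = x := by simp
  have hfwd : ∀ i ≤ k, R ((τ ^ i) a) ∈ X := by
    intro i
    induction i with
    | zero => exact fun _ => ha'
    | succ i ih =>
      intro hi
      have h1 := ih (by omega)
      by_cases h2 : (τ ^ (i + 1)) a = a
      · rw [h2]; exact ha'
      · rw [← hX _ (hsc _) h2 (hmin i (by omega)), ← hR]; exact h1
  refine ⟨(List.range k).map w, ⟨?_, ?_⟩, fun x => ?_⟩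
  · have := hwalk k
    rwa [hR, hkb] at this
  -- The vertices of the path are the `L` sides of the arc including its final dart `b`, whence `k +
  -- 1`.
  · have : R a :: ((List.range k).map w).map R = ((List.range (k + 1)).map w).map L := by
      rw [List.range_succ_eq_map, List.map_cons, List.map_cons, List.map_map, List.map_map,
        List.map_map]
      congr 1
      · exact hR 0
      · exact List.map_congr_left fun i _ => hR (i + 1)
    rw [this, List.map_map]
    refine List.Nodup.map_on (fun i hi j hj hij => ?_) List.nodup_range
    have key : ∀ i j, i < j → j < k + 1 → L (w i) ≠ L (w j) := by
      intro i j hij hj h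
      have h1 := hinj _ _ (hsc _) (hsc _) h
      -- A repeated dart could be cut out, reaching `b` earlier by `j - i` steps.
      refine hmin (k - (j - i)) (by omega) ?_
      have h2 : k - (j - i) + 1 = (k - j) + (i + 1) := by omega
      rw [h2, pow_add, Equiv.Perm.mul_apply, h1, ← Equiv.Perm.mul_apply, ← pow_add, ← hkb]
      congr 2
      omega
    rw [List.mem_range] at hi hj
    rcases lt_trichotomy i j with h | h | h
    · exact absurd hij (key i j h hj)
    · exact h
    · exact absurd hij.symm (key j i h hi)
  · constructor
    · rw [hmem]
      rintro ⟨i, hi, rfl⟩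
      exact ⟨hsc _, hmin i hi, by rw [← hR]; exact hfwd i hi.le⟩
    · rintro ⟨hx, hxb, hxX⟩
      obtain ⟨m, rfl⟩ := hx.exists_nat_pow_eq
      -- After `b` the rotation stays off `X` until it is back at `a`.
      have key : ∀ m : ℕ, (τ ^ m) a ∈ (List.range k).map w ∨ (τ ^ m) a = b ∨
          L ((τ ^ m) a) ∉ X := by
        intro m
        induction m with
        | zero => exact Or.inr (Or.inr ha)
        | succ m ih =>
          have next : ∀ i ≤ k, (τ ^ m) a = (τ ^ i) a → (τ ^ (m + 1)) a ∈ (List.range k).map w ∨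
              (τ ^ (m + 1)) a = b := by
            intro i hi h
            have h' : (τ ^ (m + 1)) a = w i := by
              simp only [w, pow_succ', Equiv.Perm.mul_apply, h]
            rw [h', hmem]
            rcases hi.lt_or_eq with h1 | rfl
            · exact Or.inl ⟨i, h1, rfl⟩
            · exact Or.inr hkb
          rcases ih with ih | ih | ih
          · obtain ⟨i, hi, h⟩ := (hmem _).1 ih
            rcases next (i + 1) hi h.symm with h | h <;> tauto
          · right; right; rw [← hR, ih]; exact hb'
          · by_cases h1 : (τ ^ m) a = a
            · rcases next 0 (Nat.zero_le _) h1 with h | h <;> tauto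
            · by_cases h2 : (τ ^ m) a = b
              · right; right; rw [← hR, h2]; exact hb'
              · right; right; rw [← hR, ← hX _ (hsc _) h1 h2]; exact ih
      rcases key m with h | h | h
      · exact h
      · exact absurd h hxb
      · exact absurd hxX h

/-! ### Sources and sinks of the cores. -/

namespace DirectedComplex

variable {D : Type*} {C : DirectedComplex D} {N S : C.V} {WE EW : List D} {W Ea : Set C.F}

section Bipolar

theorem allCells_isClosed : C.allCells.IsClosed := ⟨fun _ _ => trivial, fun _ _ => trivial⟩

variable [Finite D]

/-- At a lowest vertex of the boundary circle both boundary edges leave: the dart `d` arriving there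
runs against its edge, the next one along its edge. -/
theorem exists_local_source (h : C.allCells.IsBipolar N S) (f : C.F) :
    ∃ d, C.left d = f ∧ ¬ C.dir d ∧ C.dir (C.facePerm d) := by
  obtain ⟨ht, hht⟩ := h.exists_height
  replace hht := fun d hd => hht d hd trivial
  obtain ⟨d, hd, hmin⟩ := Set.exists_min_image {d | C.left d = f} (fun d => ht (C.src d))
    (Set.toFinite _) (C.exists_left f)
  obtain ⟨d, rfl⟩ := C.facePerm.surjective d
  have hd' : C.left d = f := by simpa using hd
  refine ⟨d, hd', fun h => ?_, ?_⟩
  · have h1 := hmin d hd'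
    have h2 := hht d h
    simp only [src_facePerm] at h1
    omega
  · by_contra h
    have h1 := hmin (C.facePerm (C.facePerm d)) (by simpa using hd')
    have h2 := hht _ ((C.dir_opp _).2 h)
    rw [src_facePerm _ (C.facePerm d), ← src_opp] at h1
    rw [tgt_opp] at h2
    omega

theorem exists_local_sink (h : C.allCells.IsBipolar N S) (f : C.F) :
    ∃ d, C.left d = f ∧ C.dir d ∧ ¬ C.dir (C.facePerm d) := by
  obtain ⟨ht, hht⟩ := h.exists_height
  replace hht := fun d hd => hht d hd trivial
  obtain ⟨d, hd, hmax⟩ := Set.exists_max_image {d | C.left d = f} (fun d => ht (C.src d))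
    (Set.toFinite _) (C.exists_left f)
  obtain ⟨d, rfl⟩ := C.facePerm.surjective d
  have hd' : C.left d = f := by simpa using hd
  refine ⟨d, hd', ?_, fun h => ?_⟩
  · by_contra h
    have h1 := hmax d hd'
    have h2 := hht _ ((C.dir_opp _).2 h)
    simp only [src_facePerm, tgt_opp, src_opp] at h1 h2
    omega
  · have h1 := hmax (C.facePerm (C.facePerm d)) (by simpa using hd')
    have h2 := hht _ h
    rw [src_facePerm _ (C.facePerm d)] at h1
    omega

/-- Every vertex lies on a directed walk from `N` to `S`. -/
theorem potential_bounds (h : C.allCells.IsBipolar N S) (g : C.V → ℝ)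
    (hg : ∀ d, C.dir d → g (C.src d) ≤ g (C.tgt d)) (v : C.V) : g N ≤ g v ∧ g v ≤ g S := by
  obtain ⟨l, hl, hw⟩ := h.exists_walk_from allCells_isClosed (v := v) trivial
  obtain ⟨l', hl', hw'⟩ := h.exists_walk_to allCells_isClosed (v := v) trivial
  exact ⟨hw.monotone g fun d hd => hg d (hl d hd).1, hw'.monotone g fun d hd => hg d (hl' d hd).1⟩

/-- An acyclic complex with at most one source and one sink is bipolar. -/
theorem Cells.isBipolar_of_unique {K : C.Cells} {n s : C.V} (hne : K.verts.Nonempty)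
    (hK : K.IsClosed)
    (hac : ∀ l : List D, l ≠ [] → (∀ d ∈ l, C.dir d ∧ C.edge d ∈ K.edges) →
      ∀ v, ¬ IsDirectedWalk C.src C.tgt v v l)
    (hn : ∀ v ∈ K.verts, (∀ d, C.dir d → C.edge d ∈ K.edges → C.tgt d ≠ v) → v = n)
    (hs : ∀ v ∈ K.verts, (∀ d, C.dir d → C.edge d ∈ K.edges → C.src d ≠ v) → v = s) :
    K.IsBipolar n s := by
  have hac' : ∀ v, ¬ Relation.TransGen
      (fun u u' => ∃ d, C.dir d ∧ C.edge d ∈ K.edges ∧ C.src d = u ∧ C.tgt d = u') v v := by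
    intro v hv
    obtain ⟨l, h1, h2, h3⟩ := exists_walk_of_transGen (src := C.src) (tgt := C.tgt)
      (P := fun d => C.dir d ∧ C.edge d ∈ K.edges)
      (Relation.TransGen.mono (fun a b ⟨d, hd⟩ => ⟨d, ⟨hd.1, hd.2.1⟩, hd.2.2⟩) _ _ hv)
    exact hac l h1 h2 v h3
  obtain ⟨ht, hht⟩ := _root_.exists_height hac'
  refine ⟨hac', fun v => ⟨fun h => hn v h.1 h.2, ?_⟩, fun v => ⟨fun h => hs v h.1 h.2, ?_⟩⟩
  · rintro rfl
    -- A lowest vertex has no incoming edge, so a source exists and must be `n`.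
    obtain ⟨u, hu, hmin⟩ := Set.exists_min_image K.verts ht (Set.toFinite _) hne
    have hu' : ∀ d, C.dir d → C.edge d ∈ K.edges → C.tgt d ≠ u := by
      rintro d h1 h2 rfl
      have := hht _ _ ⟨d, h1, h2, rfl, rfl⟩
      have := hmin _ (hK.1 d h2)
      omega
    obtain rfl := hn u hu hu'
    exact ⟨hu, hu'⟩
  · rintro rfl
    obtain ⟨u, hu, hmax⟩ := Set.exists_max_image K.verts ht (Set.toFinite _) hne
    have hu' : ∀ d, C.dir d → C.edge d ∈ K.edges → C.src d ≠ u := by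
      rintro d h1 h2 rfl
      have := hht _ _ ⟨d, h1, h2, rfl, rfl⟩
      have := hmax _ (hK.1 (C.opp d) (by simpa using h2))
      rw [src_opp] at this
      omega
    obtain rfl := hs u hu hu'
    exact ⟨hu, hu'⟩

end Bipolar

theorem edge_mem_pathEdges_left {p q : List D} {d : D} (h : d ∈ p) :
    C.edge d ∈ C.pathEdges p q :=
  mem_pathEdges_iff.2 (Or.inl h)

theorem edge_mem_pathEdges_right {p q : List D} {d : D} (h : d ∈ q) :
    C.edge d ∈ C.pathEdges p q :=
  mem_pathEdges_iff.2 (Or.inr (Or.inl h))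

namespace OrientedTemplate

theorem mem_Ea (T : OrientedTemplate C N S WE EW W Ea)
    {f : C.F} : f ∈ Ea ↔ f ∉ W := T.hemi.mem_right

theorem side_W (T : OrientedTemplate C N S WE EW W Ea)
    {d : D} (hd : C.edge d ∉ C.pathEdges WE EW) : C.left d ∈ W ↔ C.right d ∈ W :=
  (T.hemi.2.2.2 _ _).1 (Relation.EqvGen.rel _ _ ⟨d, hd, rfl, rfl⟩)

theorem side_Ea (T : OrientedTemplate C N S WE EW W Ea)
    {d : D} (hd : C.edge d ∉ C.pathEdges WE EW) : C.left d ∈ Ea ↔ C.right d ∈ Ea := by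
  rw [T.mem_Ea, T.mem_Ea, T.side_W hd]

theorem src_mem_pathVerts (T : OrientedTemplate C N S WE EW W Ea)
    {d : D} (hd : C.edge d ∈ C.pathEdges WE EW) :
    C.src d ∈ C.pathVerts N WE EW := by
  rcases mem_pathEdges_iff.1 hd with h | h | h | h
  · exact Or.inl (T.path_WE.1.src_mem h)
  · exact Or.inr (T.path_EW.1.src_mem h)
  · exact Or.inl (List.mem_cons_of_mem _ (List.mem_map.2 ⟨_, h, C.tgt_opp d⟩))
  · exact Or.inr (List.mem_cons_of_mem _ (List.mem_map.2 ⟨_, h, C.tgt_opp d⟩))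

theorem tgt_mem_pathVerts (T : OrientedTemplate C N S WE EW W Ea)
    {d : D} (hd : C.edge d ∈ C.pathEdges WE EW) :
    C.tgt d ∈ C.pathVerts N WE EW :=
  T.src_mem_pathVerts (d := C.opp d) (by simpa using hd)

theorem tgt_ne_N (T : OrientedTemplate C N S WE EW W Ea)
    {d : D} (hd : C.dir d) : C.tgt d ≠ N := ((T.bipolar.2.1 N).2 rfl).2 d hd trivial

theorem src_ne_S (T : OrientedTemplate C N S WE EW W Ea)
    {d : D} (hd : C.dir d) : C.src d ≠ S := ((T.bipolar.2.2 S).2 rfl).2 d hd trivial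

theorem dir_of_src_eq_N (T : OrientedTemplate C N S WE EW W Ea)
    {d : D} (hd : C.src d = N) : C.dir d :=
  (C.dir_or_dir_opp d).resolve_right fun h => T.tgt_ne_N h (by rw [tgt_opp, hd])

theorem dir_of_tgt_eq_S (T : OrientedTemplate C N S WE EW W Ea)
    {d : D} (hd : C.tgt d = S) : C.dir d :=
  (C.dir_or_dir_opp d).resolve_right fun h => T.src_ne_S h (by rw [src_opp, hd])

theorem WE_ne_nil (T : OrientedTemplate C N S WE EW W Ea) : WE ≠ [] := T.overlap_WE.ne_nil

theorem EW_ne_nil (T : OrientedTemplate C N S WE EW W Ea) : EW ≠ [] := T.overlap_EW.ne_nil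

theorem N_ne_S (T : OrientedTemplate C N S WE EW W Ea) : N ≠ S := by
  rintro rfl
  have h := T.WE_ne_nil
  cases hWE : WE with
  | nil => exact h hWE
  | cons e l =>
    have hp := T.path_WE
    rw [hWE] at hp
    exact hp.src_ne_end (d := e) (by simp) hp.1.1

theorem mem_cases (T : OrientedTemplate C N S WE EW W Ea)
    {d : D} (hd : C.dir d) (hB : C.edge d ∈ C.pathEdges WE EW) : d ∈ WE ∨ d ∈ EW :=
  (mem_pathEdges_iff_of_dir T.dir_WE T.dir_EW hd).1 hB

theorem mem_WE_of_right (T : OrientedTemplate C N S WE EW W Ea)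
    {d : D} (hd : C.dir d) (hB : C.edge d ∈ C.pathEdges WE EW)
    (h : C.right d ∈ W) : d ∈ WE :=
  (T.mem_cases hd hB).resolve_right fun h' => T.mem_Ea.1 (T.right_EW d h') h

theorem mem_EW_of_left (T : OrientedTemplate C N S WE EW W Ea)
    {d : D} (hd : C.dir d) (hB : C.edge d ∈ C.pathEdges WE EW)
    (h : C.left d ∈ W) : d ∈ EW :=
  (T.mem_cases hd hB).resolve_left fun h' => T.mem_Ea.1 (T.left_WE d h') h

theorem mem_EW_of_right (T : OrientedTemplate C N S WE EW W Ea)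
    {d : D} (hd : C.dir d) (hB : C.edge d ∈ C.pathEdges WE EW)
    (h : C.right d ∈ Ea) : d ∈ EW :=
  (T.mem_cases hd hB).resolve_left fun h' => T.mem_Ea.1 h (T.right_WE d h')

theorem mem_WE_of_left (T : OrientedTemplate C N S WE EW W Ea)
    {d : D} (hd : C.dir d) (hB : C.edge d ∈ C.pathEdges WE EW)
    (h : C.left d ∈ Ea) : d ∈ WE :=
  (T.mem_cases hd hB).resolve_right fun h' => T.mem_Ea.1 h (T.left_EW d h')

theorem src_eq_N (T : OrientedTemplate C N S WE EW W Ea)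
    {d d' : D} (hd : d ∈ WE) (hd' : d' ∈ EW) (h : C.src d = C.src d') :
    C.src d = N :=
  (T.disj.2 _ (T.path_WE.1.src_mem hd) (h ▸ T.path_EW.1.src_mem hd')).resolve_right
    (T.src_ne_S (T.dir_WE d hd))

theorem tgt_eq_S (T : OrientedTemplate C N S WE EW W Ea)
    {d d' : D} (hd : d ∈ WE) (hd' : d' ∈ EW) (h : C.tgt d = C.tgt d') :
    C.tgt d = S :=
  (T.disj.2 _ (List.mem_cons_of_mem _ (List.mem_map_of_mem hd))
    (h ▸ List.mem_cons_of_mem _ (List.mem_map_of_mem hd'))).resolve_left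
    (T.tgt_ne_N (T.dir_WE d hd))

/-- An outgoing edge in the closed Western hemisphere, other than a meridian, starts off the
meridians or at the North pole. -/
theorem src_eq_N_of_left (T : OrientedTemplate C N S WE EW W Ea)
    {d : D} (hd : C.dir d) (hB : C.edge d ∉ C.pathEdges WE EW)
    (hW : C.left d ∈ W) (hs : C.src d ∈ C.pathVerts N WE EW) : C.src d = N :=
  (T.west d hd hB hW hs).resolve_right (T.src_ne_S hd)

theorem tgt_eq_S_of_left (T : OrientedTemplate C N S WE EW W Ea)
    {d : D} (hd : C.dir d) (hB : C.edge d ∉ C.pathEdges WE EW)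
    (hW : C.left d ∈ Ea) (hs : C.tgt d ∈ C.pathVerts N WE EW) : C.tgt d = S :=
  (T.east d hd hB hW hs).resolve_left (T.tgt_ne_N hd)

variable [Finite D]

/-- At a local source of the boundary of `f`, the edge with `f` on its right has its dual entering
`f`; hence it is a meridian edge, on `WE`. The other boundary edge leaving that vertex is either on
`EW`, which shares only the start `N` with `WE`, or off the meridians, and then may leave them only
at `N`. -/
theorem source_W (T : OrientedTemplate C N S WE EW W Ea) {f : C.F} (hf : f ∈ W)
    (h : ∀ d, C.dir d → C.edge d ∉ C.pathEdges WE EW → C.right d ≠ f) :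
    ∃ a ∈ WE, C.src a = N ∧ C.right a = f := by
  obtain ⟨d, rfl, h1, h2⟩ := exists_local_source T.bipolar f
  have h3 := (C.dir_opp d).2 h1
  have hB : C.edge (C.opp d) ∈ C.pathEdges WE EW := by
    by_contra hB; exact h _ h3 hB (by simp)
  have ha := T.mem_WE_of_right h3 hB (by simpa using hf)
  refine ⟨_, ha, ?_, by simp⟩
  by_cases hB' : C.edge (C.facePerm d) ∈ C.pathEdges WE EW
  · exact T.src_eq_N ha (T.mem_EW_of_left h2 hB' (by simpa using hf)) (by simp)
  · have := T.src_eq_N_of_left h2 hB' (by simpa using hf)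
      (by rw [src_facePerm, ← src_opp]; exact T.src_mem_pathVerts hB)
    simpa using this

/-- A local source serves again; now the edge with `f` on its left, whose dual leaves `f`, is the
forced meridian edge. -/
theorem sink_W (T : OrientedTemplate C N S WE EW W Ea) {f : C.F} (hf : f ∈ W)
    (h : ∀ d, C.dir d → C.edge d ∉ C.pathEdges WE EW → C.left d ≠ f) :
    ∃ b ∈ EW, C.src b = N ∧ C.left b = f := by
  obtain ⟨d, rfl, h1, h2⟩ := exists_local_source T.bipolar f
  have h3 := (C.dir_opp d).2 h1
  have hB : C.edge (C.facePerm d) ∈ C.pathEdges WE EW := by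
    by_contra hB; exact h _ h2 hB (by simp)
  have ha := T.mem_EW_of_left h2 hB (by simpa using hf)
  refine ⟨_, ha, ?_, by simp⟩
  by_cases hB' : C.edge (C.opp d) ∈ C.pathEdges WE EW
  · have := T.src_eq_N (T.mem_WE_of_right h3 hB' (by simpa using hf)) ha (by simp)
    simpa using this
  · have := T.src_eq_N_of_left h3 hB' ((T.side_W hB').2 (by simpa using hf))
      (by rw [src_opp, ← src_facePerm]; exact T.src_mem_pathVerts hB)
    simpa using this

/-- In the East it is arrival at the meridians that is restricted, so a local sink is used and the
pole found is `S`. -/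
theorem source_Ea (T : OrientedTemplate C N S WE EW W Ea) {f : C.F} (hf : f ∈ Ea)
    (h : ∀ d, C.dir d → C.edge d ∉ C.pathEdges WE EW → C.right d ≠ f) :
    ∃ a ∈ EW, C.tgt a = S ∧ C.right a = f := by
  obtain ⟨d, rfl, h1, h2⟩ := exists_local_sink T.bipolar f
  have h3 := (C.dir_opp _).2 h2
  have hB : C.edge (C.opp (C.facePerm d)) ∈ C.pathEdges WE EW := by
    by_contra hB; exact h _ h3 hB (by simp)
  have ha := T.mem_EW_of_right h3 hB (by simpa using hf)
  refine ⟨_, ha, ?_, by simp⟩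
  by_cases hB' : C.edge d ∈ C.pathEdges WE EW
  · have := T.tgt_eq_S (T.mem_WE_of_left h1 hB' hf) ha (by simp)
    simpa using this
  · have := T.tgt_eq_S_of_left h1 hB' hf
      (by have := T.tgt_mem_pathVerts hB; simpa using this)
    simpa using this

theorem sink_Ea (T : OrientedTemplate C N S WE EW W Ea) {f : C.F} (hf : f ∈ Ea)
    (h : ∀ d, C.dir d → C.edge d ∉ C.pathEdges WE EW → C.left d ≠ f) :
    ∃ b ∈ WE, C.tgt b = S ∧ C.left b = f := by
  obtain ⟨d, rfl, h1, h2⟩ := exists_local_sink T.bipolar f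
  have h3 := (C.dir_opp _).2 h2
  have hB : C.edge d ∈ C.pathEdges WE EW := by
    by_contra hB; exact h _ h1 hB rfl
  have ha := T.mem_WE_of_left h1 hB hf
  refine ⟨_, ha, ?_, rfl⟩
  by_cases hB' : C.edge (C.opp (C.facePerm d)) ∈ C.pathEdges WE EW
  · exact T.tgt_eq_S ha (T.mem_EW_of_right h3 hB' (by simpa using hf)) (by simp)
  · have := T.tgt_eq_S_of_left h3 hB' ((T.side_Ea hB').2 (by simpa using hf))
      (by have := T.tgt_mem_pathVerts hB; simpa using this)
    simpa using this

/-- There is no directed cycle of the dual which avoids the meridians. -/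
theorem not_dual_cycle (T : OrientedTemplate C N S WE EW W Ea) {l : List D} (hl : l ≠ [])
    (hl' : ∀ d ∈ l, C.dir d ∧ C.edge d ∉ C.pathEdges WE EW) (f : C.F) :
    ¬ IsDirectedWalk C.left C.right f f l := by
  intro hw
  obtain ⟨g, hg⟩ := T.sphere.exists_vertex_potential hw
  have hopp : ∀ d, C.dir d → C.opp d ∉ l := fun d => C.opp_not_mem fun d hd => (hl' d hd).1
  have hmono : ∀ d, C.dir d → g (C.src d) ≤ g (C.tgt d) := fun d hd => by
    rw [← sub_nonneg, hg]; exact chain_nonneg (hopp d hd)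
  -- The dual cycle does not cross `WE`, so `g` is constant along it.
  have hSN : g S ≤ g N := by
    have := T.path_WE.1.monotone (fun v => - g v) fun d hd => by
      have h := hg d
      rw [chain_eq_zero (fun h => (hl' d h).2 (edge_mem_pathEdges_left hd))
        (hopp d (T.dir_WE d hd))] at h
      linarith
    linarith
  have hconst : ∀ v, g v = g N := fun v => by
    have := potential_bounds T.bipolar g hmono v
    linarith
  obtain ⟨d, hd⟩ := List.exists_mem_of_ne_nil _ hl
  have := chain_pos hd (hopp d (hl' d hd).1)
  rw [← hg, hconst, hconst (C.src d), sub_self] at this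
  exact lt_irrefl _ this

/-- Every vertex of the meridian cycle is the end of an edge of `WE` or the start of an edge of
`EW`; `S` is covered by the former and `N` by the latter. -/
theorem ncard_pathVerts_le (T : OrientedTemplate C N S WE EW W Ea) :
    (C.pathVerts N WE EW).ncard ≤ (C.pathEdges WE EW).ncard := by
  classical
  have h1 : C.pathVerts N WE EW ⊆ C.tgt '' {d | d ∈ WE} ∪ C.src '' {d | d ∈ EW} := by
    have hS : S ∈ C.tgt '' {d | d ∈ WE} := by
      have := (T.path_WE.1.mem_verts_iff S).2 (Or.inr rfl)
      rcases List.mem_cons.1 this with h | h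
      · exact absurd h.symm T.N_ne_S
      · simpa using h
    rintro v (hv | hv)
    · rcases List.mem_cons.1 hv with rfl | h
      · right
        have := (T.path_EW.1.mem_verts_iff v).1 (by simp)
        rcases this with h | h
        · simpa using h
        · exact absurd h T.N_ne_S
      · left; simpa using h
    · rcases (T.path_EW.1.mem_verts_iff v).1 hv with h | rfl
      · right; simpa using h
      · left; exact hS
  have h2 : C.edge '' ({d | d ∈ WE} ∪ {d | d ∈ EW}) = C.pathEdges WE EW := by
    ext e; rfl
  have h3 : ({d | d ∈ WE} ∪ {d | d ∈ EW}).ncard = (C.pathEdges WE EW).ncard := by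
    rw [← h2, Set.InjOn.ncard_image]
    have hdir : ∀ d ∈ ({d | d ∈ WE} ∪ {d | d ∈ EW} : Set D), C.dir d := by
      rintro d (hd | hd)
      · exact T.dir_WE d hd
      · exact T.dir_EW d hd
    exact fun d hd d' hd' h => C.eq_of_edge_eq (hdir d hd) (hdir d' hd') h
  rw [Set.ncard_union_eq (s := {d | d ∈ WE}) (t := {d | d ∈ EW})
    (Set.disjoint_left.2 T.disj.1) (Set.toFinite _) (Set.toFinite _)] at h3
  have h4 := Set.ncard_le_ncard h1 (Set.toFinite _)
  have h5 := Set.ncard_union_le (C.tgt '' {d | d ∈ WE}) (C.src '' {d | d ∈ EW})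
  have h6 := Set.ncard_image_le (f := C.tgt) (Set.toFinite {d | d ∈ WE})
  have h7 := Set.ncard_image_le (f := C.src) (Set.toFinite {d | d ∈ EW})
  omega

end OrientedTemplate

end DirectedComplex

/-! ### From the template to the dual: cores and polar circles. -/

namespace DirectedComplex

variable {D : Type*} {C : DirectedComplex D} {N S : C.V} {WE EW : List D} {W Ea : Set C.F}

/-- The intersection of a core with a polar circle. `O` is the set of darts at the pole, `a` and `b`
are the meridian darts at which the pole enters and leaves the core. -/
theorem isPolarSegment_core [Finite D] {B : Set C.E} {P : Set C.V} {X : Set C.F} {v : C.V}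
    (hX : ∀ d, C.edge d ∉ B → (C.left d ∈ X ↔ C.right d ∈ X)) (hv : v ∈ P)
    (τ : Equiv.Perm D) (hτ : ∀ x, C.left (τ x) = C.right x) {a b : D} (hab : τ.SameCycle a b)
    (haB : C.edge a ∈ B) (hbB : C.edge b ∈ B)
    (hB : ∀ x, τ.SameCycle a x → C.edge x ∈ B → x = a ∨ x = b)
    (hdir : ∀ x, τ.SameCycle a x → C.dir x)
    (ha : C.left a ∉ X) (ha' : C.right a ∈ X) (hb : C.left b ∈ X) (hb' : C.right b ∉ X)
    (hinj : ∀ x y, τ.SameCycle a x → τ.SameCycle a y → C.left x = C.left y → x = y)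
    (hverts : ∀ f : C.F, f ∈ (C.dual.faceVertices (C.dualFace v) : Set C.F) ↔
      ∃ x, τ.SameCycle a x ∧ C.left x = f)
    (hedges : ∀ e : C.E, e ∈ (C.dual.faceEdges (C.dualFace v) : Set C.E) ↔
      ∃ x, τ.SameCycle a x ∧ C.edge x = e) :
    C.dual.IsPolarSegment (C.core B P X) (C.dualFace v) (C.right a) (C.left b) := by
  have hvK : C.dualFace v ∉ (C.core B P X).faces := fun h => h.1 (by simpa using hv)
  refine ⟨?_, ?_, ?_⟩
  · obtain ⟨l, hp, hl⟩ := exists_arc τ C.left C.right hτ X hab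
      (fun x hx h1 h2 => hX x fun h => (hB x hx h).elim h1 h2) ha ha' hb hb' hinj
    refine ⟨l, fun d hd => hdir d ((hl d).1 hd).1, hp, ?_, ?_⟩
    · refine Set.ext fun (f : C.F) => Iff.trans ?_ (hp.1.mem_verts_iff f).symm
      constructor
      · rintro ⟨h1, h2⟩
        obtain ⟨x, hx, rfl⟩ := (hverts f).1 h2
        by_cases hxb : x = b
        · exact Or.inr (by rw [hxb])
        · exact Or.inl (List.mem_map.2 ⟨x, (hl x).2 ⟨hx, hxb, h1⟩, rfl⟩)
      · rintro (h | rfl)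
        · obtain ⟨x, hx, rfl⟩ := List.mem_map.1 h
          exact ⟨((hl x).1 hx).2.2, (hverts _).2 ⟨x, ((hl x).1 hx).1, rfl⟩⟩
        · exact ⟨hb, (hverts _).2 ⟨b, hab, rfl⟩⟩
    · refine Set.ext fun (e : C.E) => ⟨?_, fun h => ?_⟩
      · rintro ⟨h1, h2⟩
        obtain ⟨x, hx, rfl⟩ := (hedges e).1 h2
        have h3 := (edge_mem_core hX).1 h1
        exact List.mem_map.2 ⟨x, (hl x).2 ⟨hx, fun h => h3.1 (h ▸ hbB), h3.2⟩, rfl⟩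
      · obtain ⟨x, hx, rfl⟩ := List.mem_map.1 h
        obtain ⟨h1, h2, h3⟩ := (hl x).1 hx
        refine ⟨(edge_mem_core hX).2 ⟨fun h => ?_, h3⟩, (hedges _).2 ⟨x, h1, rfl⟩⟩
        rcases hB x h1 h with rfl | rfl
        · exact ha h3
        · exact h2 rfl
  · rintro f ⟨h1, d, h2, h3⟩
    exact ⟨h1, d, h3, h2 ▸ hvK⟩
  · rintro e ⟨h1, d, h2, h3⟩
    exact ⟨h1, d, h3, h2 ▸ hvK⟩

theorem sameCycle_rot_symm {a x : D} : Equiv.Perm.SameCycle C.rot.symm a x ↔ C.src a = C.src x := by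
  rw [src_eq_iff]; exact Equiv.Perm.sameCycle_inv

theorem sameCycle_dual_facePerm {a x : D} :
    C.dual.facePerm.SameCycle a x ↔ C.tgt a = C.tgt x := by
  rw [← left_eq_iff, dual_left, dual_left, C.dualFace.injective.eq_iff]

namespace OrientedTemplate

theorem core_W_isClosed [Finite D] (T : OrientedTemplate C N S WE EW W Ea) :
    (C.core (C.pathEdges WE EW) (C.pathVerts N WE EW) W).IsClosed :=
  core_isClosed (fun _ => T.side_W) fun _ => T.src_mem_pathVerts

theorem core_Ea_isClosed [Finite D] (T : OrientedTemplate C N S WE EW W Ea) :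
    (C.core (C.pathEdges WE EW) (C.pathVerts N WE EW) Ea).IsClosed :=
  core_isClosed (fun _ => T.side_Ea) fun _ => T.src_mem_pathVerts

theorem core_W_joined (T : OrientedTemplate C N S WE EW W Ea) : ∀ f ∈ W, ∀ g ∈ W,
    C.dual.Joined (C.core (C.pathEdges WE EW) (C.pathVerts N WE EW) W).edges f g :=
  fun f hf g hg => core_joined (fun _ => T.side_W) hf ((T.hemi.2.2.2 f g).2 (iff_of_true hf hg))

theorem core_Ea_joined (T : OrientedTemplate C N S WE EW W Ea) : ∀ f ∈ Ea, ∀ g ∈ Ea,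
    C.dual.Joined (C.core (C.pathEdges WE EW) (C.pathVerts N WE EW) Ea).edges f g :=
  fun f hf g hg => core_joined (fun _ => T.side_Ea) hf
    ((T.hemi.2.2.2 f g).2 (iff_of_false (T.mem_Ea.1 hf) (T.mem_Ea.1 hg)))

theorem N_mem_pathVerts : N ∈ C.pathVerts N WE EW := Or.inl (by simp)

theorem S_mem_pathVerts (T : OrientedTemplate C N S WE EW W Ea) : S ∈ C.pathVerts N WE EW :=
  Or.inl ((T.path_WE.1.mem_verts_iff S).2 (Or.inr rfl))

theorem dualFace_not_mem_core {v : C.V} (hv : v ∈ C.pathVerts N WE EW) (X : Set C.F) :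
    C.dualFace v ∉ (C.core (C.pathEdges WE EW) (C.pathVerts N WE EW) X).faces :=
  fun h => h.1 (by simpa using hv)

/-- Each core is connected and misses a face, so its Euler characteristic is at most 1. The sphere
consists of the two cores and the meridian cells, which contribute at most 0, so the two
characteristics add up to at least 2. -/
theorem cores_isContractible [Finite D] (T : OrientedTemplate C N S WE EW W Ea) :
    (C.core (C.pathEdges WE EW) (C.pathVerts N WE EW) W).IsContractible ∧
      (C.core (C.pathEdges WE EW) (C.pathVerts N WE EW) Ea).IsContractible := by
  set KW := C.core (C.pathEdges WE EW) (C.pathVerts N WE EW) W with hKW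
  set KE := C.core (C.pathEdges WE EW) (C.pathVerts N WE EW) Ea with hKE
  have hsph : C.dual.IsSphere := C.isSphere_dual.2 T.sphere
  have eW := KW.euler_le hsph.1 T.core_W_isClosed T.core_W_joined T.hemi.1
    (dualFace_not_mem_core N_mem_pathVerts W)
  have eE := KE.euler_le hsph.1 T.core_Ea_isClosed T.core_Ea_joined T.hemi.2.1
    (dualFace_not_mem_core N_mem_pathVerts Ea)
  have hF : KW.verts.ncard + KE.verts.ncard = Nat.card C.F := by
    change W.ncard + Ea.ncard = _
    rw [← T.hemi.2.2.1.compl_eq, Set.ncard_add_ncard_compl]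
  have hE : KW.edges.ncard + KE.edges.ncard + (C.pathEdges WE EW).ncard ≤ Nat.card C.E := by
    have h1 : Disjoint KW.edges KE.edges := by
      refine Set.disjoint_left.2 fun e he he' => ?_
      obtain ⟨d, -, rfl⟩ := C.exists_edge e
      exact T.mem_Ea.1 ((edge_mem_core fun _ => T.side_Ea).1 he').2
        ((edge_mem_core fun _ => T.side_W).1 he).2
    have h2 : Disjoint (KW.edges ∪ KE.edges) (C.pathEdges WE EW) :=
      Set.disjoint_left.2 fun e he he' => he.elim (fun h => h.1 he') fun h => h.1 he'
    have h3 := Set.ncard_union_eq h2 (Set.toFinite _) (Set.toFinite _)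
    rw [Set.ncard_union_eq h1 (Set.toFinite _) (Set.toFinite _)] at h3
    exact h3.symm.le.trans (Set.ncard_le_card _)
  have hV : Nat.card C.V ≤ KW.faces.ncard + KE.faces.ncard + (C.pathVerts N WE EW).ncard := by
    have h1 : (Set.univ : Set C.dual.F) ⊆
        KW.faces ∪ KE.faces ∪ C.dualFace '' C.pathVerts N WE EW := by
      intro f _
      obtain ⟨v, rfl⟩ := C.dualFace.surjective f
      obtain ⟨d, rfl⟩ := C.exists_src v
      by_cases hP : C.src d ∈ C.pathVerts N WE EW
      · exact Or.inr ⟨_, hP, rfl⟩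
      · by_cases hW : C.left d ∈ W
        · exact Or.inl (Or.inl ((dualFace_mem_core (fun _ => T.side_W)
            fun _ => T.src_mem_pathVerts).2 ⟨hP, hW⟩))
        · exact Or.inl (Or.inr ((dualFace_mem_core (fun _ => T.side_Ea)
            fun _ => T.src_mem_pathVerts).2 ⟨hP, T.mem_Ea.2 hW⟩))
    have h2 := Set.ncard_le_ncard h1 (Set.toFinite _)
    rw [Set.ncard_univ, ← Nat.card_congr C.dualFace] at h2
    have h3 := Set.ncard_union_le (KW.faces ∪ KE.faces) (C.dualFace '' C.pathVerts N WE EW)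
    have h4 := Set.ncard_union_le KW.faces KE.faces
    rw [Set.ncard_image_of_injective _ C.dualFace.injective] at h3
    omega
  have hP := T.ncard_pathVerts_le
  have hχ := T.sphere.2
  exact ⟨⟨T.hemi.1, T.core_W_joined, by omega⟩, ⟨T.hemi.2.1, T.core_Ea_joined, by omega⟩⟩

/-- By `source_W` and `sink_W`, only the Western faces at the first edges of the meridians can be
source and sink. They are on the boundary because the polar face of `N` is missing from the core. -/
theorem core_W_isPlanarSturm [Finite D] (T : OrientedTemplate C N S WE EW W Ea)
    {a b : D} (ha : a ∈ WE) (ha' : C.src a = N) (hb : b ∈ EW)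
    (hb' : C.src b = N) :
    (C.core (C.pathEdges WE EW) (C.pathVerts N WE EW) W).IsPlanarSturm (C.right a) (C.left b) := by
  have hN := dualFace_not_mem_core (N := N) (WE := WE) (EW := EW) N_mem_pathVerts W
  refine ⟨T.core_W_isClosed, ⟨_, hN⟩, T.cores_isContractible.1,
    Cells.isBipolar_of_unique T.hemi.1 T.core_W_isClosed ?_ ?_ ?_, ?_, ?_⟩
  · exact fun l h1 h2 f => T.not_dual_cycle h1
      (fun d hd => ⟨(h2 d hd).1, ((edge_mem_core fun _ => T.side_W).1 (h2 d hd).2).1⟩) f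
  · intro f hf h
    obtain ⟨a', h1, h2, h3⟩ := T.source_W hf fun d hd hB hdf => h d hd
      ((edge_mem_core fun _ => T.side_W).2 ⟨hB, (T.side_W hB).2 (hdf ▸ hf)⟩) hdf
    rw [← h3, T.path_WE.eq_of_src_eq ha h1 (ha'.trans h2.symm)]
  · intro f hf h
    obtain ⟨a', h1, h2, h3⟩ := T.sink_W hf fun d hd hB hdf => h d hd
      ((edge_mem_core fun _ => T.side_W).2 ⟨hB, hdf ▸ hf⟩) hdf
    rw [← h3, T.path_EW.eq_of_src_eq hb h1 (hb'.trans h2.symm)]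
  · refine ⟨T.right_WE a ha, C.opp a, rfl, ?_⟩
    rwa [dual_left, tgt_opp, ha']
  · refine ⟨T.left_EW b hb, C.facePerm.symm b, ?_, ?_⟩
    · rw [dual_src, ← left_facePerm, Equiv.apply_symm_apply]
    · rwa [dual_left, ← src_facePerm, Equiv.apply_symm_apply, hb']

theorem core_Ea_isPlanarSturm [Finite D] (T : OrientedTemplate C N S WE EW W Ea)
    {a b : D} (ha : a ∈ EW) (ha' : C.tgt a = S) (hb : b ∈ WE)
    (hb' : C.tgt b = S) :
    (C.core (C.pathEdges WE EW) (C.pathVerts N WE EW) Ea).IsPlanarSturm (C.right a) (C.left b) := by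
  have hS := dualFace_not_mem_core T.S_mem_pathVerts Ea
  refine ⟨T.core_Ea_isClosed, ⟨_, hS⟩, T.cores_isContractible.2,
    Cells.isBipolar_of_unique T.hemi.2.1 T.core_Ea_isClosed ?_ ?_ ?_, ?_, ?_⟩
  · exact fun l h1 h2 f => T.not_dual_cycle h1
      (fun d hd => ⟨(h2 d hd).1, ((edge_mem_core fun _ => T.side_Ea).1 (h2 d hd).2).1⟩) f
  · intro f hf h
    obtain ⟨a', h1, h2, h3⟩ := T.source_Ea hf fun d hd hB hdf => h d hd
      ((edge_mem_core fun _ => T.side_Ea).2 ⟨hB, (T.side_Ea hB).2 (hdf ▸ hf)⟩) hdf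
    rw [← h3, T.path_EW.eq_of_tgt_eq ha h1 (ha'.trans h2.symm)]
  · intro f hf h
    obtain ⟨a', h1, h2, h3⟩ := T.sink_Ea hf fun d hd hB hdf => h d hd
      ((edge_mem_core fun _ => T.side_Ea).2 ⟨hB, hdf ▸ hf⟩) hdf
    rw [← h3, T.path_WE.eq_of_tgt_eq hb h1 (hb'.trans h2.symm)]
  · refine ⟨T.right_EW a ha, C.facePerm.symm (C.opp a), ?_, ?_⟩
    · rw [dual_src, ← left_facePerm, Equiv.apply_symm_apply, left_opp]
    · rwa [dual_left, ← src_facePerm, Equiv.apply_symm_apply, src_opp, ha']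
  · refine ⟨T.left_WE b hb, b, rfl, ?_⟩
    rwa [dual_left, hb']

/-- All edges at `N` leave it and only two are meridian edges, so turning clockwise from `WE` to
`EW` sweeps exactly the Western faces at `N`. -/
theorem isPolarSegment_W [Finite D] (T : OrientedTemplate C N S WE EW W Ea)
    {a b : D} (ha : a ∈ WE) (ha' : C.src a = N) (hb : b ∈ EW)
    (hb' : C.src b = N) :
    C.dual.IsPolarSegment (C.core (C.pathEdges WE EW) (C.pathVerts N WE EW) W) (C.dualFace N)
      (C.right a) (C.left b) := by
  have hO : ∀ x, Equiv.Perm.SameCycle C.rot.symm a x ↔ C.src x = N := fun x => by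
    rw [sameCycle_rot_symm, ha', eq_comm]
  refine isPolarSegment_core (fun _ => T.side_W) N_mem_pathVerts C.rot.symm (fun x => ?_)
    ((hO b).2 hb') (edge_mem_pathEdges_left ha) (edge_mem_pathEdges_right hb) (fun x hx hB => ?_)
    (fun x hx => T.dir_of_src_eq_N ((hO x).1 hx)) (T.mem_Ea.1 (T.left_WE a ha)) (T.right_WE a ha)
    (T.left_EW b hb) (T.mem_Ea.1 (T.right_EW b hb)) (fun x y hx hy h => ?_) ?_ ?_
  · rw [← right_rot, Equiv.apply_symm_apply]
  · rw [hO] at hx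
    rcases T.mem_cases (T.dir_of_src_eq_N hx) hB with h | h
    · exact Or.inl (T.path_WE.eq_of_src_eq h ha (hx.trans ha'.symm))
    · exact Or.inr (T.path_EW.eq_of_src_eq h hb (hx.trans hb'.symm))
  · exact T.regular.2.2 x y h (((hO x).1 hx).trans ((hO y).1 hy).symm)
  · intro _
    constructor
    · rintro ⟨d, h1, h2⟩
      rw [dual_left, C.dualFace.injective.eq_iff] at h1
      exact ⟨C.facePerm d, (hO _).2 (by simpa using h1), (C.left_facePerm d).trans h2⟩
    · rintro ⟨x, h1, h2⟩
      obtain ⟨d, rfl⟩ := C.facePerm.surjective x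
      refine ⟨d, ?_, (C.left_facePerm d).symm.trans h2⟩
      rw [dual_left, ← src_facePerm, (hO _).1 h1]
  · intro _
    constructor
    · rintro ⟨d, h1, h2⟩
      rw [dual_left, C.dualFace.injective.eq_iff] at h1
      exact ⟨C.opp d, (hO _).2 h1, (C.edge_opp d).trans h2⟩
    · rintro ⟨x, h1, h2⟩
      refine ⟨C.opp x, ?_, (C.edge_opp x).trans h2⟩
      rw [dual_left, tgt_opp, (hO _).1 h1]

/-- At `S` all edges arrive; the sweep runs from `EW` to `WE` and uses `C.dual.facePerm`, which
permutes the darts with a common end. -/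
theorem isPolarSegment_Ea [Finite D] (T : OrientedTemplate C N S WE EW W Ea)
    {a b : D} (ha : a ∈ EW) (ha' : C.tgt a = S) (hb : b ∈ WE)
    (hb' : C.tgt b = S) :
    C.dual.IsPolarSegment (C.core (C.pathEdges WE EW) (C.pathVerts N WE EW) Ea) (C.dualFace S)
      (C.right a) (C.left b) := by
  have hO : ∀ x, C.dual.facePerm.SameCycle a x ↔ C.tgt x = S := fun x => by
    rw [sameCycle_dual_facePerm, ha', eq_comm]
  refine isPolarSegment_core (fun _ => T.side_Ea) T.S_mem_pathVerts C.dual.facePerm (fun x => ?_)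
    ((hO b).2 hb') (edge_mem_pathEdges_right ha) (edge_mem_pathEdges_left hb) (fun x hx hB => ?_)
    (fun x hx => T.dir_of_tgt_eq_S ((hO x).1 hx)) (fun h => T.mem_Ea.1 h (T.left_EW a ha))
    (T.right_EW a ha)
    (T.left_WE b hb) (fun h => T.mem_Ea.1 h (T.right_WE b hb)) (fun x y hx hy h => ?_) ?_ ?_
  · exact C.dual.src_facePerm x
  · rw [hO] at hx
    rcases T.mem_cases (T.dir_of_tgt_eq_S hx) hB with h | h
    · exact Or.inr (T.path_WE.eq_of_tgt_eq h hb (hx.trans hb'.symm))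
    · exact Or.inl (T.path_EW.eq_of_tgt_eq h ha (hx.trans ha'.symm))
  · refine C.facePerm.injective (T.regular.2.2 _ _ (by simpa using h) ?_)
    rw [src_facePerm, src_facePerm, (hO x).1 hx, (hO y).1 hy]
  · intro _
    constructor
    · rintro ⟨d, h1, h2⟩
      rw [dual_left, C.dualFace.injective.eq_iff] at h1
      exact ⟨d, (hO _).2 h1, h2⟩
    · rintro ⟨d, h1, h2⟩
      exact ⟨d, by rw [dual_left, (hO _).1 h1], h2⟩
  · intro _
    constructor
    · rintro ⟨d, h1, h2⟩
      rw [dual_left, C.dualFace.injective.eq_iff] at h1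
      exact ⟨d, (hO _).2 h1, h2⟩
    · rintro ⟨d, h1, h2⟩
      exact ⟨d, by rw [dual_left, (hO _).1 h1], h2⟩

end OrientedTemplate

end DirectedComplex

/-! ### From the template to the dual: decomposition and bridges. -/

namespace DirectedComplex

variable {D : Type*} {C : DirectedComplex D} {N S : C.V} {WE EW : List D} {W Ea : Set C.F}

/-- The edges and interior vertices of a path to `b`, as edges and faces of the dual. -/
def pathDual (C : DirectedComplex D) (b : C.V) (p : List D) : C.dual.Cells where
  verts := ∅
  edges := {e | e ∈ p.map C.edge}
  faces := {f | C.dualFace.symm f ≠ b ∧ C.dualFace.symm f ∈ p.map C.tgt}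

theorem edge_mem_map_iff {p : List D} (hp : ∀ d ∈ p, C.dir d) {d : D} (hd : C.dir d) :
    C.edge d ∈ p.map C.edge ↔ d ∈ p := by
  refine ⟨fun h => ?_, fun h => List.mem_map_of_mem h⟩
  obtain ⟨e, he, h⟩ := List.mem_map.1 h
  rwa [← C.eq_of_edge_eq (hp e he) hd h]

/-- With each membership replaced by an equivalent proposition, the decomposition of vertices, edges
and faces becomes propositional reasoning. -/
theorem existsUnique_fin_six {P : Fin 6 → Prop} {q₀ q₁ q₂ q₃ q₄ q₅ : Prop} (h₀ : P 0 ↔ q₀)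
    (h₁ : P 1 ↔ q₁) (h₂ : P 2 ↔ q₂) (h₃ : P 3 ↔ q₃) (h₄ : P 4 ↔ q₄) (h₅ : P 5 ↔ q₅)
    (hex : ¬ q₀ → ¬ q₁ → ¬ q₂ → ¬ q₃ → ¬ q₄ → q₅) (h0 : q₀ → ¬ q₁ ∧ ¬ q₂ ∧ ¬ q₃ ∧ ¬ q₄ ∧ ¬ q₅)
    (h1 : q₁ → ¬ q₂ ∧ ¬ q₃ ∧ ¬ q₄ ∧ ¬ q₅) (h2 : q₂ → ¬ q₃ ∧ ¬ q₄ ∧ ¬ q₅) (h3 : q₃ → ¬ q₄ ∧ ¬ q₅)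
    (h4 : q₄ → ¬ q₅) : ∃! i, P i := by
  have hall : ∀ A : Fin 6 → Prop, A 0 → A 1 → A 2 → A 3 → A 4 → A 5 → ∀ i, A i := by
    intro A a0 a1 a2 a3 a4 a5 i
    match i with
    | 0 => exact a0
    | 1 => exact a1
    | 2 => exact a2
    | 3 => exact a3
    | 4 => exact a4
    | 5 => exact a5
  rw [← h₀, ← h₁, ← h₂, ← h₃, ← h₄, ← h₅] at *
  clear h₀ h₁ h₂ h₃ h₄ h₅
  by_cases k0 : P 0
  · obtain ⟨n1, n2, n3, n4, n5⟩ := h0 k0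
    exact ⟨0, k0,
      hall _ (fun _ => rfl) (absurd · n1) (absurd · n2) (absurd · n3) (absurd · n4) (absurd · n5)⟩
  by_cases k1 : P 1
  · obtain ⟨n2, n3, n4, n5⟩ := h1 k1
    exact ⟨1, k1,
      hall _ (absurd · k0) (fun _ => rfl) (absurd · n2) (absurd · n3) (absurd · n4) (absurd · n5)⟩
  by_cases k2 : P 2
  · obtain ⟨n3, n4, n5⟩ := h2 k2
    exact ⟨2, k2,
      hall _ (absurd · k0) (absurd · k1) (fun _ => rfl) (absurd · n3) (absurd · n4) (absurd · n5)⟩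
  by_cases k3 : P 3
  · obtain ⟨n4, n5⟩ := h3 k3
    exact ⟨3, k3,
      hall _ (absurd · k0) (absurd · k1) (absurd · k2) (fun _ => rfl) (absurd · n4) (absurd · n5)⟩
  by_cases k4 : P 4
  · obtain n5 := h4 k4
    exact ⟨4, k4,
      hall _ (absurd · k0) (absurd · k1) (absurd · k2) (absurd · k3) (fun _ => rfl) (absurd · n5)⟩
  · exact ⟨5, hex k0 k1 k2 k3 k4,
      hall _ (absurd · k0) (absurd · k1) (absurd · k2) (absurd · k3) (absurd · k4) (fun _ => rfl)⟩

theorem exists_first {p : List D} {a b : C.V} (hp : IsDirectedWalk C.src C.tgt a b p)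
    (h : p ≠ []) : ∃ d ∈ p, p.head? = some d ∧ C.src d = a := by
  cases p with
  | nil => exact absurd rfl h
  | cons d l => exact ⟨d, by simp, rfl, hp.1⟩

theorem exists_last {p : List D} {a b : C.V} (hp : IsDirectedWalk C.src C.tgt a b p)
    (h : p ≠ []) : ∃ d ∈ p, p.getLast? = some d ∧ C.tgt d = b := by
  obtain ⟨l, d, rfl⟩ : ∃ l d, p = l ++ [d] := ⟨_, _, (List.dropLast_append_getLast h).symm⟩
  obtain ⟨c, -, -, hc⟩ := isDirectedWalk_append_iff.1 hp
  exact ⟨d, by simp, by simp, hc⟩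

theorem map_dual_left (a : C.V) (p : List D) :
    C.dualFace a :: p.map C.dual.left = (a :: p.map C.tgt).map C.dualFace := by
  rw [List.map_cons, List.map_map]
  congr 1
  exact List.map_congr_left fun d _ => C.dual_left d

theorem eq_of_mem_faceEdges {d : D} {f : C.F} (h : C.edge d ∈ C.faceEdges f) :
    f = C.left d ∨ f = C.right d := by
  obtain ⟨d', rfl, h⟩ := h
  rcases C.edge_eq_iff.1 h with rfl | rfl
  · exact Or.inl rfl
  · exact Or.inr (by simp)

theorem isDirectedPath_dual {a b : C.V} {p : List D} (hp : IsDirectedPath C.src C.tgt a b p) :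
    IsDirectedPath C.dual.right C.dual.left (C.dualFace a) (C.dualFace b) p := by
  refine ⟨?_, ?_⟩
  · have := hp.1
    clear hp
    induction p generalizing a with
    | nil => exact congrArg _ this
    | cons d l ih =>
      refine ⟨congrArg C.dualFace this.1, ?_⟩
      rw [dual_left]
      exact ih this.2
  · rw [map_dual_left]
    exact hp.2.map C.dualFace.injective

theorem pathsDisjoint_dual {a b : C.V} {p q : List D} (h : PathsDisjoint C.tgt a b p q) :
    PathsDisjoint C.dual.left (C.dualFace a) (C.dualFace b) p q := by
  refine ⟨h.1, ?_⟩
  intro x hx hx'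
  rw [map_dual_left] at hx hx'
  obtain ⟨v, hv, rfl⟩ := List.mem_map.1 hx
  rw [List.mem_map_of_injective C.dualFace.injective] at hx'
  exact (h.2 v hv hx').imp (congrArg _) (congrArg _)

namespace OrientedTemplate

theorem decomposesInto [Finite D] (T : OrientedTemplate C N S WE EW W Ea) :
    C.dual.DecomposesInto ![C.dual.faceCell (C.dualFace N), C.dual.faceCell (C.dualFace S),
      C.core (C.pathEdges WE EW) (C.pathVerts N WE EW) W,
      C.core (C.pathEdges WE EW) (C.pathVerts N WE EW) Ea,
      C.pathDual S EW, C.pathDual S WE] := by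
  refine ⟨fun f => ?_, fun e => ?_, fun f => ?_⟩
  · change C.F at f
    exact existsUnique_fin_six (q₀ := False) (q₁ := False) (q₂ := f ∈ W) (q₃ := f ∉ W)
      (q₄ := False) (q₅ := False) Iff.rfl Iff.rfl Iff.rfl T.mem_Ea Iff.rfl Iff.rfl
      (by grind) (by grind) (by grind) (by grind) (by grind) (by grind)
  · obtain ⟨d, hd, rfl⟩ := C.dual.exists_edge e
    have h3 := edge_mem_core (P := C.pathVerts N WE EW) (fun _ => T.side_W) (d := d)
    have h4 := edge_mem_core (P := C.pathVerts N WE EW) (fun _ => T.side_Ea) (d := d)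
    have h5 : C.dual.edge d ∈ (C.pathDual S EW).edges ↔ d ∈ EW := edge_mem_map_iff T.dir_EW hd
    have h6 : C.dual.edge d ∈ (C.pathDual S WE).edges ↔ d ∈ WE := edge_mem_map_iff T.dir_WE hd
    have hB := mem_pathEdges_iff_of_dir T.dir_WE T.dir_EW hd
    have hE := T.mem_Ea (f := C.left d)
    have hdisj := T.disj.1 d
    exact existsUnique_fin_six (q₀ := False) (q₁ := False) Iff.rfl Iff.rfl h3 h4 h5 h6
      (by grind) (by grind) (by grind) (by grind) (by grind) (by grind)
  · obtain ⟨v, rfl⟩ := C.dualFace.surjective f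
    obtain ⟨d, rfl⟩ := C.exists_src v
    have h1 : C.dualFace (C.src d) ∈ (C.dual.faceCell (C.dualFace N)).faces ↔ C.src d = N :=
      C.dualFace.injective.eq_iff
    have h2 : C.dualFace (C.src d) ∈ (C.dual.faceCell (C.dualFace S)).faces ↔ C.src d = S :=
      C.dualFace.injective.eq_iff
    have h3 := dualFace_mem_core (fun _ => T.side_W) (fun _ => T.src_mem_pathVerts) (d := d)
    have h4 := dualFace_mem_core (fun _ => T.side_Ea) (fun _ => T.src_mem_pathVerts) (d := d)
    have h5 : C.dualFace (C.src d) ∈ (C.pathDual S EW).faces ↔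
        C.src d ≠ S ∧ C.src d ∈ EW.map C.tgt := by
      simp only [pathDual, Set.mem_ofPred_eq, Equiv.symm_apply_apply]
    have h6 : C.dualFace (C.src d) ∈ (C.pathDual S WE).faces ↔
        C.src d ≠ S ∧ C.src d ∈ WE.map C.tgt := by
      simp only [pathDual, Set.mem_ofPred_eq, Equiv.symm_apply_apply]
    have hE := T.mem_Ea (f := C.left d)
    have hP : C.src d ∈ C.pathVerts N WE EW ↔
        C.src d = N ∨ C.src d ∈ WE.map C.tgt ∨ C.src d ∈ EW.map C.tgt := by
      simp only [pathVerts, Set.mem_ofPred_eq, List.mem_cons]; grind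
    have hS : C.src d = S → C.src d ∈ C.pathVerts N WE EW := fun h => h ▸ T.S_mem_pathVerts
    have hNS := T.N_ne_S
    have hN1 : C.src d = N → C.src d ∉ WE.map C.tgt := fun h => by
      rw [h]; exact (List.nodup_cons.1 T.path_WE.2).1
    have hN2 : C.src d = N → C.src d ∉ EW.map C.tgt := fun h => by
      rw [h]; exact (List.nodup_cons.1 T.path_EW.2).1
    have hd := T.disj.2 (C.src d)
    simp only [List.mem_cons] at hd
    exact existsUnique_fin_six h1 h2 h3 h4 h5 h6
      (by grind) (fun h => by have : C.src d ≠ S := fun h' => hNS (h.symm.trans h'); grind)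
      (by grind) (by grind) (by grind) (by grind)

theorem dualConditions [Finite D] (T : OrientedTemplate C N S WE EW W Ea) :
    C.dual.DualConditions := by
  obtain ⟨a, ha, ha0, ha1⟩ := exists_first T.path_WE.1 T.WE_ne_nil
  obtain ⟨b, hb, hb0, hb1⟩ := exists_first T.path_EW.1 T.EW_ne_nil
  obtain ⟨a', ha', ha0', ha1'⟩ := exists_last T.path_EW.1 T.EW_ne_nil
  obtain ⟨b', hb', hb0', hb1'⟩ := exists_last T.path_WE.1 T.WE_ne_nil
  refine ⟨C.isSphere_dual.2 T.sphere, C.isRegular_dual.2 T.regular, C.dualFace N, C.dualFace S,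
    C.core (C.pathEdges WE EW) (C.pathVerts N WE EW) W,
    C.core (C.pathEdges WE EW) (C.pathVerts N WE EW) Ea,
    C.pathDual S EW, C.pathDual S WE, C.right a, C.left b, C.right a', C.left b',
    T.decomposesInto, T.core_W_isPlanarSturm ha ha1 hb hb1,
    T.core_Ea_isPlanarSturm ha' ha1' hb' hb1', rfl, rfl, fun d hd h => ?_, fun d hd h => ?_,
    T.isPolarSegment_W ha ha1 hb hb1, T.isPolarSegment_Ea ha' ha1' hb' hb1', ?_,
    ⟨EW, WE, ⟨T.dir_EW, isDirectedPath_dual T.path_EW, rfl⟩,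
      ⟨T.dir_WE, isDirectedPath_dual T.path_WE, rfl⟩,
      pathsDisjoint_dual (PathsDisjoint.symm T.disj)⟩, ?_, ?_⟩
  · obtain ⟨d', h1, h2⟩ := h
    rw [dual_left, C.dualFace.injective.eq_iff] at h1
    rcases C.edge_eq_iff.1 h2 with rfl | rfl
    · exact absurd h1 (T.tgt_ne_N hd)
    · rw [dual_right, src_opp, h1]
  · obtain ⟨d', h1, h2⟩ := h
    rw [dual_left, C.dualFace.injective.eq_iff] at h1
    rcases C.edge_eq_iff.1 h2 with rfl | rfl
    · rw [dual_left, h1]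
    · exact absurd h1 (T.src_ne_S hd)
  · exact Set.disjoint_left.2 fun f hf hf' => T.mem_Ea.1 hf'.1 hf.1
  -- The Western face `f` lies to the right of the first edge of `WE`, and the Eastern face `g` to
  -- the left of its last edge. The shared edge `d` separates the same two faces, so its dual is the
  -- bridge.
  · obtain ⟨f, hf, g, hg, ⟨x, hx, hx'⟩, ⟨y, hy, hy'⟩, d, hd, h1, h2⟩ := T.overlap_WE
    obtain rfl : a = x := by rw [ha0] at hx; simpa using hx
    obtain rfl : b' = y := by rw [hb0'] at hy; simpa using hy
    obtain rfl : f = C.right a := (eq_of_mem_faceEdges hx').resolve_left fun h =>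
      T.mem_Ea.1 (T.left_WE a ha) (h ▸ hf)
    obtain rfl : g = C.left b' := (eq_of_mem_faceEdges hy').resolve_right fun h =>
      T.mem_Ea.1 hg (h ▸ T.right_WE b' hb')
    refine ⟨d, T.dir_WE d hd, List.mem_map_of_mem hd, ?_, ?_⟩
    · exact ((eq_of_mem_faceEdges h2).resolve_right fun h =>
        T.mem_Ea.1 hg (h ▸ T.right_WE d hd)).symm
    · exact ((eq_of_mem_faceEdges h1).resolve_left fun h =>
        T.mem_Ea.1 (T.left_WE d hd) (h ▸ hf)).symm
  · obtain ⟨f, hf, g, hg, ⟨x, hx, hx'⟩, ⟨y, hy, hy'⟩, d, hd, h1, h2⟩ := T.overlap_EW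
    obtain rfl : b = x := by rw [hb0] at hx; simpa using hx
    obtain rfl : a' = y := by rw [ha0'] at hy; simpa using hy
    obtain rfl : f = C.left b := (eq_of_mem_faceEdges hx').resolve_right fun h =>
      T.mem_Ea.1 (T.right_EW b hb) (h ▸ hf)
    obtain rfl : g = C.right a' := (eq_of_mem_faceEdges hy').resolve_left fun h =>
      T.mem_Ea.1 hg (h ▸ T.left_EW a' ha')
    refine ⟨d, T.dir_EW d hd, List.mem_map_of_mem hd, ?_, ?_⟩
    · exact ((eq_of_mem_faceEdges h1).resolve_right fun h =>
        T.mem_Ea.1 (T.right_EW d hd) (h ▸ hf)).symm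
    · exact ((eq_of_mem_faceEdges h2).resolve_left fun h =>
        T.mem_Ea.1 hg (h ▸ T.left_EW d hd)).symm

end OrientedTemplate

end DirectedComplex

/-! ### Monotonicity and propagation along paths. -/

theorem IsDirectedWalk.strict_monotone {D X : Type*} {src tgt : D → X} {a b : X} {l : List D}
    (h : IsDirectedWalk src tgt a b l) (g : X → ℝ) (hg : ∀ d ∈ l, g (src d) ≤ g (tgt d)) {d : D}
    (hd : d ∈ l) (hlt : g (src d) < g (tgt d)) : g a < g b := by
  obtain ⟨l₁, l₂, rfl⟩ := List.append_of_mem hd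
  obtain ⟨c, h1, rfl, h2⟩ := isDirectedWalk_append_iff.1 h
  have := h1.monotone g fun e he => hg e (by simp [he])
  have := h2.monotone g fun e he => hg e (by simp [he])
  linarith

/-- Carries `P` from the first entry of `p` up to `d`; the condition `d ∈ b :: p₂` says that `b` has
not passed `d`. -/
theorem List.forward_propagation {D : Type*} {p : List D} {d : D} {P : D → Prop}
    (base : ∀ b p₂, p = b :: p₂ → P b)
    (step : ∀ p₁ a b p₂, p = p₁ ++ a :: b :: p₂ → d ∈ b :: p₂ → P a → P b) :
    ∀ p₁ b p₂, p = p₁ ++ b :: p₂ → d ∈ b :: p₂ → P b := by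
  intro p₁
  induction p₁ using List.reverseRecOn with
  | nil => exact fun b p₂ h _ => base b p₂ h
  | append_singleton p₁ a ih =>
    intro b p₂ h hd
    have h' : p = p₁ ++ a :: b :: p₂ := by simpa using h
    exact step p₁ a b p₂ h' hd (ih a (b :: p₂) h' (List.mem_cons_of_mem _ hd))

/-- Carries `P` from the last entry of `p` back to `d`. -/
theorem List.backward_propagation {D : Type*} {p : List D} {d : D} {P : D → Prop}
    (base : ∀ a p₁, p = p₁ ++ [a] → P a)
    (step : ∀ p₁ a b p₂, p = p₁ ++ a :: b :: p₂ → d ∈ p₁ ++ [a] → P b → P a) :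
    ∀ p₂ p₁ a, p = p₁ ++ a :: p₂ → d ∈ p₁ ++ [a] → P a := by
  intro p₂
  induction p₂ with
  | nil => exact fun p₁ a h _ => base a p₁ h
  | cons b p₂ ih =>
    intro p₁ a h hd
    exact step p₁ a b p₂ h hd (ih (p₁ ++ [a]) b (by simpa using h) (List.mem_append_left _ hd))

/-! ### Meridians with a bridge. -/

namespace DirectedComplex

variable {D : Type*} {C : DirectedComplex D}

/-- Let `α`, `β` be two darts at a vertex, around which `σ` rotates from side `R` to side `L`. If
`X` is entered across `α`, in the face `w`, and left across `β`, and if `w` cannot be left across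
any other dart, then `w` is the only face of `X` at the vertex. -/
theorem sector {v : C.V} (σ : Equiv.Perm D) (L R : D → C.F) (hσ : ∀ y, R (σ y) = L y)
    (hv : ∀ y, C.src (σ y) = C.src y) (X : Set C.F) {α β : D} {w : C.F} (hw : w ∈ X)
    (hα : C.src α = v) (hβ : ∀ y, C.src y = v → ∃ n : ℕ, (σ ^ n) β = y)
    (hLα : L α = w) (hRα : R α ∉ X) (hLβ : L β ∉ X)
    (hy : ∀ y, C.src y = v → y ≠ α → y ≠ β → (L y ∈ X ↔ R y ∈ X) ∧ R y ≠ w) :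
    R β = w ∧ ∀ y, C.src y = v → y ≠ α → L y ∉ X := by
  have hR : R (σ α) = w := (hσ α).trans hLα
  -- The dart after `α` has `w` on its `R` side. It is not `α`, whose `R` side is off `X`, and no
  -- third dart has `w` there.
  have h1 : σ α = β := by
    by_contra h
    refine (hy (σ α) ((hv α).trans hα) (fun h' => hRα ?_) h).2 hR
    rw [← h', hR]; exact hw
  refine ⟨h1 ▸ hR, fun y hyv hyα => ?_⟩
  -- From `β` on, the rotation is off `X` and cannot re-enter it before reaching `α`.
  have key : ∀ n : ℕ, C.src ((σ ^ n) β) = v ∧ ((σ ^ n) β = α ∨ L ((σ ^ n) β) ∉ X) := by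
    intro n
    induction n with
    | zero => exact ⟨by rw [pow_zero, Equiv.Perm.one_apply, ← h1, hv, hα], Or.inr hLβ⟩
    | succ n ih =>
      rw [pow_succ', Equiv.Perm.mul_apply]
      refine ⟨(hv _).trans ih.1, ?_⟩
      rcases ih.2 with h | h
      · rw [h, h1]; exact Or.inr hLβ
      · by_cases hα' : σ ((σ ^ n) β) = α
        · exact Or.inl hα'
        by_cases hβ' : σ ((σ ^ n) β) = β
        · rw [hβ']; exact Or.inr hLβ
        · right
          rw [(hy _ ((hv _).trans ih.1) hα' hβ').1, hσ]
          exact h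
  obtain ⟨n, rfl⟩ := hβ y hyv
  exact (key n).2.resolve_left hyα

/-- A meridian `p` with the regions `XL` to its left and `XR` to its right, and with another
meridian `q`. The region `XL` has the dual sink `t`, the region `XR` has the dual source `s`, and
the dual of `d₀` leads from `t` to `s`. -/
structure Meridian (C : DirectedComplex D) (N S : C.V) (p q : List D) (XL XR : Set C.F)
    (t s : C.F) (d₀ : D) : Prop where
  sphere : C.IsSphere
  bipolar : C.allCells.IsBipolar N S
  dir_p : ∀ d ∈ p, C.dir d
  dir_q : ∀ d ∈ q, C.dir d
  path_p : IsDirectedPath C.src C.tgt N S p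
  path_q : IsDirectedPath C.src C.tgt N S q
  disj : PathsDisjoint C.tgt N S p q
  compl : ∀ f, f ∈ XL ↔ f ∉ XR
  side : ∀ d, C.edge d ∉ C.pathEdges p q → (C.left d ∈ XR ↔ C.right d ∈ XR)
  left_mem : ∀ d ∈ p, C.left d ∈ XL
  right_mem : ∀ d ∈ p, C.right d ∈ XR
  from_s : ∀ f ∈ XR, ∃ l : List D, (∀ d ∈ l, C.dir d ∧ C.edge d ∉ C.pathEdges p q) ∧
    IsDirectedWalk C.left C.right s f l
  to_t : ∀ f ∈ XL, ∃ l : List D, (∀ d ∈ l, C.dir d ∧ C.edge d ∉ C.pathEdges p q) ∧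
    IsDirectedWalk C.left C.right f t l
  source : ∀ d, C.dir d → C.edge d ∉ C.pathEdges p q → C.right d ≠ s
  sink : ∀ d, C.dir d → C.edge d ∉ C.pathEdges p q → C.left d ≠ t
  mem : d₀ ∈ p
  left_bridge : C.left d₀ = t
  right_bridge : C.right d₀ = s

namespace Meridian

variable {N S : C.V} {p q : List D} {XL XR : Set C.F} {t s : C.F} {d₀ : D}

theorem nodup (Me : Meridian C N S p q XL XR t s d₀) : p.Nodup :=
  List.Nodup.of_map _ (List.nodup_cons.1 Me.path_p.2).2

/-- The closed dual curve through the bridge `d₀` and back through `b` is a potential difference. -/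
theorem exists_potential [Finite D] (Me : Meridian C N S p q XL XR t s d₀) {b : D} (hb : b ∈ p)
    (hne : d₀ ≠ b) :
    ∃ g : C.V → ℝ, (∀ e, C.dir e → e ≠ b → g (C.src e) ≤ g (C.tgt e)) ∧
      g (C.src d₀) < g (C.tgt d₀) ∧ g N = g S := by
  obtain ⟨lR, hlR, wR⟩ := Me.from_s _ (Me.right_mem b hb)
  obtain ⟨lL, hlL, wL⟩ := Me.to_t _ (Me.left_mem b hb)
  -- The curve crosses the bridge from `t` to `s`, runs to the right of `b`, crosses `b` backwards
  -- and returns to `t`. Only `b` is crossed against its dual direction.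
  have hw : IsDirectedWalk C.left C.right t t (d₀ :: (lR ++ C.opp b :: lL)) := by
    refine ⟨Me.left_bridge, ?_⟩
    rw [Me.right_bridge]
    exact wR.append ⟨rfl, by rw [right_opp]; exact wL⟩
  obtain ⟨g, hg⟩ := Me.sphere.exists_vertex_potential hw
  have hdb := Me.dir_p b hb
  have hopp : ∀ e, C.dir e → e ≠ b → C.opp e ∉ d₀ :: (lR ++ C.opp b :: lL) := by
    intro e he hneb h
    have hne' : ¬ C.dir (C.opp e) := fun h => (C.dir_opp e).1 h he
    rcases List.mem_cons.1 h with h | h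
    · exact hne' (h ▸ Me.dir_p _ Me.mem)
    rcases List.mem_append.1 h with h | h
    · exact hne' (hlR _ h).1
    rcases List.mem_cons.1 h with h | h
    · exact hneb (C.opp.injective h)
    · exact hne' (hlL _ h).1
  refine ⟨g, fun e he hneb => ?_, ?_, ?_⟩
  · rw [← sub_nonneg, hg]
    exact chain_nonneg (hopp e he hneb)
  · rw [← sub_pos, hg]
    exact chain_pos (by simp) (hopp d₀ (Me.dir_p _ Me.mem) hne)
  -- The curve does not cross `q`, so `g` is constant along `q`.
  · have hq : ∀ e ∈ q, g (C.tgt e) - g (C.src e) = 0 := by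
      intro e he
      have hep : e ∉ p := fun h => Me.disj.1 e h he
      rw [hg]
      refine chain_eq_zero (fun h => ?_) (hopp e (Me.dir_q e he) fun h => hep (h ▸ hb))
      rcases List.mem_cons.1 h with h | h
      · exact hep (h ▸ Me.mem)
      rcases List.mem_append.1 h with h | h
      · exact (hlR _ h).2 (edge_mem_pathEdges_right he)
      rcases List.mem_cons.1 h with h | h
      · exact (C.dir_opp b).1 (h ▸ Me.dir_q e he) hdb
      · exact (hlL _ h).2 (edge_mem_pathEdges_right he)
    refine le_antisymm ?_ ?_
    · exact Me.path_q.1.monotone g fun e he => by linarith [hq e he]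
    · have := Me.path_q.1.monotone (fun v => - g v) fun e he => by linarith [hq e he]
      linarith

/-- After the bridge, the only edge which leaves a vertex of the meridian is the meridian edge. -/
theorem unique_out [Finite D] (Me : Meridian C N S p q XL XR t s d₀) {p₁ p₂ : List D} {b : D}
    (hp : p = p₁ ++ b :: p₂) (hd : d₀ ∈ p₁) {y : D} (hy : C.dir y) (hs : C.src y = C.src b) :
    y = b := by
  by_contra hyb
  have hnd := Me.nodup
  rw [hp, List.nodup_append] at hnd
  have hne : ∀ e ∈ p₁, e ≠ b := fun e he => hnd.2.2 e he b (by simp)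
  obtain ⟨g, hmono, hlt, hNS⟩ := Me.exists_potential (b := b) (by simp [hp]) (hne _ hd)
  obtain ⟨ht, hht⟩ := Me.bipolar.exists_height
  have hw := Me.path_p.1
  rw [hp] at hw
  obtain ⟨c, hw1, rfl, -⟩ := isDirectedWalk_append_iff.1 hw
  -- The bridge lifts `g` at the start of `b` strictly above `g N`. A walk that leaves through `y`
  -- never meets `b` again, since heights increase; so `g` cannot descend along it to `g S = g N`.
  have h1 := hw1.strict_monotone g (fun e he => hmono e (Me.dir_p e (by simp [hp, he])) (hne e he))
    hd hlt
  have key : ∀ (l : List D) (v : C.V), (∀ d ∈ l, C.dir d) → IsDirectedWalk C.src C.tgt v S l →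
      ht (C.src b) < ht v → g v ≤ g S := by
    intro l
    induction l with
    | nil => exact fun v _ h _ => (congrArg g h).le
    | cons e l ih =>
      rintro v hl ⟨rfl, hw⟩ hv
      have he := hl e (by simp)
      have h2 := hht e he trivial
      exact (hmono e he fun h => hv.ne (by rw [h])).trans
        (ih _ (fun d hd => hl d (by simp [hd])) hw (hv.trans h2))
  obtain ⟨l, hl, hwl⟩ := Me.bipolar.exists_walk_to allCells_isClosed (v := C.tgt y) trivial
  have h2 := key l _ (fun d hd => (hl d hd).1) hwl (hs ▸ hht y hy trivial)
  have h3 := hmono y hy hyb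
  rw [hs] at h3
  linarith

/-- Before the bridge, the only edge which enters a vertex of the meridian is the meridian edge. -/
theorem unique_in [Finite D] (Me : Meridian C N S p q XL XR t s d₀) {p₁ p₂ : List D} {b : D}
    (hp : p = p₁ ++ b :: p₂) (hd : d₀ ∈ p₂) {y : D} (hy : C.dir y) (hs : C.tgt y = C.tgt b) :
    y = b := by
  by_contra hyb
  have hnd := Me.nodup
  rw [hp, List.nodup_append] at hnd
  have hne : ∀ e ∈ p₂, e ≠ b := fun e he h => (List.nodup_cons.1 hnd.2.1).1 (h ▸ he)
  obtain ⟨g, hmono, hlt, hNS⟩ := Me.exists_potential (b := b) (by simp [hp]) (hne _ hd)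
  obtain ⟨ht, hht⟩ := Me.bipolar.exists_height
  have hw := Me.path_p.1
  rw [hp] at hw
  obtain ⟨c, -, -, hw2⟩ := isDirectedWalk_append_iff.1 hw
  -- A walk from `N` that arrives through `y` avoids `b`, so `g` is at least `g N` at the end of
  -- `b`; then the bridge would lift `g S` strictly above `g N`.
  have h1 := hw2.strict_monotone g (fun e he => hmono e (Me.dir_p e (by simp [hp, he])) (hne e he))
    hd hlt
  have key : ∀ (l : List D) (v : C.V), (∀ d ∈ l, C.dir d) →
      IsDirectedWalk C.src C.tgt v (C.src y) l → g v ≤ g (C.src y) ∧ ht v ≤ ht (C.src y) := by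
    intro l
    induction l with
    | nil => exact fun v _ h => ⟨(congrArg g h).le, (congrArg ht h).le⟩
    | cons e l ih =>
      rintro v hl ⟨rfl, hw⟩
      have he := hl e (by simp)
      have h2 := hht e he trivial
      obtain ⟨i1, i2⟩ := ih _ (fun d hd => hl d (by simp [hd])) hw
      refine ⟨(hmono e he fun h => ?_).trans i1, by omega⟩
      have h3 := hht y hy trivial
      rw [h, ← hs] at i2
      omega
  obtain ⟨l, hl, hwl⟩ := Me.bipolar.exists_walk_from allCells_isClosed (v := C.src y) trivial
  have h2 := (key l _ (fun d hd => (hl d hd).1) hwl).1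
  have h3 := hmono y hy hyb
  rw [hs] at h3
  linarith

theorem src_eq_tgt (Me : Meridian C N S p q XL XR t s d₀) {p₁ p₂ : List D} {a b : D}
    (hp : p = p₁ ++ a :: b :: p₂) : C.src b = C.tgt a := by
  have hw := Me.path_p.1
  rw [hp] at hw
  obtain ⟨c, -, -, hw2⟩ := isDirectedWalk_append_iff.1 hw
  exact hw2.1

/-- The darts on the meridians at an interior vertex of a meridian. -/
theorem eq_or_eq (Me : Meridian C N S p q XL XR t s d₀) {p₁ p₂ : List D} {a b : D}
    (hp : p = p₁ ++ a :: b :: p₂) {y : D} (hy : C.src y = C.tgt a)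
    (hB : C.edge y ∈ C.pathEdges p q) : y = C.opp a ∨ y = b := by
  have ha : a ∈ p := by simp [hp]
  have hb : b ∈ p := by simp [hp]
  have hab := Me.src_eq_tgt hp
  -- An interior vertex of `p` is not a pole, so `q` does not pass through it.
  have hq : C.src y ∉ N :: q.map C.tgt := fun h => by
    rw [hy] at h
    rcases Me.disj.2 _ (List.mem_cons_of_mem _ (List.mem_map_of_mem ha)) h with h | h
    · exact Me.path_p.tgt_ne_start ha h
    · exact Me.path_p.src_ne_end hb (hab.trans h)
  rcases mem_pathEdges_iff.1 hB with h | h | h | h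
  · exact Or.inr (Me.path_p.eq_of_src_eq h hb (hy.trans hab.symm))
  · exact absurd (Me.path_q.1.src_mem h) hq
  · left
    rw [← Me.path_p.eq_of_tgt_eq h ha (by rw [tgt_opp, hy]), C.opp_opp]
  · exact absurd (List.mem_cons_of_mem _ (List.mem_map.2 ⟨_, h, C.tgt_opp y⟩)) hq

theorem side_left (Me : Meridian C N S p q XL XR t s d₀) {d : D}
    (hd : C.edge d ∉ C.pathEdges p q) : C.left d ∈ XL ↔ C.right d ∈ XL := by
  rw [Me.compl, Me.compl, Me.side d hd]

theorem left_not_mem (Me : Meridian C N S p q XL XR t s d₀) {d : D} (hd : d ∈ p) :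
    C.left d ∉ XR := (Me.compl _).1 (Me.left_mem d hd)

theorem right_not_mem (Me : Meridian C N S p q XL XR t s d₀) {d : D} (hd : d ∈ p) :
    C.right d ∉ XL := fun h => (Me.compl _).1 h (Me.right_mem d hd)

theorem s_mem (Me : Meridian C N S p q XL XR t s d₀) : s ∈ XR :=
  Me.right_bridge ▸ Me.right_mem _ Me.mem

theorem t_mem (Me : Meridian C N S p q XL XR t s d₀) : t ∈ XL :=
  Me.left_bridge ▸ Me.left_mem _ Me.mem

theorem exists_pow_rot [Finite D] {x y : D} (h : C.src y = C.src x) :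
    ∃ n : ℕ, (C.rot ^ n) x = y := (C.src_eq_iff.1 h.symm).exists_nat_pow_eq

theorem exists_pow_rot_symm [Finite D] {x y : D} (h : C.src y = C.src x) :
    ∃ n : ℕ, ((C.rot.symm : Equiv.Perm D) ^ n) x = y :=
  (sameCycle_rot_symm.2 h.symm).exists_nat_pow_eq

theorem src_rot_symm (y : D) : C.src (C.rot.symm y) = C.src y := by
  rw [← src_rot, Equiv.apply_symm_apply]

theorem left_rot_symm (y : D) : C.left (C.rot.symm y) = C.right y := by
  rw [← right_rot, Equiv.apply_symm_apply]

/-- Before the bridge, the right side of the meridian propagates. -/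
theorem step_right_before [Finite D] (Me : Meridian C N S p q XL XR t s d₀) {p₁ p₂ : List D}
    {a b : D} (hp : p = p₁ ++ a :: b :: p₂) (hd : d₀ ∈ b :: p₂) (ha : C.right a = s) :
    C.right b = s ∧ ∀ y, C.src y = C.tgt a → y ≠ C.opp a → C.left y ∉ XR := by
  have hap : a ∈ p := by simp [hp]
  have hbp : b ∈ p := by simp [hp]
  refine sector C.rot C.left C.right C.right_rot C.src_rot XR (α := C.opp a) (β := b)
    (v := C.tgt a) Me.s_mem rfl (fun y hy => exists_pow_rot (hy.trans (Me.src_eq_tgt hp).symm))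
    ha ?_ (Me.left_not_mem hbp) fun y hy h1 h2 => ?_
  · rw [right_opp]; exact Me.left_not_mem hap
  · have hB : C.edge y ∉ C.pathEdges p q := fun h => (Me.eq_or_eq hp hy h).elim h1 h2
    -- By `unique_in`, every dart here other than `opp a` is directed away from the vertex; its dual
    -- ends in `right y`, which is thus not the source `s`.
    refine ⟨Me.side y hB, Me.source y ?_ hB⟩
    refine (C.dir_or_dir_opp y).resolve_right fun h => h1 ?_
    rw [← Me.unique_in hp hd h (by rw [tgt_opp, hy]), C.opp_opp]

/-- Before the bridge, the left side of the meridian propagates. -/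
theorem step_left_before [Finite D] (Me : Meridian C N S p q XL XR t s d₀) {p₁ p₂ : List D}
    {a b : D} (hp : p = p₁ ++ a :: b :: p₂) (hd : d₀ ∈ b :: p₂) (ha : C.left a = t) :
    C.left b = t ∧ ∀ y, C.src y = C.tgt a → y ≠ C.opp a → C.right y ∉ XL := by
  have hap : a ∈ p := by simp [hp]
  have hbp : b ∈ p := by simp [hp]
  refine sector C.rot.symm C.right C.left left_rot_symm src_rot_symm XL (α := C.opp a) (β := b)
    (v := C.tgt a) Me.t_mem rfl
    (fun y hy => exists_pow_rot_symm (hy.trans (Me.src_eq_tgt hp).symm))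
    ((C.right_opp a).trans ha) (Me.right_not_mem hap) (Me.right_not_mem hbp) fun y hy h1 h2 => ?_
  have hB : C.edge y ∉ C.pathEdges p q := fun h => (Me.eq_or_eq hp hy h).elim h1 h2
  refine ⟨(Me.side_left hB).symm, Me.sink y ?_ hB⟩
  refine (C.dir_or_dir_opp y).resolve_right fun h => h1 ?_
  rw [← Me.unique_in hp hd h (by rw [tgt_opp, hy]), C.opp_opp]

/-- After the bridge, the left side of the meridian propagates backwards. -/
theorem step_left_after [Finite D] (Me : Meridian C N S p q XL XR t s d₀) {p₁ p₂ : List D}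
    {a b : D} (hp : p = p₁ ++ a :: b :: p₂) (hd : d₀ ∈ p₁ ++ [a]) (hb : C.left b = t) :
    C.left a = t ∧ ∀ y, C.src y = C.tgt a → y ≠ b → C.left y ∉ XL := by
  have hap : a ∈ p := by simp [hp]
  have hbp : b ∈ p := by simp [hp]
  have hp' : p = (p₁ ++ [a]) ++ b :: p₂ := by simpa using hp
  rw [← C.right_opp a]
  refine sector C.rot C.left C.right C.right_rot C.src_rot XL (α := b) (β := C.opp a)
    (v := C.tgt a) Me.t_mem (Me.src_eq_tgt hp) (fun y hy => exists_pow_rot hy)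
    hb (Me.right_not_mem hbp) (Me.right_not_mem hap) fun y hy h1 h2 => ?_
  have hB : C.edge y ∉ C.pathEdges p q := fun h => (Me.eq_or_eq hp hy h).elim h2 h1
  refine ⟨Me.side_left hB, ?_⟩
  -- By `unique_out`, every edge here other than that of `b` arrives at the vertex; its dual starts
  -- in `right y`, which is thus not the sink `t`.
  have hdir : C.dir (C.opp y) := (C.dir_or_dir_opp y).resolve_left fun h =>
    h1 (Me.unique_out hp' hd h (hy.trans (Me.src_eq_tgt hp).symm))
  exact Me.sink _ hdir (by simpa using hB)

/-- After the bridge, the right side of the meridian propagates backwards. -/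
theorem step_right_after [Finite D] (Me : Meridian C N S p q XL XR t s d₀) {p₁ p₂ : List D}
    {a b : D} (hp : p = p₁ ++ a :: b :: p₂) (hd : d₀ ∈ p₁ ++ [a]) (hb : C.right b = s) :
    C.right a = s ∧ ∀ y, C.src y = C.tgt a → y ≠ b → C.right y ∉ XR := by
  have hap : a ∈ p := by simp [hp]
  have hbp : b ∈ p := by simp [hp]
  have hp' : p = (p₁ ++ [a]) ++ b :: p₂ := by simpa using hp
  refine sector C.rot.symm C.right C.left left_rot_symm src_rot_symm XR (α := b) (β := C.opp a)
    (v := C.tgt a) Me.s_mem (Me.src_eq_tgt hp) (fun y hy => exists_pow_rot_symm hy)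
    hb (Me.left_not_mem hbp) ?_ fun y hy h1 h2 => ?_
  · rw [right_opp]; exact Me.left_not_mem hap
  have hB : C.edge y ∉ C.pathEdges p q := fun h => (Me.eq_or_eq hp hy h).elim h2 h1
  refine ⟨(Me.side y hB).symm, ?_⟩
  have hdir : C.dir (C.opp y) := (C.dir_or_dir_opp y).resolve_left fun h =>
    h1 (Me.unique_out hp' hd h (hy.trans (Me.src_eq_tgt hp).symm))
  have := Me.source _ hdir (by simpa using hB)
  rwa [right_opp] at this

/-- An interior vertex of a meridian lies between two consecutive edges. -/
theorem exists_split (Me : Meridian C N S p q XL XR t s d₀) {x : C.V}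
    (hx : x ∈ N :: p.map C.tgt) (hN : x ≠ N) (hS : x ≠ S) :
    ∃ p₁ a b p₂, p = p₁ ++ a :: b :: p₂ ∧ x = C.tgt a := by
  obtain ⟨a, ha, rfl⟩ := List.mem_map.1 ((List.mem_cons.1 hx).resolve_left hN)
  obtain ⟨p₁, r, hp⟩ := List.append_of_mem ha
  cases r with
  | nil =>
    have hw := Me.path_p.1
    rw [hp] at hw
    obtain ⟨c, -, -, h⟩ := isDirectedWalk_append_iff.1 hw
    exact absurd h hS
  | cons b p₂ => exact ⟨p₁, a, b, p₂, hp, rfl⟩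

theorem bridge_cases (Me : Meridian C N S p q XL XR t s d₀) {p₁ p₂ : List D} {a b : D}
    (hp : p = p₁ ++ a :: b :: p₂) : d₀ ∈ p₁ ++ [a] ∨ d₀ ∈ b :: p₂ := by
  have := Me.mem
  rw [hp] at this
  simp only [List.mem_append, List.mem_cons, List.not_mem_nil, or_false] at this ⊢
  tauto

theorem base_first (Me : Meridian C N S p q XL XR t s d₀) {P : D → Prop}
    (h : ∀ d ∈ p, C.src d = N → P d) (b : D) (p₂ : List D) (hp : p = b :: p₂) : P b := by
  have hw := Me.path_p.1
  rw [hp] at hw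
  exact h b (by simp [hp]) hw.1

theorem base_last (Me : Meridian C N S p q XL XR t s d₀) {P : D → Prop}
    (h : ∀ d ∈ p, C.tgt d = S → P d) (b : D) (p₁ : List D) (hp : p = p₁ ++ [b]) : P b := by
  have hw := Me.path_p.1
  rw [hp] at hw
  obtain ⟨c, -, -, h'⟩ := isDirectedWalk_append_iff.1 hw
  exact h b (by simp [hp]) h'

/-- If `s` is the right face of the first edge, then no edge in `XR` leaves the meridian. -/
theorem not_out_right [Finite D] (Me : Meridian C N S p q XL XR t s d₀)
    (hfirst : ∀ d ∈ p, C.src d = N → C.right d = s) {d : D} (hd : C.dir d)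
    (hB : C.edge d ∉ C.pathEdges p q) (hX : C.left d ∈ XR) (hx : C.src d ∈ N :: p.map C.tgt) :
    C.src d = N ∨ C.src d = S := by
  by_contra! hNS
  obtain ⟨p₁, a, b, p₂, hp, hs⟩ := Me.exists_split hx hNS.1 hNS.2
  -- After the bridge the meridian edge is the only outgoing one. Before it, `s` has propagated from
  -- the first edge and is the only face of `XR` at the vertex.
  rcases Me.bridge_cases hp with h | h
  · have := Me.unique_out (b := b) (p₂ := p₂) (by simpa using hp) h hd
      (hs.trans (Me.src_eq_tgt hp).symm)
    exact hB (this ▸ edge_mem_pathEdges_left (by simp [hp]))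
  · have hra := List.forward_propagation (Me.base_first hfirst)
      (fun p₁ a b p₂ hp h ha => (Me.step_right_before hp h ha).1) p₁ a (b :: p₂) hp
      (List.mem_cons_of_mem _ h)
    exact (Me.step_right_before hp h hra).2 d hs
      (fun h => (C.dir_opp a).1 (h ▸ hd) (Me.dir_p a (by simp [hp]))) hX

/-- If `t` is the left face of the first edge, then no edge in `XL` leaves the meridian. -/
theorem not_out_left [Finite D] (Me : Meridian C N S p q XL XR t s d₀)
    (hfirst : ∀ d ∈ p, C.src d = N → C.left d = t) {d : D} (hd : C.dir d)
    (hB : C.edge d ∉ C.pathEdges p q) (hX : C.left d ∈ XL) (hx : C.src d ∈ N :: p.map C.tgt) :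
    C.src d = N ∨ C.src d = S := by
  by_contra! hNS
  obtain ⟨p₁, a, b, p₂, hp, hs⟩ := Me.exists_split hx hNS.1 hNS.2
  rcases Me.bridge_cases hp with h | h
  · have := Me.unique_out (b := b) (p₂ := p₂) (by simpa using hp) h hd
      (hs.trans (Me.src_eq_tgt hp).symm)
    exact hB (this ▸ edge_mem_pathEdges_left (by simp [hp]))
  · have hra := List.forward_propagation (Me.base_first hfirst)
      (fun p₁ a b p₂ hp h ha => (Me.step_left_before hp h ha).1) p₁ a (b :: p₂) hp
      (List.mem_cons_of_mem _ h)
    exact (Me.step_left_before hp h hra).2 d hs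
      (fun h => (C.dir_opp a).1 (h ▸ hd) (Me.dir_p a (by simp [hp]))) ((Me.side_left hB).1 hX)

/-- If `t` is the left face of the last edge, then no edge in `XL` enters the meridian. -/
theorem not_in_left [Finite D] (Me : Meridian C N S p q XL XR t s d₀)
    (hlast : ∀ d ∈ p, C.tgt d = S → C.left d = t) {d : D} (hd : C.dir d)
    (hB : C.edge d ∉ C.pathEdges p q) (hX : C.left d ∈ XL) (hx : C.tgt d ∈ N :: p.map C.tgt) :
    C.tgt d = N ∨ C.tgt d = S := by
  by_contra! hNS
  obtain ⟨p₁, a, b, p₂, hp, hs⟩ := Me.exists_split hx hNS.1 hNS.2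
  -- After the bridge, `t` has propagated back from the last edge and is the only face of `XL` at
  -- the vertex. Before it, the meridian edge is the only incoming one.
  rcases Me.bridge_cases hp with h | h
  · have hlb := List.backward_propagation (Me.base_last hlast)
      (fun p₁ a b p₂ hp h hb => (Me.step_left_after hp h hb).1) p₂ (p₁ ++ [a]) b
      (by simpa using hp) (List.mem_append_left _ h)
    exact (Me.step_left_after hp h hlb).2 (C.opp d) hs
      (fun h => (C.dir_opp d).1 (h ▸ Me.dir_p b (by simp [hp])) hd) ((Me.side_left hB).1 hX)
  · exact hB (Me.unique_in hp h hd hs ▸ edge_mem_pathEdges_left (by simp [hp]))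

/-- If `s` is the right face of the last edge, then no edge in `XR` enters the meridian. -/
theorem not_in_right [Finite D] (Me : Meridian C N S p q XL XR t s d₀)
    (hlast : ∀ d ∈ p, C.tgt d = S → C.right d = s) {d : D} (hd : C.dir d)
    (hB : C.edge d ∉ C.pathEdges p q) (hX : C.left d ∈ XR) (hx : C.tgt d ∈ N :: p.map C.tgt) :
    C.tgt d = N ∨ C.tgt d = S := by
  by_contra! hNS
  obtain ⟨p₁, a, b, p₂, hp, hs⟩ := Me.exists_split hx hNS.1 hNS.2
  rcases Me.bridge_cases hp with h | h
  · have hlb := List.backward_propagation (Me.base_last hlast)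
      (fun p₁ a b p₂ hp h hb => (Me.step_right_after hp h hb).1) p₂ (p₁ ++ [a]) b
      (by simpa using hp) (List.mem_append_left _ h)
    exact (Me.step_right_after hp h hlb).2 (C.opp d) hs
      (fun h => (C.dir_opp d).1 (h ▸ Me.dir_p b (by simp [hp])) hd) (by simpa using hX)
  · exact hB (Me.unique_in hp h hd hs ▸ edge_mem_pathEdges_left (by simp [hp]))

end Meridian

end DirectedComplex

/-! ### From the dual conditions to the template. -/

namespace DirectedComplex

variable {D : Type*} {C : DirectedComplex D} {N S : C.V} {WE EW : List D} {W Ea : Set C.F}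
  {w₀ w₁ e₀ e₁ : C.F}

/-- The conditions on the dual, expressed in the complex itself. -/
structure DualData (C : DirectedComplex D) (N S : C.V) (WE EW : List D) (W Ea : Set C.F)
    (w₀ w₁ e₀ e₁ : C.F) : Prop where
  sphere : C.IsSphere
  regular : C.IsRegular
  compl : ∀ f, f ∈ Ea ↔ f ∉ W
  side : ∀ d, C.edge d ∉ C.pathEdges WE EW → (C.left d ∈ W ↔ C.right d ∈ W)
  joined_W : ∀ f ∈ W, ∀ g ∈ W, C.FacesJoinedOff (C.pathEdges WE EW) f g
  joined_Ea : ∀ f ∈ Ea, ∀ g ∈ Ea, C.FacesJoinedOff (C.pathEdges WE EW) f g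
  mem_W : w₀ ∈ W
  mem_Ea : e₀ ∈ Ea
  from_W : ∀ f ∈ W, ∃ l : List D, (∀ d ∈ l, C.dir d ∧ C.edge d ∉ C.pathEdges WE EW) ∧
    IsDirectedWalk C.left C.right w₀ f l
  to_W : ∀ f ∈ W, ∃ l : List D, (∀ d ∈ l, C.dir d ∧ C.edge d ∉ C.pathEdges WE EW) ∧
    IsDirectedWalk C.left C.right f w₁ l
  from_Ea : ∀ f ∈ Ea, ∃ l : List D, (∀ d ∈ l, C.dir d ∧ C.edge d ∉ C.pathEdges WE EW) ∧
    IsDirectedWalk C.left C.right e₀ f l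
  to_Ea : ∀ f ∈ Ea, ∃ l : List D, (∀ d ∈ l, C.dir d ∧ C.edge d ∉ C.pathEdges WE EW) ∧
    IsDirectedWalk C.left C.right f e₁ l
  source_W : ∀ d, C.dir d → C.edge d ∉ C.pathEdges WE EW → C.right d ≠ w₀
  sink_W : ∀ d, C.dir d → C.edge d ∉ C.pathEdges WE EW → C.left d ≠ w₁
  source_Ea : ∀ d, C.dir d → C.edge d ∉ C.pathEdges WE EW → C.right d ≠ e₀
  sink_Ea : ∀ d, C.dir d → C.edge d ∉ C.pathEdges WE EW → C.left d ≠ e₁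
  height : ∃ ht : C.F → ℕ, ∀ d, C.dir d → C.edge d ∉ C.pathEdges WE EW →
    ht (C.left d) < ht (C.right d)
  tgt_ne_N : ∀ d, C.dir d → C.tgt d ≠ N
  src_ne_S : ∀ d, C.dir d → C.src d ≠ S
  polar_w₀ : ∃ d, C.src d = N ∧ C.right d = w₀
  polar_w₁ : ∃ d, C.src d = N ∧ C.left d = w₁
  polar_e₀ : ∃ d, C.tgt d = S ∧ C.right d = e₀
  polar_e₁ : ∃ d, C.tgt d = S ∧ C.left d = e₁
  dir_WE : ∀ d ∈ WE, C.dir d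
  path_WE : IsDirectedPath C.src C.tgt N S WE
  dir_EW : ∀ d ∈ EW, C.dir d
  path_EW : IsDirectedPath C.src C.tgt N S EW
  disj : PathsDisjoint C.tgt N S WE EW
  bridge_WE : ∃ d ∈ WE, C.left d = e₁ ∧ C.right d = w₀
  bridge_EW : ∃ d ∈ EW, C.left d = w₁ ∧ C.right d = e₀

namespace DualData

theorem hemi (G : DualData C N S WE EW W Ea w₀ w₁ e₀ e₁) :
    C.AreHemispheres (C.pathEdges WE EW) W Ea := by
  have hE : Ea = Wᶜ := Set.ext G.compl
  refine ⟨⟨_, G.mem_W⟩, ⟨_, G.mem_Ea⟩, hE ▸ isCompl_compl, fun f g => ⟨fun h => ?_, fun h => ?_⟩⟩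
  · induction h with
    | rel f g h => obtain ⟨d, hd, rfl, rfl⟩ := h; exact G.side d hd
    | refl => rfl
    | symm _ _ _ ih => exact ih.symm
    | trans _ _ _ _ _ ih1 ih2 => exact ih1.trans ih2
  · by_cases hf : f ∈ W
    · exact G.joined_W f hf g (h.1 hf)
    · exact G.joined_Ea f ((G.compl f).2 hf) g ((G.compl g).2 fun hg => hf (h.2 hg))

/-- The bridge in `WE` has `w₀` on its right; this single edge decides the sides of the whole
meridian cycle. -/
theorem sides [Finite D] (G : DualData C N S WE EW W Ea w₀ w₁ e₀ e₁) :
    (∀ d ∈ WE, C.left d ∈ Ea ∧ C.right d ∈ W) ∧ ∀ d ∈ EW, C.right d ∈ Ea ∧ C.left d ∈ W := by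
  obtain ⟨ph, hp, hq, hc⟩ := G.sphere.exists_jump G.dir_WE G.dir_EW G.path_WE.1 G.path_EW.1
    G.disj.1
  obtain ⟨d₀, h0, -, h2⟩ := G.bridge_WE
  exact ⟨fun d hd => G.hemi.sides ph hc (hp _ h0) (hp _ hd) (h2 ▸ G.mem_W),
    fun d hd => G.hemi.sides ph hc (hp _ h0) (hq _ hd) (h2 ▸ G.mem_W)⟩

/-- A directed cycle would bound a region that the dual, which is strongly connected, could only
enter. -/
theorem not_cycle [Finite D] (G : DualData C N S WE EW W Ea w₀ w₁ e₀ e₁) {l : List D} (hl : l ≠ [])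
    (hl' : ∀ d ∈ l, C.dir d) (v : C.V) : ¬ IsDirectedWalk C.src C.tgt v v l := by
  intro hw
  obtain ⟨h, hh⟩ := G.sphere.exists_face_potential hw
  have hmono : ∀ d, C.dir d → h (C.left d) ≤ h (C.right d) := fun d hd => by
    rw [← sub_nonneg, hh]; exact chain_nonneg (C.opp_not_mem hl' hd)
  have hwalk : ∀ {f g} {m : List D}, (∀ d ∈ m, C.dir d ∧ C.edge d ∉ C.pathEdges WE EW) →
      IsDirectedWalk C.left C.right f g m → h f ≤ h g := fun hm hw =>
    hw.monotone h fun d hd => hmono d (hm d hd).1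
  obtain ⟨a, ha, ha1, ha2⟩ := G.bridge_WE
  obtain ⟨b, hb, hb1, hb2⟩ := G.bridge_EW
  have h1 := hmono a (G.dir_WE a ha)
  have h2 := hmono b (G.dir_EW b hb)
  rw [ha1, ha2] at h1
  rw [hb1, hb2] at h2
  have hW : ∀ f ∈ W, h w₀ ≤ h f ∧ h f ≤ h w₁ := fun f hf => by
    obtain ⟨m, hm, hw⟩ := G.from_W f hf
    obtain ⟨m', hm', hw'⟩ := G.to_W f hf
    exact ⟨hwalk hm hw, hwalk hm' hw'⟩
  have hE : ∀ f ∈ Ea, h e₀ ≤ h f ∧ h f ≤ h e₁ := fun f hf => by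
    obtain ⟨m, hm, hw⟩ := G.from_Ea f hf
    obtain ⟨m', hm', hw'⟩ := G.to_Ea f hf
    exact ⟨hwalk hm hw, hwalk hm' hw'⟩
  have hW0 := hW w₀ G.mem_W
  have hE0 := hE e₀ G.mem_Ea
  -- Cores and bridges close the chain `h w₀ ≤ h w₁ ≤ h e₀ ≤ h e₁ ≤ h w₀`.
  have hconst : ∀ f, h f = h w₀ := fun f => by
    by_cases hf : f ∈ W
    · have := hW f hf; linarith
    · have := hE f ((G.compl f).2 hf); linarith
  obtain ⟨d, hd⟩ := List.exists_mem_of_ne_nil _ hl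
  have := chain_pos hd (C.opp_not_mem hl' (hl' d hd))
  rw [← hh, hconst, hconst (C.left d), sub_self] at this
  exact lt_irrefl _ this

theorem edge_not_mem (G : DualData C N S WE EW W Ea w₀ w₁ e₀ e₁) {d : D}
    (h : C.src d ∉ C.pathVerts N WE EW) : C.edge d ∉ C.pathEdges WE EW := by
  intro hB
  refine h ?_
  rcases mem_pathEdges_iff.1 hB with h | h | h | h
  · exact Or.inl (G.path_WE.1.src_mem h)
  · exact Or.inr (G.path_EW.1.src_mem h)
  · exact Or.inl (List.mem_cons_of_mem _ (List.mem_map.2 ⟨_, h, C.tgt_opp d⟩))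
  · exact Or.inr (List.mem_cons_of_mem _ (List.mem_map.2 ⟨_, h, C.tgt_opp d⟩))

/-- If all edges at a vertex off the meridians pointed the same way, their duals would form a
directed cycle around it, against the height function of the cores. -/
theorem bipolar [Finite D] (G : DualData C N S WE EW W Ea w₀ w₁ e₀ e₁) :
    C.allCells.IsBipolar N S := by
  obtain ⟨ht, hht⟩ := G.height
  refine Cells.isBipolar_of_unique ⟨N, trivial⟩ allCells_isClosed
    (fun l h1 h2 v => G.not_cycle h1 (fun d hd => (h2 d hd).1) v) ?_ ?_
  · intro v _ hv
    replace hv := fun d hd => hv d hd trivial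
    by_contra hN
    have hP : v ∉ C.pathVerts N WE EW := by
      rintro (h | h)
      · obtain ⟨d, hd, rfl⟩ := List.mem_map.1 ((List.mem_cons.1 h).resolve_left hN)
        exact hv d (G.dir_WE d hd) rfl
      · obtain ⟨d, hd, rfl⟩ := List.mem_map.1 ((List.mem_cons.1 h).resolve_left hN)
        exact hv d (G.dir_EW d hd) rfl
    obtain ⟨d, hd, hmin⟩ := Set.exists_min_image {d | C.src d = v} (fun d => ht (C.left d))
      (Set.toFinite _) (C.exists_src v)
    have hr : C.src (C.rot d) = v := (C.src_rot d).trans hd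
    have hdir : C.dir (C.rot d) := (C.dir_or_dir_opp _).resolve_right fun h =>
      hv _ h ((C.tgt_opp _).trans hr)
    have h1 := hht _ hdir (G.edge_not_mem (hr ▸ hP))
    have h2 := hmin _ hr
    rw [right_rot] at h1
    omega
  · intro v _ hv
    replace hv := fun d hd => hv d hd trivial
    by_contra hS
    have hP : v ∉ C.pathVerts N WE EW := by
      rintro (h | h)
      · obtain ⟨d, hd, rfl⟩ := List.mem_map.1
          (((G.path_WE.1.mem_verts_iff v).1 h).resolve_right hS)
        exact hv d (G.dir_WE d hd) rfl
      · obtain ⟨d, hd, rfl⟩ := List.mem_map.1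
          (((G.path_EW.1.mem_verts_iff v).1 h).resolve_right hS)
        exact hv d (G.dir_EW d hd) rfl
    obtain ⟨d, hd, hmax⟩ := Set.exists_max_image {d | C.src d = v} (fun d => ht (C.left d))
      (Set.toFinite _) (C.exists_src v)
    have hr : C.src (C.rot d) = v := (C.src_rot d).trans hd
    have hdir : C.dir (C.opp (C.rot d)) := (C.dir_or_dir_opp _).resolve_left fun h => hv _ h hr
    have h1 := hht _ hdir (by rw [edge_opp]; exact G.edge_not_mem (hr ▸ hP))
    have h2 := hmax _ hr
    rw [right_opp, left_opp, right_rot] at h1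
    omega

theorem exists_meridian_WE [Finite D] (G : DualData C N S WE EW W Ea w₀ w₁ e₀ e₁) :
    ∃ d₀, Meridian C N S WE EW Ea W e₁ w₀ d₀ := by
  obtain ⟨d₀, h0, h1, h2⟩ := G.bridge_WE
  exact ⟨d₀, G.sphere, G.bipolar, G.dir_WE, G.dir_EW, G.path_WE, G.path_EW, G.disj, G.compl, G.side,
    fun d hd => (G.sides.1 d hd).1, fun d hd => (G.sides.1 d hd).2, G.from_W, G.to_Ea, G.source_W,
    G.sink_Ea, h0, h1, h2⟩

/-- Along `EW` the sides are exchanged: the West is on the left with sink `w₁`, the East on the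
right with source `e₀`. -/
theorem exists_meridian_EW [Finite D] (G : DualData C N S WE EW W Ea w₀ w₁ e₀ e₁) :
    ∃ d₀, Meridian C N S EW WE W Ea w₁ e₀ d₀ := by
  obtain ⟨d₀, h0, h1, h2⟩ := G.bridge_EW
  refine ⟨d₀, G.sphere, G.bipolar, G.dir_EW, G.dir_WE, G.path_EW, G.path_WE,
    PathsDisjoint.symm G.disj, fun f => ?_, ?_,
    fun d hd => (G.sides.2 d hd).2, fun d hd => (G.sides.2 d hd).1, ?_, ?_, ?_, ?_, h0, h1, h2⟩
  · rw [G.compl, not_not]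
  · intro d hd
    rw [pathEdges_comm] at hd
    rw [G.compl, G.compl, G.side d hd]
  · rw [pathEdges_comm]; exact G.from_Ea
  · rw [pathEdges_comm]; exact G.to_W
  · rw [pathEdges_comm]; exact G.source_Ea
  · rw [pathEdges_comm]; exact G.sink_W

theorem mem_cases (G : DualData C N S WE EW W Ea w₀ w₁ e₀ e₁) {d : D} (hd : C.dir d)
    (hB : C.edge d ∈ C.pathEdges WE EW) : d ∈ WE ∨ d ∈ EW :=
  (mem_pathEdges_iff_of_dir G.dir_WE G.dir_EW hd).1 hB

theorem w₁_mem [Finite D] (G : DualData C N S WE EW W Ea w₀ w₁ e₀ e₁) : w₁ ∈ W := by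
  obtain ⟨d, hd, h, -⟩ := G.bridge_EW
  exact h ▸ (G.sides.2 d hd).2

theorem e₁_mem [Finite D] (G : DualData C N S WE EW W Ea w₀ w₁ e₀ e₁) : e₁ ∈ Ea := by
  obtain ⟨d, hd, h, -⟩ := G.bridge_WE
  exact h ▸ (G.sides.1 d hd).1

theorem dir_of_src_eq_N (G : DualData C N S WE EW W Ea w₀ w₁ e₀ e₁) {d : D} (hd : C.src d = N) :
    C.dir d :=
  (C.dir_or_dir_opp d).resolve_right fun h => G.tgt_ne_N _ h (by rw [tgt_opp, hd])

theorem dir_of_tgt_eq_S (G : DualData C N S WE EW W Ea w₀ w₁ e₀ e₁) {d : D} (hd : C.tgt d = S) :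
    C.dir d :=
  (C.dir_or_dir_opp d).resolve_right fun h => G.src_ne_S _ h (by rw [src_opp, hd])

/-- The polar circle provides an edge at `N` with `w₀` on its right. Its dual enters the source of
the core, so the edge is on a meridian, and its sides single out `WE`. The three lemmas that follow
argue alike. -/
theorem first_WE [Finite D] (G : DualData C N S WE EW W Ea w₀ w₁ e₀ e₁) :
    ∀ d ∈ WE, C.src d = N → C.right d = w₀ := by
  intro d hd hN
  obtain ⟨x, hx, rfl⟩ := G.polar_w₀
  have hdir := G.dir_of_src_eq_N hx
  have hB : C.edge x ∈ C.pathEdges WE EW := by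
    by_contra hB; exact G.source_W x hdir hB rfl
  rcases G.mem_cases hdir hB with h | h
  · rw [G.path_WE.eq_of_src_eq hd h (hN.trans hx.symm)]
  · exact absurd G.mem_W ((G.compl _).1 (G.sides.2 x h).1)

theorem first_EW [Finite D] (G : DualData C N S WE EW W Ea w₀ w₁ e₀ e₁) :
    ∀ d ∈ EW, C.src d = N → C.left d = w₁ := by
  intro d hd hN
  obtain ⟨x, hx, h1⟩ := G.polar_w₁
  have hdir := G.dir_of_src_eq_N hx
  have hB : C.edge x ∈ C.pathEdges WE EW := by
    by_contra hB; exact G.sink_W x hdir hB h1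
  rcases G.mem_cases hdir hB with h | h
  · exact absurd (h1 ▸ G.w₁_mem) ((G.compl _).1 (G.sides.1 x h).1)
  · rw [G.path_EW.eq_of_src_eq hd h (hN.trans hx.symm), h1]

theorem last_WE [Finite D] (G : DualData C N S WE EW W Ea w₀ w₁ e₀ e₁) :
    ∀ d ∈ WE, C.tgt d = S → C.left d = e₁ := by
  intro d hd hS
  obtain ⟨x, hx, h1⟩ := G.polar_e₁
  have hdir := G.dir_of_tgt_eq_S hx
  have hB : C.edge x ∈ C.pathEdges WE EW := by
    by_contra hB; exact G.sink_Ea x hdir hB h1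
  rcases G.mem_cases hdir hB with h | h
  · rw [G.path_WE.eq_of_tgt_eq hd h (hS.trans hx.symm), h1]
  · exact absurd (G.sides.2 x h).2 ((G.compl _).1 (h1 ▸ G.e₁_mem))

theorem last_EW [Finite D] (G : DualData C N S WE EW W Ea w₀ w₁ e₀ e₁) :
    ∀ d ∈ EW, C.tgt d = S → C.right d = e₀ := by
  intro d hd hS
  obtain ⟨x, hx, rfl⟩ := G.polar_e₀
  have hdir := G.dir_of_tgt_eq_S hx
  have hB : C.edge x ∈ C.pathEdges WE EW := by
    by_contra hB; exact G.source_Ea x hdir hB rfl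
  rcases G.mem_cases hdir hB with h | h
  · exact absurd (G.sides.1 x h).2 ((G.compl _).1 G.mem_Ea)
  · rw [G.path_EW.eq_of_tgt_eq hd h (hS.trans hx.symm)]

theorem edge_mem_faceEdges_left (d : D) : C.edge d ∈ C.faceEdges (C.left d) := ⟨d, rfl, rfl⟩

theorem edge_mem_faceEdges_right (d : D) : C.edge d ∈ C.faceEdges (C.right d) :=
  ⟨C.opp d, rfl, C.edge_opp d⟩

/-- For the overlaps: the bridge in `WE` lies between `w₀`, the Western face at the first edge, and
`e₁`, the Eastern face at the last edge; so it is the shared edge. The same holds for `EW` with `w₁`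
and `e₀`. -/
theorem isTemplateBoundary [Finite D] (G : DualData C N S WE EW W Ea w₀ w₁ e₀ e₁) :
    C.IsTemplateBoundary := by
  obtain ⟨d₁, M₁⟩ := G.exists_meridian_WE
  obtain ⟨d₂, M₂⟩ := G.exists_meridian_EW
  refine ⟨G.sphere, G.regular, N, S, WE, EW, W, Ea, G.bipolar, ⟨G.dir_WE, G.path_WE⟩,
    ⟨G.dir_EW, G.path_EW⟩, G.disj, G.hemi, ?_, ?_, ?_, ?_⟩
  · rintro d hd hB hX (hx | hx)
    · exact M₁.not_out_right G.first_WE hd hB hX hx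
    · exact M₂.not_out_left G.first_EW hd (by rwa [pathEdges_comm]) hX hx
  · rintro d hd hB hX (hx | hx)
    · exact M₁.not_in_left G.last_WE hd hB hX hx
    · exact M₂.not_in_right G.last_EW hd (by rwa [pathEdges_comm]) hX hx
  · have hne := List.ne_nil_of_mem M₁.mem
    obtain ⟨a, ha, ha0, ha1⟩ := exists_first G.path_WE.1 hne
    obtain ⟨b, hb, hb0, hb1⟩ := exists_last G.path_WE.1 hne
    refine ⟨w₀, G.mem_W, e₁, G.e₁_mem, ⟨a, ha0, ?_⟩, ⟨b, hb0, ?_⟩, d₁, M₁.mem, ?_, ?_⟩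
    · rw [← G.first_WE a ha ha1]; exact edge_mem_faceEdges_right a
    · rw [← G.last_WE b hb hb1]; exact edge_mem_faceEdges_left b
    · rw [← M₁.right_bridge]; exact edge_mem_faceEdges_right d₁
    · rw [← M₁.left_bridge]; exact edge_mem_faceEdges_left d₁
  · have hne := List.ne_nil_of_mem M₂.mem
    obtain ⟨a, ha, ha0, ha1⟩ := exists_first G.path_EW.1 hne
    obtain ⟨b, hb, hb0, hb1⟩ := exists_last G.path_EW.1 hne
    refine ⟨w₁, G.w₁_mem, e₀, G.mem_Ea, ⟨a, ha0, ?_⟩, ⟨b, hb0, ?_⟩, d₂, M₂.mem, ?_, ?_⟩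
    · rw [← G.first_EW a ha ha1]; exact edge_mem_faceEdges_left a
    · rw [← G.last_EW b hb hb1]; exact edge_mem_faceEdges_right b
    · rw [← M₂.left_bridge]; exact edge_mem_faceEdges_left d₂
    · rw [← M₂.right_bridge]; exact edge_mem_faceEdges_right d₂

end DualData

end DirectedComplex

/-! ### Reading the dual conditions in the predual. -/

namespace DirectedComplex

variable {D : Type*} {C : DirectedComplex D}

theorem DecomposesInto.not_mem_edges {M : DirectedComplex D} {k : ℕ} {P : Fin k → M.Cells}
    (h : M.DecomposesInto P) {i j : Fin k} (hij : i ≠ j) {e : M.E} (hi : e ∈ (P i).edges) :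
    e ∉ (P j).edges := fun hj => hij ((h.2.1 e).unique hi hj)

theorem DecomposesInto.not_mem_verts {M : DirectedComplex D} {k : ℕ} {P : Fin k → M.Cells}
    (h : M.DecomposesInto P) {i j : Fin k} (hij : i ≠ j) {v : M.V} (hi : v ∈ (P i).verts) :
    v ∉ (P j).verts := fun hj => hij ((h.1 v).unique hi hj)

theorem isDirectedPath_of_dual {a b : C.V} {p : List D}
    (hp : IsDirectedPath C.dual.right C.dual.left (C.dualFace a) (C.dualFace b) p) :
    IsDirectedPath C.src C.tgt a b p := by
  refine ⟨?_, ?_⟩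
  · have := hp.1
    clear hp
    induction p generalizing a with
    | nil => exact C.dualFace.injective this
    | cons d l ih =>
      refine ⟨C.dualFace.injective this.1, ih ?_⟩
      rw [← dual_left]
      exact this.2
  · have := hp.2
    rw [map_dual_left] at this
    exact this.of_map _

theorem pathsDisjoint_of_dual {a b : C.V} {p q : List D}
    (h : PathsDisjoint C.dual.left (C.dualFace a) (C.dualFace b) p q) :
    PathsDisjoint C.tgt a b p q := by
  refine ⟨h.1, fun x hx hx' => ?_⟩
  have := h.2 (C.dualFace x) (by rw [map_dual_left]; exact List.mem_map_of_mem hx)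
    (by rw [map_dual_left]; exact List.mem_map_of_mem hx')
  exact this.imp (fun h => C.dualFace.injective h) fun h => C.dualFace.injective h

/-- A planar Sturm core whose edges are the edges off `B` in the region `X`. -/
structure IsSturmRegion (C : DirectedComplex D) (B : Set C.E) (X : Set C.F) (n s : C.F) :
    Prop where
  joined : ∀ f ∈ X, ∀ g ∈ X, C.FacesJoinedOff B f g
  mem : n ∈ X
  walk_from : ∀ f ∈ X, ∃ l : List D, (∀ d ∈ l, C.dir d ∧ C.edge d ∉ B) ∧
    IsDirectedWalk C.left C.right n f l
  walk_to : ∀ f ∈ X, ∃ l : List D, (∀ d ∈ l, C.dir d ∧ C.edge d ∉ B) ∧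
    IsDirectedWalk C.left C.right f s l
  source : ∀ d, C.dir d → C.edge d ∉ B → C.right d ≠ n
  sink : ∀ d, C.dir d → C.edge d ∉ B → C.left d ≠ s
  height : ∃ ht : C.F → ℕ, ∀ d, C.dir d → C.edge d ∉ B → C.left d ∈ X →
    ht (C.left d) < ht (C.right d)

/-- Every edge off `B` with a face in the region belongs to `K`, so bipolarity of `K` controls all
of them. -/
theorem Cells.IsPlanarSturm.isSturmRegion [Finite D] {K : C.dual.Cells} {n s : C.dual.V}
    (hK : K.IsPlanarSturm n s) {B : Set C.E}
    (hB : ∀ d, C.dual.edge d ∈ K.edges → C.edge d ∉ B)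
    (hside : ∀ d, C.edge d ∉ B → (C.left d ∈ (K.verts : Set C.F) ↔ C.right d ∈ (K.verts : Set C.F)))
    (hedge : ∀ d, C.edge d ∉ B → C.left d ∈ (K.verts : Set C.F) → C.dual.edge d ∈ K.edges) :
    IsSturmRegion C B K.verts n s := by
  obtain ⟨hcl, -, ⟨-, hj, -⟩, hb, hn, hs⟩ := hK
  refine ⟨fun f hf g hg => ?_, hn.1, fun f hf => ?_, fun f hf => ?_, fun d hd hdB h => ?_,
    fun d hd hdB h => ?_, ?_⟩
  · refine Relation.EqvGen.mono ?_ _ _ (hj f hf g hg)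
    rintro u v ⟨d, hd, rfl, rfl⟩
    exact ⟨d, hB d hd, rfl, rfl⟩
  · obtain ⟨l, hl, hw⟩ := hb.exists_walk_from hcl hf
    exact ⟨l, fun d hd => ⟨(hl d hd).1, hB d (hl d hd).2⟩, hw⟩
  · obtain ⟨l, hl, hw⟩ := hb.exists_walk_to hcl hf
    exact ⟨l, fun d hd => ⟨(hl d hd).1, hB d (hl d hd).2⟩, hw⟩
  · exact ((hb.2.1 n).2 rfl).2 d hd (hedge d hdB ((hside d hdB).2 (h ▸ hn.1))) h
  · exact ((hb.2.2 s).2 rfl).2 d hd (hedge d hdB (h ▸ hs.1)) h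
  · obtain ⟨ht, hht⟩ := hb.exists_height
    exact ⟨ht, fun d hd hdB hl => hht d hd (hedge d hdB hl)⟩

theorem IsPolarSegment.exists_darts {K : C.dual.Cells} {v : C.V} {a b : C.dual.V}
    (h : C.dual.IsPolarSegment K (C.dualFace v) a b) :
    (∃ d, C.tgt d = v ∧ C.left d = a) ∧ ∃ d, C.tgt d = v ∧ C.left d = b := by
  obtain ⟨⟨l, -, hp, hv, -⟩, -⟩ := h
  have key : ∀ x : C.dual.V, x ∈ a :: l.map C.dual.tgt → ∃ d, C.tgt d = v ∧ C.left d = x := by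
    intro x hx
    have : x ∈ K.verts ∩ C.dual.faceVertices (C.dualFace v) := by rw [hv]; exact hx
    obtain ⟨-, d, h1, h2⟩ := this
    rw [dual_left, C.dualFace.injective.eq_iff] at h1
    exact ⟨d, h1, h2⟩
  exact ⟨key a (by simp), key b ((hp.1.mem_verts_iff b).2 (Or.inr rfl))⟩

theorem DualConditions.exists_dualData [Finite D] (h : C.dual.DualConditions) :
    ∃ N S WE EW W Ea w₀ w₁ e₀ e₁, DualData C N S WE EW W Ea w₀ w₁ e₀ e₁ := by
  obtain ⟨hsph, hreg, N, S, W, Ea, EW, WE, w₀, w₁, e₀, e₁, hdec, hW, hE, hEW, hWE, hN, hS, hsW, hsE,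
    -, ⟨p, q, ⟨hp, pp, ep⟩, ⟨hq, pq, eq⟩, hd⟩, ⟨d₁, hd₁, hm₁, hl₁, hr₁⟩,
    ⟨d₂, hd₂, hm₂, hl₂, hr₂⟩⟩ := h
  obtain ⟨N, rfl⟩ := C.dualFace.surjective N
  obtain ⟨S, rfl⟩ := C.dualFace.surjective S
  have hreg' := C.isRegular_dual.1 hreg
  have hcompl : ∀ f, f ∈ Ea.verts ↔ f ∉ W.verts := by
    intro f
    refine ⟨fun h => hdec.not_mem_verts (i := 3) (j := 2) (by decide) h, fun h => ?_⟩
    obtain ⟨i, hi, -⟩ := hdec.1 f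
    match i, hi with
    | 0, hi => exact absurd hi id
    | 1, hi => exact absurd hi id
    | 2, hi => exact absurd hi h
    | 3, hi => exact hi
    | 4, hi => exact absurd (hEW ▸ hi : f ∈ (∅ : Set C.dual.V)) id
    | 5, hi => exact absurd (hWE ▸ hi : f ∈ (∅ : Set C.dual.V)) id
  have hBiff : ∀ d, C.edge d ∈ C.pathEdges q p ↔
      C.dual.edge d ∈ WE.edges ∨ C.dual.edge d ∈ EW.edges := by
    intro d
    rw [ep, eq]
    constructor
    · rintro ⟨x, hx | hx, h⟩
      · exact Or.inl (List.mem_map.2 ⟨x, hx, h⟩)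
      · exact Or.inr (List.mem_map.2 ⟨x, hx, h⟩)
    · rintro (h | h)
      · obtain ⟨x, hx, h⟩ := List.mem_map.1 h
        exact ⟨x, Or.inl hx, h⟩
      · obtain ⟨x, hx, h⟩ := List.mem_map.1 h
        exact ⟨x, Or.inr hx, h⟩
  have hcases : ∀ d, C.edge d ∉ C.pathEdges q p →
      C.dual.edge d ∈ W.edges ∨ C.dual.edge d ∈ Ea.edges := by
    intro d hB
    rw [hBiff, not_or] at hB
    obtain ⟨i, hi, -⟩ := hdec.2.1 (C.dual.edge d)
    match i, hi with
    | 0, hi => exact absurd hi id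
    | 1, hi => exact absurd hi id
    | 2, hi => exact Or.inl hi
    | 3, hi => exact Or.inr hi
    | 4, hi => exact absurd hi hB.2
    | 5, hi => exact absurd hi hB.1
  have hWB : ∀ d, C.dual.edge d ∈ W.edges → C.edge d ∉ C.pathEdges q p := fun d hd hB =>
    ((hBiff d).1 hB).elim (hdec.not_mem_edges (i := 2) (j := 5) (by decide) hd)
      (hdec.not_mem_edges (i := 2) (j := 4) (by decide) hd)
  have hEB : ∀ d, C.dual.edge d ∈ Ea.edges → C.edge d ∉ C.pathEdges q p := fun d hd hB =>
    ((hBiff d).1 hB).elim (hdec.not_mem_edges (i := 3) (j := 5) (by decide) hd)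
      (hdec.not_mem_edges (i := 3) (j := 4) (by decide) hd)
  have hends : ∀ (K : C.dual.Cells), K.IsClosed → ∀ d, C.dual.edge d ∈ K.edges →
      C.left d ∈ (K.verts : Set C.F) ∧ C.right d ∈ (K.verts : Set C.F) := fun K hK d hd =>
    ⟨hK.1 d hd, hK.1 (C.opp d) (by rw [dual_edge, edge_opp]; exact hd)⟩
  have hside : ∀ d, C.edge d ∉ C.pathEdges q p →
      (C.left d ∈ (W.verts : Set C.F) ↔ C.right d ∈ (W.verts : Set C.F)) := by
    intro d hB
    rcases hcases d hB with h | h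
    · have := hends W hW.1 d h
      exact iff_of_true this.1 this.2
    · have := hends Ea hE.1 d h
      exact iff_of_false ((hcompl _).1 this.1) ((hcompl _).1 this.2)
  have hside' : ∀ d, C.edge d ∉ C.pathEdges q p →
      (C.left d ∈ (Ea.verts : Set C.F) ↔ C.right d ∈ (Ea.verts : Set C.F)) := fun d hB =>
    (hcompl _).trans ((not_congr (hside d hB)).trans (hcompl _).symm)
  have RW := hW.isSturmRegion hWB hside fun d hB hl => (hcases d hB).resolve_right fun h =>
    (hcompl _).1 (hends Ea hE.1 d h).1 hl
  have RE := hE.isSturmRegion hEB hside' fun d hB hl => (hcases d hB).resolve_left fun h =>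
    (hcompl _).1 hl (hends W hW.1 d h).1
  obtain ⟨⟨a₀, ha₀, ha₀'⟩, ⟨a₁, ha₁, ha₁'⟩⟩ := IsPolarSegment.exists_darts hsW
  obtain ⟨⟨b₀, hb₀, hb₀'⟩, ⟨b₁, hb₁, hb₁'⟩⟩ := IsPolarSegment.exists_darts hsE
  refine ⟨N, S, q, p, W.verts, Ea.verts, w₀, w₁, e₀, e₁, C.isSphere_dual.1 hsph, hreg', hcompl,
    hside, RW.joined, RE.joined, RW.mem, RE.mem, RW.walk_from, RW.walk_to, RE.walk_from, RE.walk_to,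
    RW.source, RW.sink, RE.source, RE.sink, ?_, ?_, ?_, ?_, ?_, ?_, ?_, hq,
    isDirectedPath_of_dual pq, hp, isDirectedPath_of_dual pp,
    PathsDisjoint.symm (pathsDisjoint_of_dual hd), ?_, ?_⟩
  -- No edge off the meridians joins the two cores, so their heights combine without compatibility
  -- conditions.
  · classical
    obtain ⟨h₁, hh₁⟩ := RW.height
    obtain ⟨h₂, hh₂⟩ := RE.height
    refine ⟨fun f => if f ∈ (W.verts : Set C.F) then h₁ f else h₂ f, fun d hd hB => ?_⟩
    by_cases hl : C.left d ∈ (W.verts : Set C.F)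
    · have hr := (hside d hB).1 hl
      simp only [hl, hr, if_true]
      exact hh₁ d hd hB hl
    · have hr : C.right d ∉ (W.verts : Set C.F) := fun h => hl ((hside d hB).2 h)
      simp only [hl, hr, if_false]
      exact hh₂ d hd hB ((hcompl _).2 hl)
  -- The dual of a directed edge into `N` has the polar face on its left; the clockwise orientation
  -- puts it on the right as well, so the edge would be a loop.
  · intro d hd h
    have := hN d hd ⟨d, by rw [dual_left, h], rfl⟩
    rw [dual_right, C.dualFace.injective.eq_iff] at this
    exact hreg'.1 d (this.trans h.symm)
  · intro d hd h
    have := hS d hd ⟨C.opp d, by rw [dual_left, tgt_opp, h], C.edge_opp d⟩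
    rw [dual_left, C.dualFace.injective.eq_iff] at this
    exact hreg'.1 d (h.trans this.symm)
  -- The given darts end at the pole with the core pole on their left; `opp` and `facePerm` pass to
  -- the sense, or to the neighbouring boundary edge, that is required.
  · exact ⟨C.opp a₀, ha₀, by rw [right_opp]; exact ha₀'⟩
  · exact ⟨C.facePerm a₁, by rw [src_facePerm, ha₁], by rw [left_facePerm]; exact ha₁'⟩
  · exact ⟨C.opp (C.facePerm b₀), by rw [tgt_opp, src_facePerm, hb₀],
      by rw [right_opp, left_facePerm]; exact hb₀'⟩
  · exact ⟨b₁, hb₁, hb₁'⟩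
  · rw [eq] at hm₁
    exact ⟨d₁, (edge_mem_map_iff hq hd₁).1 hm₁, hl₁, hr₁⟩
  · rw [ep] at hm₂
    exact ⟨d₂, (edge_mem_map_iff hp hd₂).1 hm₂, hl₂, hr₂⟩

end DirectedComplex

theorem lemma5p1 {D : Type*} [Finite D] (M : DirectedComplex D) :
    (∃ C : DirectedComplex D, C.IsTemplateBoundary ∧ M = C.dual) ↔ M.DualConditions := by
  constructor
  · rintro ⟨C, hC, rfl⟩
    obtain ⟨_, _, _, _, _, _, T⟩ := hC.exists_oriented
    exact T.dualConditions
  · intro h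
    obtain ⟨C, rfl⟩ := M.exists_eq_dual
    obtain ⟨_, _, _, _, _, _, _, _, _, _, G⟩ :=
      DirectedComplex.DualConditions.exists_dualData h
    exact ⟨C, G.isTemplateBoundary, rfl⟩
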